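/- Let $X=\{X_t;\,t\in[0,1]\}$ be a centered Gaussian process with covariance function $R$, and for $n\ge 1$ put $$V_n(X)=\sum_{k=1}^{n-1}\bigl[X_{(k+1)/n}+X_{(k-1)/n}-2X_{k/n}\bigr]^2 .$$ Write $\delta_1^hR(s,t)=R(s+h,t)+R(s-h,t)-2R(s,t)$ and $\delta_2^hR(s,t)=R(s,t+h)+R(s,t-h)-2R(s,t)$. Assume the following. 1. $R$ is continuous on $[0,1]^2$. 2. The derivative $\frac{\partial^4R}{\partial s^2\partial t^2}$ exists on $]0,1]^2\setminus\{s=t\}$, and there are a continuous function $C:T=\{0\le t\le s\le1\}\to\mathbb R$, a real $\gamma\in\,]0,2[$ and a positive Borel function $L:\,]0,1[\,\to\,]0,\infty[$, bounded on every compact subinterval of $]0,1[$ and slowly varying at $0$ (that is, $L(\lambda x)/L(x)\to1$ as $x\to0^+$ for every $\lambda>0$), such that $$\frac{(s-t)^{2+\gamma}}{L(s-t)}\,\frac{\partial^4R}{\partial s^2\partial t^2}(s,t)=C(s,t)\qquad\text{for } 0<t<s<1 .$$ 3. There are $q\in\mathbb N$, functions $g_0,\dots,g_q:\,]0,1[\,\to\mathbb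 R$, reals $0<\nu_1<\dots<\nu_q$ and a function $\phi:\,]0,1[\,\to\,]0,\infty[$ such that (a) $g_i$ is Lipschitz on $]0,1[$ for $0\le i\le q-1$; (b) $g_q$ is $(1/2+\alpha_q)$-Hölder on $]0,1[$ for some $0<\alpha_q\le1/2$; (c) $g_0(t)\ne0$ for some $t\in\,]0,1[$; (d) if $q\ne0$, then $\phi(h)\to0$ as $h\to0^+$, and $$\lim_{h\to0^+}\frac1{\sqrt h}\sup_{h\le t\le1-h}\left|\frac{(\delta_1^h\circ\delta_2^hR)(t,t)}{h^{2-\gamma}L(h)}-g_0(t)-\sum_{i=1}^qg_i(t)\phi(h)^{\nu_i}\right|=0$$ (the sum is $0$ if $q=0$); (e) there is a bounded function $\tilde g:\,]0,1[\,\to\mathbb R$ with $$\lim_{h\to0^+}\sup_{h\le t\le1-2h}\left|\frac{(\delta_1^h\circ\delta_2^hR)(t+h,t)}{h^{2-\gamma}L(h)}-\tilde g(t)\right|=0 .$$ For integers $l=j-k\ge2$ let $$\rho_\gamma(l)=\int_j^{j+1}du\int_{u-1}^udv\int_k^{k+1}dx\int_{x-1}^x\frac{dy}{(v-y)^{2+\gamma}},$$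 which depends only on $j-k$, let $\|\rho_\gamma\|^2=\sum_{l\ge2}\rho_\gamma(l)^2$, and set $$\sigma^2=2\int_0^1g_0(x)^2dx+4\int_0^1\tilde g(x)^2dx+4\|\rho_\gamma\|^2\int_0^1C(x,x)^2dx,$$ $$\sigma_{1,\mathrm{cov}}^2=2\int_0^1\tilde g(t)^2dt+4\rho_\gamma(2)\int_0^1g_0(t)C(t,t)dt+4\rho_\gamma(3)\int_0^1\tilde g(t)C(t,t)dt+4\int_0^1C(t,t)^2dt\sum_{l=4}^\infty\rho_\gamma(l)\rho_\gamma(l-2),$$ $$\sigma_{2,\mathrm{cov}}^2=4\int_0^1g_0(t)\tilde g(t)dt+4\rho_\gamma(2)\int_0^1\tilde g(t)C(t,t)dt+4\int_0^1C(t,t)^2dt\sum_{l=3}^\infty\rho_\gamma(l)\rho_\gamma(l-1),$$ $$\sigma_*^2=3\sigma^2+\sigma_{1,\mathrm{cov}}^2+4\sigma_{2,\mathrm{cov}}^2 .$$ Then the matrix $$\Sigma=\begin{bmatrix}\sigma^2&2^{\gamma-2}\sigma_*^2\\2^{\gamma-2}\sigma_*^2&\sigma^2/2\end{bmatrix}$$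 is positive semidefinite and, as $n\to\infty$, $$\sqrt n\begin{pmatrix}\frac{n^{1-\gamma}}{L(1/n)}V_n(X)-\int_0^1g_0(x)dx-\sum_{i=1}^q\int_0^1g_i(x)dx\,\phi(\tfrac1n)^{\nu_i}\\[4pt]\frac{(2n)^{1-\gamma}}{L(1/(2n))}V_{2n}(X)-\int_0^1g_0(x)dx-\sum_{i=1}^q\int_0^1g_i(x)dx\,\phi(\tfrac1{2n})^{\nu_i}\end{pmatrix}\xrightarrow{(\mathcal L)}\mathcal N(0,\Sigma).$$ -/

import Mathlib

open MeasureTheory ProbabilityTheory Set Filter Topology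
open scoped NNReal

noncomputable section

namespace QuadVar

/-- The second-order quadratic variation
`V_n(X) = ∑_{k=1}^{n-1} (X_{(k+1)/n} + X_{(k-1)/n} - 2 X_{k/n})²`. -/
def V {Ω : Type*} (X : ℝ → Ω → ℝ) (n : ℕ) (ω : Ω) : ℝ :=
  ∑ k ∈ Finset.Ico 1 n,
    (X (((k : ℝ) + 1) / n) ω + X (((k : ℝ) - 1) / n) ω - 2 * X ((k : ℝ) / n) ω) ^ 2

/-- Second-order increment of `R` in its first variable. -/
def delta₁ (h : ℝ) (R : ℝ → ℝ → ℝ) (s t : ℝ) : ℝ :=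
  R (s + h) t + R (s - h) t - 2 * R s t

/-- Second-order increment of `R` in its second variable. -/
def delta₂ (h : ℝ) (R : ℝ → ℝ → ℝ) (s t : ℝ) : ℝ :=
  R s (t + h) + R s (t - h) - 2 * R s t

/-- `D = ∂⁴R/∂s²∂t²` exists at every point of `]0,1]² \ {s = t}`: the partial derivatives
`R₁ = ∂R/∂t`, `R₂ = ∂²R/∂t²`, `R₃ = ∂³R/∂s∂t²` and `D` exist one after the other
(one-sided derivatives at the end point `1`). -/
def IsMixedDeriv (R D : ℝ → ℝ → ℝ) : Prop :=
  ∃ R₁ R₂ R₃ : ℝ → ℝ → ℝ, ∀ s ∈ Ioc (0 : ℝ) 1, ∀ t ∈ Ioc (0 : ℝ) 1, s ≠ t →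
    HasDerivWithinAt (fun y => R s y) (R₁ s t) (Ioc 0 1) t ∧
    HasDerivWithinAt (fun y => R₁ s y) (R₂ s t) (Ioc 0 1) t ∧
    HasDerivWithinAt (fun x => R₂ x t) (R₃ s t) (Ioc 0 1) s ∧
    HasDerivWithinAt (fun x => R₃ x t) (D s t) (Ioc 0 1) s

/-- `L : ]0,1[ → ]0,∞[` is a (Borel) function slowly varying at `0`. Values of `L` outside `]0,1[`
play no role. -/
structure IsSlowlyVarying (L : ℝ → ℝ) : Prop where
  measurable : Measurable (fun x : Ioo (0 : ℝ) 1 => L x)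
  pos : ∀ x ∈ Ioo (0 : ℝ) 1, 0 < L x
  tendsto : ∀ c : ℝ, 0 < c → Tendsto (fun x => L (c * x) / L x) (𝓝[>] 0) (𝓝 1)

/-- `∫_j^{j+1} du ∫_{u-1}^u dv ∫_k^{k+1} dx ∫_{x-1}^x (v-y)^{-(2+γ)} dy`. -/
def rhoInt (γ j k : ℝ) : ℝ :=
  ∫ u in j..(j + 1), ∫ v in (u - 1)..u, ∫ x in k..(k + 1), ∫ y in (x - 1)..x,
    1 / (v - y) ^ (2 + γ)

/-- `ρ_γ(l)` for `l ≥ 2`; the integral `rhoInt γ j k` depends on `j - k` only. -/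
def rho (γ : ℝ) (l : ℕ) : ℝ := rhoInt γ l 0

/-- `‖ρ_γ‖² = ∑_{l ≥ 2} ρ_γ(l)²`. -/
def rhoNormSq (γ : ℝ) : ℝ := ∑' l : ℕ, rho γ (l + 2) ^ 2

/-- `σ²`. -/
def sigmaSq (γ : ℝ) (C : ℝ → ℝ → ℝ) (g₀ gt : ℝ → ℝ) : ℝ :=
  2 * (∫ x in (0 : ℝ)..1, g₀ x ^ 2) + 4 * (∫ x in (0 : ℝ)..1, gt x ^ 2) +
    4 * rhoNormSq γ * (∫ x in (0 : ℝ)..1, C x x ^ 2)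

/-- `σ²_{1,cov}`; the series is `∑_{l ≥ 4} ρ_γ(l) ρ_γ(l-2)`. -/
def sigmaSqCov₁ (γ : ℝ) (C : ℝ → ℝ → ℝ) (g₀ gt : ℝ → ℝ) : ℝ :=
  2 * (∫ x in (0 : ℝ)..1, gt x ^ 2) + 4 * rho γ 2 * (∫ x in (0 : ℝ)..1, g₀ x * C x x) +
    4 * rho γ 3 * (∫ x in (0 : ℝ)..1, gt x * C x x) +
    4 * (∫ x in (0 : ℝ)..1, C x x ^ 2) * ∑' l : ℕ, rho γ (l + 4) * rho γ (l + 2)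

/-- `σ²_{2,cov}`; the series is `∑_{l ≥ 3} ρ_γ(l) ρ_γ(l-1)`. -/
def sigmaSqCov₂ (γ : ℝ) (C : ℝ → ℝ → ℝ) (g₀ gt : ℝ → ℝ) : ℝ :=
  4 * (∫ x in (0 : ℝ)..1, g₀ x * gt x) + 4 * rho γ 2 * (∫ x in (0 : ℝ)..1, gt x * C x x) +
    4 * (∫ x in (0 : ℝ)..1, C x x ^ 2) * ∑' l : ℕ, rho γ (l + 3) * rho γ (l + 2)

/-- `σ_*² = 3σ² + σ²_{1,cov} + 4σ²_{2,cov}`. -/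
def sigmaStarSq (γ : ℝ) (C : ℝ → ℝ → ℝ) (g₀ gt : ℝ → ℝ) : ℝ :=
  3 * sigmaSq γ C g₀ gt + sigmaSqCov₁ γ C g₀ gt + 4 * sigmaSqCov₂ γ C g₀ gt

/-- The limiting covariance matrix. -/
def SigmaMat (γ : ℝ) (C : ℝ → ℝ → ℝ) (g₀ gt : ℝ → ℝ) : Matrix (Fin 2) (Fin 2) ℝ :=
  !![sigmaSq γ C g₀ gt, (2 : ℝ) ^ (γ - 2) * sigmaStarSq γ C g₀ gt;
     (2 : ℝ) ^ (γ - 2) * sigmaStarSq γ C g₀ gt, sigmaSq γ C g₀ gt / 2]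

/-- The normalized and bias-corrected variation
`N^{1-γ} / L(1/N) · V_N(X) - ∫₀¹ g₀ - ∑_{i=1}^q (∫₀¹ g_i) φ(1/N)^{ν_i}`. -/
def centeredV {Ω : Type*} (X : ℝ → Ω → ℝ) (γ : ℝ) (L φ : ℝ → ℝ) {q : ℕ}
    (g : Fin (q + 1) → ℝ → ℝ) (ν : Fin q → ℝ) (N : ℕ) (ω : Ω) : ℝ :=
  (N : ℝ) ^ (1 - γ) / L (1 / (N : ℝ)) * V X N ω - (∫ x in (0 : ℝ)..1, g 0 x) -
    ∑ i : Fin q, (∫ x in (0 : ℝ)..1, g i.succ x) * φ (1 / (N : ℝ)) ^ ν i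

end QuadVar

end

/-! Write `Y n k` for the second increments of step 1/n, divided by the scale `√(h^(2-γ) L(h))` with
h = 1/n. Up to the deterministic `bias`, any combination of √n times the two centred variations is a
centred quadratic form ∑ w_p (Z_p² - Var Z_p) in the jointly Gaussian increments of levels n and 2n,
with weights of order n^(-1/2). Diagonalizing S diag(w) S, where S is the square root of the
covariance matrix G, turns it into ∑ l_i (ξ_i² - 1) with ξ_i independent standard Gaussian
(`integral_cexp_quadratic_multivariateGaussian`). Each factor of the characteristic function is
exp(-l_i²) + o(l_i²), so the whole is close to exp(-∑ l_i²) as soon as max |l_i| is small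
(`exists_norm_charFun_quadratic_sub_le`). Two facts about covariances are therefore enough: max
|l_i| → 0, which follows from a uniform bound on the operator norm of G, and convergence of ∑ l_i² =
∑ w_p w_q G_pq².

Covariances at lag at least 2 are integrals of ∂⁴R/∂s²∂t² over squares off the diagonal. Potter's
bound for L makes them decay like the inverse square of the lag, uniformly in n
(`IsSingularKernel.exists_normDelta_le`), and dominated convergence gives their limit C(t,t) ρ_γ(l)
along diagonals (`IsSingularKernel.tendsto_normDelta`). Lags 0 and 1 have the limits g₀ and g̃ by
assumption. As L is not controlled near 1, the decay fails for lags close to n. Positive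
semidefiniteness replaces it there: the operator norm is controlled by two diagonal blocks on which
all lags are at most n/2 (`IsDecayingArray.exists_quadForm_le`), and Bessel's inequality bounds the
few rows that reach the corner (`IsDecayingArray.exists_sum_sq_tail_le`). The normalized sums of
squares then converge lag by lag, as Riemann sums with uniformly small tails.

An increment of step 2h is the (1,2,1) combination of three increments of step h (`incr_refine`).
Covariances between the two levels thus reduce to those of level 2n, the squared change of scale
tends to 2^(γ-2), and expanding the square of (1,2,1) yields σ_*² (`hasSum_combLimit_weightTwo`).
The limiting form is nonnegative because it is a limit of ∑ l_i².

The bias is o(n^(-1/2)): the expansion on the diagonal has error o(√h), and Riemann sums of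
functions with Hölder exponent above 1/2 have error o(n^(-1/2)). Lévy's continuity theorem
concludes. -/

noncomputable section

namespace QuadVar

/-! ### Characteristic function of ξ² - 1 near the origin -/

section StandardGaussian

/-- The characteristic function of `ξ² - 1` for a standard Gaussian variable `ξ`. -/
def chiCharFun (l : ℝ) : ℂ :=
  ∫ x, Complex.exp (((l * (x ^ 2 - 1) : ℝ) : ℂ) * Complex.I) ∂gaussianReal 0 1

lemma integral_sq_gaussianReal : ∫ x, x ^ 2 ∂gaussianReal 0 1 = 1 := by
  have h := variance_eq_integral (μ := gaussianReal 0 1) (X := fun x => x) (by fun_prop)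
  rw [variance_fun_id_gaussianReal] at h
  simpa using h.symm

/-- The moment is read off as the fourth derivative at 0 of the moment generating function
exp(t²/2). -/
lemma integral_pow_four_gaussianReal : ∫ x, x ^ 4 ∂gaussianReal 0 1 = 3 := by
  have h := iteratedDeriv_mgf_zero (X := id) (μ := gaussianReal 0 1)
    (by simp [integrableExpSet_id_gaussianReal]) 4
  rw [mgf_id_gaussianReal] at h
  have e : ∀ t : ℝ, HasDerivAt (fun t : ℝ => Real.exp (t ^ 2 / 2)) (t * Real.exp (t ^ 2 / 2)) t := by
    intro t
    have := ((hasDerivAt_pow 2 t).div_const 2).exp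
    convert this using 1
    simp; ring
  have d1 : deriv (fun t : ℝ => Real.exp (t ^ 2 / 2)) = fun t => t * Real.exp (t ^ 2 / 2) :=
    funext fun t => (e t).deriv
  have d2 : deriv (fun t : ℝ => t * Real.exp (t ^ 2 / 2)) =
      fun t => (1 + t ^ 2) * Real.exp (t ^ 2 / 2) := by
    funext t
    exact ((hasDerivAt_id' t).mul (e t)).deriv.trans (by ring)
  have d3 : deriv (fun t : ℝ => (1 + t ^ 2) * Real.exp (t ^ 2 / 2)) =
      fun t => (3 * t + t ^ 3) * Real.exp (t ^ 2 / 2) := by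
    funext t
    exact (((hasDerivAt_pow 2 t).const_add 1).mul (e t)).deriv.trans (by push_cast; ring)
  have d4 : deriv (fun t : ℝ => (3 * t + t ^ 3) * Real.exp (t ^ 2 / 2)) 0 = 3 := by
    exact ((((hasDerivAt_id' (0 : ℝ)).const_mul 3).add (hasDerivAt_pow 3 0)).mul (e 0)).deriv.trans
      (by simp)
  have f : (fun t : ℝ => Real.exp ((0 : ℝ) * t + ((1 : ℝ≥0) : ℝ) * t ^ 2 / 2)) =
      fun t => Real.exp (t ^ 2 / 2) := by
    funext t; simp
  rw [f, iteratedDeriv_succ', iteratedDeriv_succ', iteratedDeriv_succ', iteratedDeriv_succ',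
    iteratedDeriv_zero, d1, d2, d3, d4] at h
  simpa using h.symm

lemma integrable_pow_gaussianReal (n : ℕ) : Integrable (fun x : ℝ => x ^ n) (gaussianReal 0 1) := by
  have h := (memLp_id_gaussianReal (μ := 0) (v := 1) n).integrable_norm_pow'
  refine (h.mono' (by fun_prop) ?_)
  filter_upwards with x
  simp

/-- Since E ξ⁴ = 3, the variable (ξ² - 1)/√2 is centred with unit variance, and its second-order
Taylor expansion at √2 l gives 1 - l². Comparing with exp(-l²) instead makes products over
eigenvalues collapse to exp(-∑ l_i²). -/
lemma chiCharFun_isLittleO :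
    (fun l : ℝ => chiCharFun l - Complex.exp (-(l : ℂ) ^ 2)) =o[𝓝 0] fun l : ℝ => l ^ 2 := by
  set Y : ℝ → ℝ := fun x => (x ^ 2 - 1) / √2 with hY
  have hmeas : AEMeasurable Y (gaussianReal 0 1) := by fun_prop
  have h0 : (gaussianReal 0 1)[Y] = 0 := by
    simp only [hY]
    rw [integral_div, integral_sub (integrable_pow_gaussianReal 2) (integrable_const _),
      integral_sq_gaussianReal]
    simp
  have h1 : (gaussianReal 0 1)[Y ^ 2] = 1 := by
    have : ∀ x, (Y ^ 2) x = (x ^ 4 - 2 * x ^ 2 + 1) / 2 := by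
      intro x
      simp only [hY, Pi.pow_apply, div_pow]
      rw [Real.sq_sqrt (by norm_num)]
      ring
    simp_rw [this]
    have i4 := (integrable_pow_gaussianReal 4).sub ((integrable_pow_gaussianReal 2).const_mul 2)
    rw [integral_div, integral_add (f := fun x => x ^ 4 - 2 * x ^ 2) i4 (integrable_const _),
      integral_sub (integrable_pow_gaussianReal 4) ((integrable_pow_gaussianReal 2).const_mul 2),
      integral_const_mul, integral_sq_gaussianReal, integral_pow_four_gaussianReal]
    norm_num
  have key := taylor_charFun_two hmeas h0 h1
  have lim : Tendsto (fun l : ℝ => √2 * l) (𝓝 0) (𝓝 0) := by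
    have : Continuous (fun l : ℝ => √2 * l) := by fun_prop
    simpa using this.tendsto 0
  have key2 := key.comp_tendsto lim
  have e1 : (fun l : ℝ => chiCharFun l - (1 - (l : ℂ) ^ 2)) =o[𝓝 0] fun l : ℝ => l ^ 2 := by
    refine (key2.congr_left ?_).trans_isBigO ?_
    · intro l
      simp only [Function.comp]
      congr 1
      · rw [charFun_apply_real, integral_map hmeas (by fun_prop), chiCharFun]
        congr 1
        ext x
        congr 1
        simp only [hY]
        have : √2 ≠ 0 := by positivity
        push_cast
        have h2 : ((√2 : ℝ) : ℂ) ≠ 0 := by exact_mod_cast this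
        field_simp
      · push_cast
        rw [mul_pow, ← Complex.ofReal_pow, Real.sq_sqrt (by norm_num)]
        push_cast; ring
    · refine Asymptotics.IsBigO.of_bound 2 (Filter.Eventually.of_forall fun l => ?_)
      simp only [Function.comp, mul_pow]
      rw [Real.sq_sqrt (by norm_num)]
      simp
  have e2 : (fun l : ℝ => Complex.exp (-(l : ℂ) ^ 2) - (1 - (l : ℂ) ^ 2)) =o[𝓝 0]
      fun l : ℝ => l ^ 2 := by
    have lim2 : Tendsto (fun l : ℝ => -(l : ℂ) ^ 2) (𝓝 0) (𝓝 0) := by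
      have : Continuous (fun l : ℝ => -(l : ℂ) ^ 2) := by fun_prop
      simpa using this.tendsto 0
    have h := (Complex.exp_sub_sum_range_succ_isLittleO_pow 1).comp_tendsto lim2
    refine (h.congr_left ?_).trans_isBigO ?_
    · intro l
      simp [Function.comp, Finset.sum_range_succ]
      ring
    · refine Asymptotics.IsBigO.of_bound 1 (Filter.Eventually.of_forall fun l => ?_)
      simp [Function.comp]
  refine (e1.sub e2).congr_left fun l => ?_
  ring

lemma norm_chiCharFun_le (l : ℝ) : ‖chiCharFun l‖ ≤ 1 := by
  refine (norm_integral_le_of_norm_le_const (C := 1) (Filter.Eventually.of_forall fun x => ?_)).trans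
    (by simp)
  rw [Complex.norm_exp_ofReal_mul_I]

/-- Factors are exchanged one at a time; all the others have modulus at most 1, so the errors merely
add. -/
lemma norm_prod_sub_prod_le {ι : Type*} (s : Finset ι) (a b : ι → ℂ) (ha : ∀ i, ‖a i‖ ≤ 1)
    (hb : ∀ i, ‖b i‖ ≤ 1) : ‖∏ i ∈ s, a i - ∏ i ∈ s, b i‖ ≤ ∑ i ∈ s, ‖a i - b i‖ := by
  classical
  induction s using Finset.induction_on with
  | empty => simp
  | insert i s hi ih =>
    rw [Finset.prod_insert hi, Finset.prod_insert hi, Finset.sum_insert hi]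
    have e : a i * ∏ j ∈ s, a j - b i * ∏ j ∈ s, b j =
        (a i - b i) * ∏ j ∈ s, a j + b i * (∏ j ∈ s, a j - ∏ j ∈ s, b j) := by ring
    rw [e]
    refine (norm_add_le _ _).trans (add_le_add ?_ ?_)
    · rw [norm_mul, norm_prod]
      exact mul_le_of_le_one_right (norm_nonneg _)
        (Finset.prod_le_one (fun _ _ => norm_nonneg _) fun j _ => ha j)
    · rw [norm_mul]
      exact (mul_le_of_le_one_left (norm_nonneg _) (hb i)).trans ih

/-- The point is uniformity: δ depends on ε alone, not on the number of factors, because the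
factorwise errors ε l_i² sum to a multiple of ∑ l_i². -/
lemma exists_norm_prod_chiCharFun_sub_le {ε : ℝ} (hε : 0 < ε) : ∃ δ > 0, ∀ {ι : Type} [Fintype ι]
    (l : ι → ℝ), (∀ i, |l i| ≤ δ) →
      ‖∏ i, chiCharFun (l i) - Complex.exp (-((∑ i, l i ^ 2 : ℝ) : ℂ))‖ ≤ ε * ∑ i, l i ^ 2 := by
  obtain ⟨δ, hδ, h⟩ := Metric.eventually_nhds_iff_ball.1
    ((Asymptotics.isLittleO_iff.1 chiCharFun_isLittleO) hε)
  refine ⟨δ / 2, by positivity, fun {ι} _ l hl => ?_⟩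
  have e : Complex.exp (-((∑ i, l i ^ 2 : ℝ) : ℂ)) = ∏ i, Complex.exp (-(l i : ℂ) ^ 2) := by
    rw [← Complex.exp_sum]
    push_cast
    rw [Finset.sum_neg_distrib]
  rw [e, Finset.mul_sum]
  refine (norm_prod_sub_prod_le _ _ _ (fun i => norm_chiCharFun_le _) fun i => ?_).trans
    (Finset.sum_le_sum fun i _ => ?_)
  · rw [Complex.norm_exp]
    simp [← Complex.ofReal_pow]
    positivity
  · have := h (l i) (by
      rw [mem_ball_zero_iff, Real.norm_eq_abs]
      exact (hl i).trans_lt (by linarith))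
    simpa using this

end StandardGaussian

/-! ### Diagonalization of Gaussian quadratic forms -/

section QuadraticForm

variable {ι : Type} [Fintype ι]

open Matrix in
open scoped MatrixOrder in
-- The Gaussian vector is S ξ with S = √G, so the form is ξᵀBξ - tr B with B = S diag(w) S, and the
-- l_i are the eigenvalues of B. At a unit eigenvector v, |vᵀBv| ≤ W |Sv|² = W vᵀGv ≤ W κ; cyclicity
-- of the trace gives tr B² = tr (diag(w) G diag(w) G) and tr B = ∑ w_i G_ii.
lemma integral_cexp_quadratic_multivariateGaussian [DecidableEq ι] {G : Matrix ι ι ℝ} (hG : G.PosSemidef)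
    (w : ι → ℝ) {W κ : ℝ} (hw : ∀ i, |w i| ≤ W)
    (hκ : ∀ x : ι → ℝ, x ⬝ᵥ G *ᵥ x ≤ κ * ∑ i, x i ^ 2) :
    ∃ l : ι → ℝ, (∀ i, |l i| ≤ W * κ) ∧ ∑ i, l i ^ 2 = ∑ i, ∑ j, w i * w j * G i j ^ 2 ∧
      ∫ y, Complex.exp (((∑ i, w i * (y i ^ 2 - G i i) : ℝ) : ℂ) * Complex.I)
        ∂(multivariateGaussian 0 G) = ∏ i, chiCharFun (l i) := by
  set S := CFC.sqrt G with hS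
  have hSS : S * S = G := CFC.sqrt_mul_sqrt_self _ hG.nonneg
  have hSs : Sᵀ = S := by
    have := (CFC.sqrt_nonneg G).isSelfAdjoint
    rw [← conjTranspose_eq_transpose_of_trivial]
    exact this
  set B := S * diagonal w * S with hB
  have hBh : B.IsHermitian := by
    rw [IsHermitian, conjTranspose_eq_transpose_of_trivial, hB, transpose_mul, transpose_mul,
      diagonal_transpose, hSs, Matrix.mul_assoc]
  have hquad : ∀ x : ι → ℝ, x ⬝ᵥ B *ᵥ x = ∑ i, w i * (S *ᵥ x) i ^ 2 := by
    intro x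
    rw [hB, ← mulVec_mulVec, ← mulVec_mulVec, dotProduct_mulVec, ← mulVec_transpose, hSs]
    simp only [dotProduct, mulVec_diagonal]
    exact Finset.sum_congr rfl fun i _ => by ring
  have hGq : ∀ x : ι → ℝ, x ⬝ᵥ G *ᵥ x = ∑ i, (S *ᵥ x) i ^ 2 := by
    intro x
    rw [← hSS, ← mulVec_mulVec, dotProduct_mulVec, ← mulVec_transpose, hSs]
    simp only [dotProduct]
    exact Finset.sum_congr rfl fun i _ => by ring
  set b := hBh.eigenvectorBasis with hb
  set l := hBh.eigenvalues with hl
  have hbn : ∀ i, ∑ j, (b i) j ^ 2 = 1 := by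
    intro i
    rw [← EuclideanSpace.real_norm_sq_eq, b.orthonormal.1 i]; norm_num
  refine ⟨l, fun i => ?_, ?_, ?_⟩
  · have hW' : 0 ≤ W := (abs_nonneg _).trans (hw i)
    have e : l i = ∑ j, w j * (S *ᵥ (b i)) j ^ 2 := by
      rw [← hquad, hl, hBh.eigenvalues_eq]
      simp [hb]
    rw [e]
    calc |∑ j, w j * (S *ᵥ (b i)) j ^ 2| ≤ ∑ j, |w j * (S *ᵥ (b i)) j ^ 2| :=
          Finset.abs_sum_le_sum_abs _ _
      _ ≤ ∑ j, W * (S *ᵥ (b i)) j ^ 2 := Finset.sum_le_sum fun j _ => by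
          rw [abs_mul, abs_of_nonneg (sq_nonneg ((S *ᵥ (b i)) j))]
          exact mul_le_mul_of_nonneg_right (hw j) (sq_nonneg _)
      _ ≤ W * κ := by
          rw [← Finset.mul_sum, ← hGq]
          refine mul_le_mul_of_nonneg_left ((hκ _).trans_eq ?_) hW'
          rw [hbn, mul_one]
  · have e : B * B = Unitary.conjStarAlgAut ℝ _ hBh.eigenvectorUnitary
        (Matrix.diagonal (RCLike.ofReal ∘ l) * Matrix.diagonal (RCLike.ofReal ∘ l)) := by
      rw [map_mul]
      congr 1 <;> exact hBh.spectral_theorem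
    have t1 : (B * B).trace = ∑ i, l i ^ 2 := by
      rw [e, Unitary.conjStarAlgAut_apply, trace_mul_comm, ← Matrix.mul_assoc]
      simp [trace_diagonal, sq]
    have t2 : (B * B).trace = (diagonal w * G * (diagonal w * G)).trace := by
      rw [hB, ← hSS]
      have : S * diagonal w * S * (S * diagonal w * S) =
        S * (diagonal w * (S * S) * diagonal w * S) := by noncomm_ring
      rw [this, trace_mul_comm]
      congr 1
      noncomm_ring
    rw [← t1, t2, trace]
    refine Finset.sum_congr rfl fun i _ => ?_
    rw [diag_apply, mul_apply]
    refine Finset.sum_congr rfl fun j _ => ?_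
    rw [diagonal_mul, diagonal_mul]
    have : G j i = G i j := by
      have := hG.1.apply i j
      simpa using this
    rw [this]; ring
  · have htr : ∑ i, w i * G i i = ∑ i, l i := by
      have h1 : B.trace = ∑ i, l i := hBh.trace_eq_sum_eigenvalues
      have h2 : B.trace = ∑ i, G i i * w i := by
        rw [hB, trace_mul_comm, ← Matrix.mul_assoc, hSS, trace]
        simp only [diag_apply, mul_diagonal]
      rw [← h1, h2]
      exact Finset.sum_congr rfl fun i _ => by ring
    -- By rotation invariance the coordinates of ξ in the eigenbasis of B are again independent
    -- standard Gaussian, so the integral factorizes.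
    rw [multivariateGaussian, integral_map (by fun_prop) (by fun_prop),
      stdGaussian_eq_map_pi_orthonormalBasis b,
      integral_map (Measurable.aemeasurable (by fun_prop)) (by fun_prop)]
    have key : ∀ x : ι → ℝ, (∑ i, w i *
        ((0 + toEuclideanCLM (𝕜 := ℝ) S (∑ i, x i • b i)).ofLp i ^ 2 - G i i)) =
        ∑ i, l i * (x i ^ 2 - 1) := by
      intro x
      set v := ∑ i, x i • b i with hv
      have e1 : ∑ i, w i * (S *ᵥ v.ofLp) i ^ 2 = ∑ i, l i * x i ^ 2 := by
        rw [← hquad, ← inner_toEuclideanCLM]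
        have e2 : toEuclideanCLM (𝕜 := ℝ) B v = ∑ i, (x i * l i) • b i := by
          rw [hv, map_sum]
          refine Finset.sum_congr rfl fun i _ => ?_
          rw [map_smul, mul_smul]
          congr 1
          ext j
          rw [ofLp_toEuclideanCLM, hBh.mulVec_eigenvectorBasis]
          simp [hl, hb]
        rw [e2, hv, b.orthonormal.inner_sum]
        refine Finset.sum_congr rfl fun i _ => ?_
        simp; ring
      simp only [zero_add, ofLp_toEuclideanCLM, mul_sub, Finset.sum_sub_distrib]
      rw [e1, htr]
      simp
    simp_rw [← hS, key]
    have key2 : ∀ x : ι → ℝ, Complex.exp (((∑ i, l i * (x i ^ 2 - 1) : ℝ) : ℂ) * Complex.I) =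
        ∏ i, Complex.exp (((l i * (x i ^ 2 - 1) : ℝ) : ℂ) * Complex.I) := by
      intro x
      rw [← Complex.exp_sum, ← Finset.sum_mul]
      push_cast; rfl
    simp_rw [key2]
    rw [integral_fintype_prod_eq_prod
      (f := fun i (x : ℝ) => Complex.exp (((l i * (x ^ 2 - 1) : ℝ) : ℂ) * Complex.I))]
    rfl

variable {Ω : Type*} [MeasurableSpace Ω] {P : Measure Ω}

open Matrix in
/-- The covariance matrix of a finite family of random variables. -/
def covMatrix (Z : ι → Ω → ℝ) (P : Measure Ω) : Matrix ι ι ℝ := Matrix.of fun i j => cov[Z i, Z j; P]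

open Matrix in
lemma dotProduct_covMatrix_mulVec [IsProbabilityMeasure P] {Z : ι → Ω → ℝ}
    (hZ : ∀ i, MemLp (Z i) 2 P) (x : ι → ℝ) :
    x ⬝ᵥ covMatrix Z P *ᵥ x = Var[fun ω => ∑ i, x i * Z i ω; P] := by
  rw [variance_fun_sum (fun i => (hZ i).const_mul (x i))]
  simp only [dotProduct, mulVec, covMatrix, of_apply, Finset.mul_sum]
  refine Finset.sum_congr rfl fun i _ => Finset.sum_congr rfl fun j _ => ?_
  rw [covariance_const_mul_left, covariance_const_mul_right]
  ring

open Matrix in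
lemma posSemidef_covMatrix [IsProbabilityMeasure P] {Z : ι → Ω → ℝ}
    (hZ : ∀ i, MemLp (Z i) 2 P) : (covMatrix Z P).PosSemidef := by
  refine PosSemidef.of_dotProduct_mulVec_nonneg ?_ fun x => ?_
  · ext i j
    simp [covMatrix, covariance_comm (Z i)]
  · simp only [star_trivial]
    rw [dotProduct_covMatrix_mulVec hZ]
    exact variance_nonneg _ _

open Matrix in
-- Both laws are Gaussian with the same mean and covariance, hence have the same characteristic
-- function.
lemma map_eq_multivariateGaussian [DecidableEq ι] [IsProbabilityMeasure P] {Z : ι → Ω → ℝ}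
    (hZ : HasGaussianLaw (fun ω => (Z · ω)) P) (h0 : ∀ i, P[Z i] = 0) :
    P.map (fun ω => WithLp.toLp 2 (Z · ω)) = multivariateGaussian 0 (covMatrix Z P) := by
  have hL : ∀ i, MemLp (Z i) 2 P := fun i => (hZ.eval i).memLp_two
  have hZ2 := hZ.toLp_pi 2
  have := Measure.isProbabilityMeasure_map (μ := P) hZ2.aemeasurable
  refine Measure.ext_of_charFun ?_
  ext t
  rw [hZ2.charFun_map_eq, charFun_multivariateGaussian (posSemidef_covMatrix hL),
    dotProduct_covMatrix_mulVec hL]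
  have e : ∀ ω, inner ℝ t (WithLp.toLp 2 (Z · ω)) = ∑ i, t i * Z i ω := by
    intro ω
    simp [PiLp.inner_apply, mul_comm]
  simp_rw [e]
  rw [integral_finsetSum _ fun i _ => ((hL i).integrable (by norm_num)).const_mul _]
  simp_rw [integral_const_mul, h0]
  simp

/-- Characteristic function of a centred quadratic form in Gaussian variables: it is close to that
of a Gaussian variable when the form has small operator norm. -/
theorem exists_norm_charFun_quadratic_sub_le {ε : ℝ} (hε : 0 < ε) : ∃ δ > 0,
    ∀ {ι : Type} [Fintype ι] {Ω : Type*} [MeasurableSpace Ω] {P : Measure Ω}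
      [IsProbabilityMeasure P] {Z : ι → Ω → ℝ} (_ : HasGaussianLaw (fun ω => (Z · ω)) P)
      (_ : ∀ i, P[Z i] = 0) (w : ι → ℝ) {W κ : ℝ} (_ : ∀ i, |w i| ≤ W)
      (_ : ∀ x : ι → ℝ, ∑ i, ∑ j, x i * x j * cov[Z i, Z j; P] ≤ κ * ∑ i, x i ^ 2)
      (_ : W * κ ≤ δ),
      0 ≤ ∑ i, ∑ j, w i * w j * cov[Z i, Z j; P] ^ 2 ∧
      ‖∫ ω, Complex.exp (((∑ i, w i * (Z i ω ^ 2 - cov[Z i, Z i; P]) : ℝ) : ℂ) * Complex.I) ∂P -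
        Complex.exp (-((∑ i, ∑ j, w i * w j * cov[Z i, Z j; P] ^ 2 : ℝ) : ℂ))‖ ≤
        ε * ∑ i, ∑ j, w i * w j * cov[Z i, Z j; P] ^ 2 := by
  obtain ⟨δ, hδ, h⟩ := exists_norm_prod_chiCharFun_sub_le hε
  refine ⟨δ, hδ, fun {ι} _ Ω _ P _ Z hZ h0 w W κ hw hκ hWκ => ?_⟩
  classical
  have hL : ∀ i, MemLp (Z i) 2 P := fun i => (hZ.eval i).memLp_two
  obtain ⟨l, h1, h2, h3⟩ := integral_cexp_quadratic_multivariateGaussian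
    (posSemidef_covMatrix hL) w hw (κ := κ) (fun x => by
      refine le_trans (le_of_eq ?_) (hκ x)
      simp only [dotProduct, Matrix.mulVec, covMatrix, Matrix.of_apply, Finset.mul_sum]
      exact Finset.sum_congr rfl fun i _ => Finset.sum_congr rfl fun j _ => by ring)
  rw [← map_eq_multivariateGaussian hZ h0, integral_map (hZ.toLp_pi 2).aemeasurable
    (by fun_prop)] at h3
  simp only [covMatrix, Matrix.of_apply] at h2 h3
  rw [h3, ← h2]
  -- The double sum equals ∑ l_i²; this is why it is nonnegative although the weights may have any
  -- signs.
  exact ⟨Finset.sum_nonneg fun i _ => sq_nonneg _, h l fun i => (h1 i).trans hWκ⟩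

end QuadraticForm

/-! ### Slowly varying functions: uniform convergence and Potter's bound -/

section SlowVariation

/-- These sets increase to [0,2], which has measure 2. The level 3/2 is chosen so that two such
sets, one of them shifted by at most 1, cannot be disjoint inside [0,3]. -/
lemma eventually_volume_uniform_gt {l : ℝ → ℝ}
    (h : ∀ u, Tendsto (fun x => l (x + u) - l x) atTop (𝓝 0)) {y : ℕ → ℝ}
    (hy : Tendsto y atTop atTop) {ε : ℝ} (hε : 0 < ε) :
    ∀ᶠ n in atTop, ENNReal.ofReal (3 / 2) <
      volume {u ∈ Icc (0 : ℝ) 2 | ∀ m ≥ n, |l (y m + u) - l (y m)| < ε} := by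
  set A : ℕ → Set ℝ := fun n => {u ∈ Icc (0 : ℝ) 2 | ∀ m ≥ n, |l (y m + u) - l (y m)| < ε} with hA
  have hmono : Monotone A := fun a b hab u hu => ⟨hu.1, fun m hm => hu.2 m (hab.trans hm)⟩
  have hun : ⋃ n, A n = Icc (0 : ℝ) 2 := by
    refine subset_antisymm (iUnion_subset fun n u hu => hu.1) fun u hu => ?_
    have h1 := ((h u).comp hy).eventually (Metric.ball_mem_nhds 0 hε)
    obtain ⟨n, hn⟩ := eventually_atTop.1 h1
    refine mem_iUnion.2 ⟨n, hu, fun m hm => ?_⟩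
    simpa using hn m hm
  have ht := tendsto_measure_iUnion_atTop (μ := volume) hmono
  rw [hun, Real.volume_Icc] at ht
  exact ht.eventually (lt_mem_nhds ((ENNReal.ofReal_lt_ofReal_iff (by norm_num)).2 (by norm_num)))

/-- Uniform convergence theorem for slowly varying functions, in additive form. -/
lemma exists_forall_abs_sub_le {l : ℝ → ℝ} (hm : Measurable l)
    (h : ∀ u, Tendsto (fun x => l (x + u) - l x) atTop (𝓝 0)) {ε : ℝ} (hε : 0 < ε) :
    ∃ X, ∀ x ≥ X, ∀ u ∈ Icc (0 : ℝ) 1, |l (x + u) - l x| ≤ ε := by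
  by_contra! hcon
  choose x hx u hu hxu using fun n : ℕ => hcon n
  have hxt : Tendsto x atTop atTop := tendsto_atTop_mono hx tendsto_natCast_atTop_atTop
  have hyt : Tendsto (fun n => x n + u n) atTop atTop :=
    tendsto_atTop_mono (fun n => by linarith [(hu n).1]) hxt
  obtain ⟨n, h1, h2⟩ := ((eventually_volume_uniform_gt h hxt (half_pos hε)).and
    (eventually_volume_uniform_gt h hyt (half_pos hε))).exists
  set A := {v ∈ Icc (0 : ℝ) 2 | ∀ m ≥ n, |l (x m + v) - l (x m)| < ε / 2}
  set B := {v ∈ Icc (0 : ℝ) 2 | ∀ m ≥ n, |l (x m + u m + v) - l (x m + u m)| < ε / 2} with hB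
  have hBm : MeasurableSet B := by
    have : B = Icc (0 : ℝ) 2 ∩ ⋂ m, ⋂ (_ : m ≥ n), {v | |l (x m + u m + v) - l (x m + u m)| < ε / 2} := by
      ext v; simp [hB]
    rw [this]
    refine measurableSet_Icc.inter (MeasurableSet.iInter fun m => MeasurableSet.iInter fun _ => ?_)
    exact measurableSet_lt (by fun_prop) measurable_const
  set B' := (fun v => v + (- u n)) ⁻¹' B with hB'
  have hvB : volume B' = volume B := measure_preimage_add_right _ _ _
  have hB'm : MeasurableSet B' := hBm.preimage (by fun_prop)
  -- Both sets lie in [0,3] and have measure above 3/2. A common point v compares l(x n) and l(x n +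
  -- u n) with the same value l(x n + v).
  have hne : ¬ Disjoint A B' := by
    intro hd
    have h3 : volume (A ∪ B') ≤ ENNReal.ofReal 3 := by
      have : A ∪ B' ⊆ Icc (0 : ℝ) 3 := by
        rintro v (hv | hv)
        · exact ⟨hv.1.1, hv.1.2.trans (by norm_num)⟩
        · have := hv.1
          simp only [mem_Icc] at this
          constructor <;> linarith [(hu n).1, (hu n).2]
      refine (measure_mono this).trans ?_
      rw [Real.volume_Icc]; simp
    rw [measure_union hd hB'm, hvB] at h3
    have h4 := ENNReal.add_lt_add h1 h2
    rw [← ENNReal.ofReal_add (by norm_num) (by norm_num)] at h4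
    norm_num at h4
    exact absurd (h4.trans_le h3) (by simp)
  obtain ⟨v, hvA, hvB⟩ := Set.not_disjoint_iff.1 hne
  have e1 := hvA.2 n le_rfl
  have e2 := hvB.2 n le_rfl
  rw [show x n + u n + (v + -u n) = x n + v by ring] at e2
  have e3 := hxu n
  have : l (x n + u n) - l (x n) = (l (x n + v) - l (x n)) - (l (x n + v) - l (x n + u n)) := by ring
  rw [this] at e3
  have := abs_sub (l (x n + v) - l (x n)) (l (x n + v) - l (x n + u n))
  linarith

/-- The uniform estimate is chained over ⌈u⌉ steps of length at most 1. -/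
lemma exists_forall_abs_sub_le_mul {l : ℝ → ℝ} (hm : Measurable l)
    (h : ∀ u, Tendsto (fun x => l (x + u) - l x) atTop (𝓝 0)) {ε : ℝ} (hε : 0 < ε) :
    ∃ X, ∀ x ≥ X, ∀ u ≥ 0, |l (x + u) - l x| ≤ ε * (u + 1) := by
  obtain ⟨X, hX⟩ := exists_forall_abs_sub_le hm h hε
  have key : ∀ n : ℕ, ∀ x ≥ X, ∀ u ∈ Icc (0 : ℝ) n, |l (x + u) - l x| ≤ ε * n := by
    intro n
    induction n with
    | zero =>
      intro x hx u hu
      have : u = 0 := by simpa using hu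
      simp [this]
    | succ n ih =>
      intro x hx u hu
      push_cast at hu ⊢
      rcases le_total u 1 with h1 | h1
      · refine (hX x hx u ⟨hu.1, h1⟩).trans ?_
        nlinarith [hε, (Nat.cast_nonneg n : (0 : ℝ) ≤ n)]
      · have e1 := hX x hx 1 ⟨zero_le_one, le_rfl⟩
        have e2 := ih (x + 1) (by linarith) (u - 1) ⟨by linarith, by linarith [hu.2]⟩
        rw [show x + 1 + (u - 1) = x + u by ring] at e2
        have : l (x + u) - l x = (l (x + u) - l (x + 1)) + (l (x + 1) - l x) := by ring
        rw [this]
        refine (abs_add_le _ _).trans ?_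
        linarith
  refine ⟨X, fun x hx u hu => (key ⌈u⌉₊ x hx u ⟨hu, Nat.le_ceil u⟩).trans ?_⟩
  exact mul_le_mul_of_nonneg_left (Nat.ceil_lt_add_one hu).le hε.le

lemma IsSlowlyVarying.measurable_indicator {L : ℝ → ℝ} (hL : IsSlowlyVarying L) :
    Measurable ((Ioo (0 : ℝ) 1).indicator L) := by
  refine measurable_of_restrict_of_restrict_compl (s := Ioo (0 : ℝ) 1) measurableSet_Ioo ?_ ?_
  · convert hL.measurable using 1
    ext x
    simp only [domRestrict_apply]
    exact indicator_of_mem x.2 _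
  · convert measurable_const (a := (0 : ℝ)) using 1
    ext x
    simp only [domRestrict_apply]
    exact indicator_of_notMem x.2 _

/-- The substitution l(x) = log L(e^(-x)) turns multiplicative slow variation at 0 into the additive
form at infinity. -/
lemma IsSlowlyVarying.exists_abs_log_sub_le {L : ℝ → ℝ} (hL : IsSlowlyVarying L) {η : ℝ}
    (hη : 0 < η) : ∃ δ ∈ Ioo (0 : ℝ) 1, ∀ x y, 0 < x → x ≤ y → y ≤ δ →
      |Real.log (L x) - Real.log (L y)| ≤ η * (Real.log (y / x) + 1) := by
  set L' : ℝ → ℝ := (Ioo (0 : ℝ) 1).indicator L with hL'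
  have hm : Measurable L' := hL.measurable_indicator
  have hexp : ∀ x : ℝ, 0 < x → Real.exp (-x) ∈ Ioo (0 : ℝ) 1 := fun x hx =>
    ⟨Real.exp_pos _, Real.exp_lt_one_iff.2 (by linarith)⟩
  set l : ℝ → ℝ := fun x => Real.log (L' (Real.exp (-x))) with hl
  have hlm : Measurable l := Real.measurable_log.comp (hm.comp (by fun_prop))
  have hlv : ∀ x : ℝ, 0 < x → l x = Real.log (L (Real.exp (-x))) := fun x hx => by
    simp only [hl, hL']
    rw [indicator_of_mem (hexp x hx)]
  have hlim : ∀ u, Tendsto (fun x => l (x + u) - l x) atTop (𝓝 0) := by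
    intro u
    have t1 : Tendsto (fun x : ℝ => Real.exp (-x)) atTop (𝓝[>] 0) :=
      tendsto_nhdsWithin_iff.2 ⟨Real.tendsto_exp_neg_atTop_nhds_zero,
        Filter.Eventually.of_forall fun x => Real.exp_pos _⟩
    have t2 := ((hL.tendsto (Real.exp (-u)) (Real.exp_pos _)).comp t1).log one_ne_zero
    rw [Real.log_one] at t2
    refine t2.congr' ?_
    filter_upwards [eventually_gt_atTop 0, eventually_gt_atTop (-u)] with x hx hxu
    rw [hlv x hx, hlv (x + u) (by linarith)]
    simp only [Function.comp]
    have e : Real.exp (-u) * Real.exp (-x) = Real.exp (-(x + u)) := by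
      rw [← Real.exp_add]; congr 1; ring
    rw [e, Real.log_div (hL.pos _ (hexp _ (by linarith))).ne' (hL.pos _ (hexp _ hx)).ne']
  obtain ⟨X, hX⟩ := exists_forall_abs_sub_le_mul hlm hlim hη
  set M := max X 1 with hM
  refine ⟨Real.exp (-M), hexp M (by positivity), fun x y hx hxy hy => ?_⟩
  have hy0 : 0 < y := hx.trans_le hxy
  have e1 : Real.log y ≤ -M := by
    rw [← Real.log_exp (-M)]; exact Real.log_le_log hy0 hy
  have e2 : Real.log x ≤ Real.log y := Real.log_le_log hx hxy
  have hM1 : X ≤ M := le_max_left _ _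
  have hM2 : 1 ≤ M := le_max_right _ _
  have := hX (-Real.log y) (by linarith) (Real.log y - Real.log x) (by linarith)
  rw [hlv _ (by linarith), hlv _ (by linarith)] at this
  rw [show -Real.log y + (Real.log y - Real.log x) = -Real.log x by ring, neg_neg, neg_neg,
    Real.exp_log hx, Real.exp_log hy0] at this
  rwa [Real.log_div hy0.ne' hx.ne']

/-- Potter's bound. -/
lemma IsSlowlyVarying.exists_potter {L : ℝ → ℝ} (hL : IsSlowlyVarying L)
    (hLbdd : ∀ a b : ℝ, 0 < a → b < 1 → BddAbove (L '' Icc a b)) {η ε : ℝ}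
    (hη : 0 < η) (hε : 0 < ε) : ∃ K > 0, ∃ h₀ ∈ Ioo (0 : ℝ) 1, ∀ h, 0 < h → h ≤ h₀ → ∀ x, 0 < x →
      h * x ≤ 1 - ε → L (h * x) ≤ K * (x ^ η + x ^ (-η)) * L h := by
  obtain ⟨δ, hδ, h1⟩ := hL.exists_abs_log_sub_le hη
  obtain ⟨M, hM⟩ := hLbdd δ (1 - ε) hδ.1 (by linarith)
  have hMb : ∀ x, δ ≤ x → x ≤ 1 - ε → L x ≤ max M 0 := fun x hx hx' =>
    (hM ⟨x, ⟨hx, hx'⟩, rfl⟩).trans (le_max_left _ _)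
  have hLδ : 0 < L δ := hL.pos δ hδ
  have key : ∀ x y, 0 < x → x ≤ y → y ≤ δ → L x ≤ Real.exp η * (y / x) ^ η * L y ∧
      L y ≤ Real.exp η * (y / x) ^ η * L x := by
    intro x y hx hxy hy
    have hy0 : 0 < y := hx.trans_le hxy
    have hLx : 0 < L x := hL.pos x ⟨hx, (hxy.trans hy).trans_lt hδ.2⟩
    have hLy : 0 < L y := hL.pos y ⟨hy0, hy.trans_lt hδ.2⟩
    have h2 := abs_le.1 (h1 x y hx hxy hy)
    have e : Real.exp η * (y / x) ^ η = Real.exp (η * (Real.log (y / x) + 1)) := by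
      rw [Real.rpow_def_of_pos (div_pos hy0 hx), ← Real.exp_add]; congr 1; ring
    rw [e]
    constructor
    · calc L x = Real.exp (Real.log (L x)) := (Real.exp_log hLx).symm
        _ ≤ Real.exp (η * (Real.log (y / x) + 1) + Real.log (L y)) :=
          Real.exp_le_exp.2 (by linarith [h2.2])
        _ = _ := by rw [Real.exp_add, Real.exp_log hLy]
    · calc L y = Real.exp (Real.log (L y)) := (Real.exp_log hLy).symm
        _ ≤ Real.exp (η * (Real.log (y / x) + 1) + Real.log (L x)) :=
          Real.exp_le_exp.2 (by linarith [h2.1])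
        _ = _ := by rw [Real.exp_add, Real.exp_log hLx]
  -- Between δ and 1 - ε the logarithmic estimate says nothing; L is bounded there by hypothesis,
  -- and this bound is expressed as a multiple of L δ, which is comparable with L h.
  set c := max M 0 / L δ with hc
  have hc0 : 0 ≤ c := div_nonneg (le_max_right _ _) hLδ.le
  refine ⟨Real.exp η * (1 + c), by positivity, δ, hδ, fun h hh hhδ x hx hxε => ?_⟩
  have hLh : 0 < L h := hL.pos h ⟨hh, hhδ.trans_lt hδ.2⟩
  have hxη : 0 < x ^ η := Real.rpow_pos_of_pos hx _
  have hxη' : 0 < x ^ (-η) := Real.rpow_pos_of_pos hx _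
  have hexp := Real.exp_pos η
  rcases le_total (h * x) δ with hd | hd
  · have main : L (h * x) ≤ Real.exp η * (x ^ η + x ^ (-η)) * L h := by
      rcases le_total x 1 with hx1 | hx1
      · have := (key (h * x) h (by positivity) (by nlinarith) hhδ).1
        rw [show h / (h * x) = x⁻¹ by field_simp, Real.inv_rpow hx.le, ← Real.rpow_neg hx.le] at this
        refine this.trans ?_
        gcongr
        linarith
      · have := (key h (h * x) hh (by nlinarith) hd).2
        rw [show h * x / h = x by field_simp] at this
        refine this.trans ?_
        gcongr
        linarith
    refine main.trans ?_
    gcongr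
    nlinarith
  · have e1 : L (h * x) ≤ c * L δ := by
      rw [hc, div_mul_cancel₀ _ hLδ.ne']; exact hMb _ hd hxε
    have e2 := (key h δ hh hhδ le_rfl).2
    have e3 : (δ / h) ^ η ≤ x ^ η := by
      refine Real.rpow_le_rpow (div_pos hδ.1 hh).le ?_ hη.le
      rw [div_le_iff₀ hh]; linarith
    calc L (h * x) ≤ c * (Real.exp η * (δ / h) ^ η * L h) :=
          e1.trans (mul_le_mul_of_nonneg_left e2 hc0)
      _ ≤ c * (Real.exp η * x ^ η * L h) := by gcongr
      _ ≤ (1 + c) * (Real.exp η * (x ^ η + x ^ (-η)) * L h) := by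
          gcongr <;> linarith
      _ = _ := by ring

end SlowVariation

/-! ### Second differences as averages of derivatives -/

section SecondDifference

/-- Lebesgue measure on the unit interval. -/
def unitMeasure : Measure ℝ := volume.restrict (Ioo (0 : ℝ) 1)

/-- Lebesgue measure on the unit square. -/
def squareMeasure : Measure (ℝ × ℝ) := unitMeasure.prod unitMeasure

/-- Lebesgue measure on the four-dimensional unit cube. -/
def cubeMeasure : Measure ((ℝ × ℝ) × (ℝ × ℝ)) := squareMeasure.prod squareMeasure

instance : IsProbabilityMeasure unitMeasure := ⟨by simp [unitMeasure]⟩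

instance : IsProbabilityMeasure squareMeasure := by unfold squareMeasure; infer_instance

instance : IsProbabilityMeasure cubeMeasure := by unfold cubeMeasure; infer_instance

lemma ae_unitMeasure : ∀ᵐ a ∂unitMeasure, a ∈ Ioo (0 : ℝ) 1 := ae_restrict_mem measurableSet_Ioo

lemma ae_squareMeasure : ∀ᵐ p ∂squareMeasure, p.1 ∈ Ioo (0 : ℝ) 1 ∧ p.2 ∈ Ioo (0 : ℝ) 1 :=
  (Measure.quasiMeasurePreserving_fst.ae ae_unitMeasure).and
    (Measure.quasiMeasurePreserving_snd.ae ae_unitMeasure)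

lemma ae_cubeMeasure : ∀ᵐ p ∂cubeMeasure, (p.1.1 ∈ Ioo (0 : ℝ) 1 ∧ p.1.2 ∈ Ioo (0 : ℝ) 1) ∧
    (p.2.1 ∈ Ioo (0 : ℝ) 1 ∧ p.2.2 ∈ Ioo (0 : ℝ) 1) :=
  (Measure.quasiMeasurePreserving_fst.ae ae_squareMeasure).and
    (Measure.quasiMeasurePreserving_snd.ae ae_squareMeasure)

lemma intervalIntegral_eq_unitMeasure (f : ℝ → ℝ) :
    ∫ x in (0 : ℝ)..1, f x = ∫ x, f x ∂unitMeasure := by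
  rw [intervalIntegral.integral_of_le zero_le_one, integral_Ioc_eq_integral_Ioo, unitMeasure]

lemma intervalIntegrable_iff_unitMeasure {f : ℝ → ℝ} :
    IntervalIntegrable f volume 0 1 ↔ Integrable f unitMeasure := by
  rw [intervalIntegrable_iff_integrableOn_Ioo_of_le zero_le_one]
  rfl

/-- Second differences as averages of the second derivative, which may be singular at the end
points. -/
lemma second_difference_eq_integral {f f' f'' : ℝ → ℝ} {t h : ℝ} (hh : 0 < h)
    (hf : ContinuousOn f (Icc (t - h) (t + h)))
    (hf' : ∀ x ∈ Ioo (t - h) (t + h), HasDerivAt f (f' x) x)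
    (hf'' : ∀ x ∈ Ioo (t - h) (t + h), HasDerivAt f' (f'' x) x)
    (hint : Integrable (fun p : ℝ × ℝ => f'' (t - h + h * (p.1 + p.2))) squareMeasure) :
    f (t + h) + f (t - h) - 2 * f t =
      h ^ 2 * ∫ p, f'' (t - h + h * (p.1 + p.2)) ∂squareMeasure := by
  set g : ℝ → ℝ := fun a => f' (t + h * a) - f' (t - h + h * a) with hg
  -- For a inside ]0,1[ and b in [0,1] the argument stays strictly inside the interval, so the
  -- fundamental theorem of calculus applies to f'. In the remaining variable a the end points are
  -- reached, but there only continuity of f is needed.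
  have hI : ∀ᵐ a ∂unitMeasure, h * ∫ b, f'' (t - h + h * (a + b)) ∂unitMeasure = g a := by
    filter_upwards [hint.prod_right_ae, ae_unitMeasure] with a ha ha'
    rw [← intervalIntegral_eq_unitMeasure, ← intervalIntegral.integral_const_mul]
    have hd : ∀ b ∈ uIcc (0 : ℝ) 1, HasDerivAt (fun b => f' (t - h + h * (a + b)))
        (h * f'' (t - h + h * (a + b))) b := by
      intro b hb
      rw [uIcc_of_le zero_le_one] at hb
      have h1 := hf'' (t - h + h * (a + b)) ⟨by nlinarith [ha'.1, hb.1], by nlinarith [ha'.2, hb.2]⟩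
      have h2 : HasDerivAt (fun b => t - h + h * (a + b)) h b := by
        simpa using (((hasDerivAt_id b).const_add a).const_mul h).const_add (t - h)
      rw [mul_comm]
      exact h1.comp b h2
    rw [intervalIntegral.integral_eq_sub_of_hasDerivAt hd
      ((intervalIntegrable_iff_unitMeasure.2 ha).const_mul h)]
    simp only [hg]
    congr 2 <;> ring
  have hgint : Integrable g unitMeasure :=
    (hint.integral_prod_left.const_mul h).congr hI
  have hF : ∫ a in (0 : ℝ)..1, h * g a =
      (f (t + h * 1) - f (t - h + h * 1)) - (f (t + h * 0) - f (t - h + h * 0)) := by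
    have haff : ∀ c a : ℝ, HasDerivAt (fun a => c + h * a) h a := fun c a => by
      simpa using ((hasDerivAt_id a).const_mul h).const_add c
    refine intervalIntegral.integral_eq_sub_of_hasDeriv_right_of_le
      (f := fun a => f (t + h * a) - f (t - h + h * a)) zero_le_one ?_ ?_ ?_
    · refine ContinuousOn.sub ?_ ?_
      · refine hf.comp (by fun_prop) fun a ha => ?_
        constructor <;> nlinarith [ha.1, ha.2]
      · refine hf.comp (by fun_prop) fun a ha => ?_
        constructor <;> nlinarith [ha.1, ha.2]
    · intro a ha
      have h1 := (hf' (t + h * a) ⟨by nlinarith [ha.1], by nlinarith [ha.2]⟩).comp a (haff t a)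
      have h2 := (hf' (t - h + h * a) ⟨by nlinarith [ha.1], by nlinarith [ha.2]⟩).comp a
        (haff (t - h) a)
      have := (h1.sub h2).hasDerivWithinAt (s := Ioi a)
      convert this using 1
      · rfl
      · simp only [hg]; ring
    · exact (intervalIntegrable_iff_unitMeasure.2 hgint).const_mul h
  rw [squareMeasure, integral_prod _ hint]
  have : h ^ 2 * ∫ a, ∫ b, f'' (t - h + h * (a + b)) ∂unitMeasure ∂unitMeasure =
      ∫ a in (0 : ℝ)..1, h * g a := by
    rw [intervalIntegral_eq_unitMeasure, integral_const_mul, ← integral_congr_ae hI,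
      integral_const_mul]
    ring
  rw [this, hF]
  simp only [mul_one, mul_zero, add_zero, sub_add_cancel]
  ring

/-- The one-variable formula is used in s on ∂²R/∂t², then in t on the second s-difference of R. The
two squares of parameters may touch the diagonal at one corner (t + h = s - h), where D can blow up;
hence integrability is assumed, and Fubini makes the inner formula available for almost every
t-argument. -/
lemma IsMixedDeriv.delta_eq_integral {R D : ℝ → ℝ → ℝ} (hD : IsMixedDeriv R D)
    (hR : ContinuousOn (fun p : ℝ × ℝ => R p.1 p.2) (Icc 0 1 ×ˢ Icc 0 1)) {s t h : ℝ} (hh : 0 < h)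
    (ht : 0 ≤ t - h) (hts : t + h ≤ s - h) (hs : s + h ≤ 1)
    (hint : Integrable (fun p : (ℝ × ℝ) × (ℝ × ℝ) =>
      D (s - h + h * (p.1.1 + p.1.2)) (t - h + h * (p.2.1 + p.2.2))) cubeMeasure) :
    delta₁ h (delta₂ h R) s t = h ^ 4 * ∫ p, D (s - h + h * (p.1.1 + p.1.2))
      (t - h + h * (p.2.1 + p.2.2)) ∂cubeMeasure := by
  obtain ⟨R₁, R₂, R₃, hder⟩ := hD
  have hmem : ∀ x ∈ Icc (s - h) (s + h), x ∈ Ioc (0 : ℝ) 1 := fun x hx =>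
    ⟨by linarith [hx.1], by linarith [hx.2]⟩
  have hmem' : ∀ x ∈ Ioo (s - h) (s + h), x ∈ Ioo (0 : ℝ) 1 := fun x hx =>
    ⟨by linarith [hx.1], by linarith [hx.2]⟩
  have hmemt : ∀ y ∈ Ioo (t - h) (t + h), y ∈ Ioo (0 : ℝ) 1 := fun y hy =>
    ⟨by linarith [hy.1], by linarith [hy.2]⟩
  have hne : ∀ x ∈ Icc (s - h) (s + h), ∀ y ∈ Ioo (t - h) (t + h), x ≠ y := fun x hx y hy => by
    have := hx.1; have := hy.2; intro h; linarith
  have hnhds : ∀ x ∈ Ioo (0 : ℝ) 1, Ioc (0 : ℝ) 1 ∈ 𝓝 x := fun x hx => Ioc_mem_nhds hx.1 hx.2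
  have hoc : ∀ x ∈ Ioo (0 : ℝ) 1, x ∈ Ioc (0 : ℝ) 1 := fun x hx => ⟨hx.1, hx.2.le⟩
  have mS : s ∈ Icc (s - h) (s + h) := ⟨by linarith, by linarith⟩
  have mP : s + h ∈ Icc (s - h) (s + h) := ⟨by linarith, by linarith⟩
  have mM : s - h ∈ Icc (s - h) (s + h) := ⟨by linarith, by linarith⟩
  -- This is the second y-derivative of the second s-difference of R, hence the bridge between the
  -- two applications.
  set G'' : ℝ → ℝ := fun y => R₂ (s + h) y + R₂ (s - h) y - 2 * R₂ s y with hG''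
  have inner : ∀ y ∈ Ioo (t - h) (t + h),
      Integrable (fun p : ℝ × ℝ => D (s - h + h * (p.1 + p.2)) y) squareMeasure →
      G'' y = h ^ 2 * ∫ p, D (s - h + h * (p.1 + p.2)) y ∂squareMeasure := by
    intro y hy hi
    refine second_difference_eq_integral (f := fun x => R₂ x y) (f' := fun x => R₃ x y)
      (f'' := fun x => D x y) hh ?_ ?_ ?_ hi
    · intro x hx
      refine ((hder x (hmem x hx) y (hoc y (hmemt y hy)) (hne x hx y hy)).2.2.1).continuousWithinAt.mono
        fun z hz => hmem z hz
    · intro x hx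
      exact ((hder x (hmem x (Ioo_subset_Icc_self hx)) y (hoc y (hmemt y hy))
        (hne x (Ioo_subset_Icc_self hx) y hy)).2.2.1).hasDerivAt (hnhds x (hmem' x hx))
    · intro x hx
      exact ((hder x (hmem x (Ioo_subset_Icc_self hx)) y (hoc y (hmemt y hy))
        (hne x (Ioo_subset_Icc_self hx) y hy)).2.2.2).hasDerivAt (hnhds x (hmem' x hx))
  have hae : ∀ᵐ q ∂squareMeasure, h ^ 2 * ∫ p, D (s - h + h * (p.1 + p.2))
      (t - h + h * (q.1 + q.2)) ∂squareMeasure = G'' (t - h + h * (q.1 + q.2)) := by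
    filter_upwards [hint.prod_left_ae, ae_squareMeasure] with q hq hq'
    refine (inner _ ⟨?_, ?_⟩ hq).symm
    · nlinarith [hq'.1.1, hq'.2.1]
    · nlinarith [hq'.1.2, hq'.2.2]
  have hGint : Integrable (fun q : ℝ × ℝ => G'' (t - h + h * (q.1 + q.2))) squareMeasure :=
    (hint.integral_prod_right.const_mul (h ^ 2)).congr hae
  have hcont : ∀ x ∈ Icc (s - h) (s + h), ContinuousOn (fun y => R x y) (Icc (t - h) (t + h)) := by
    intro x hx
    refine hR.comp (f := fun y => (x, y)) (by fun_prop) fun y hy => ⟨?_, ?_⟩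
    · exact Ioc_subset_Icc_self (hmem x hx)
    · exact ⟨by linarith [hy.1], by linarith [hy.2]⟩
  have outer := second_difference_eq_integral
    (f := fun y => R (s + h) y + R (s - h) y - 2 * R s y)
    (f' := fun y => R₁ (s + h) y + R₁ (s - h) y - 2 * R₁ s y) (f'' := G'') (t := t) hh
    (((hcont _ mP).add (hcont _ mM)).sub ((hcont _ mS).const_smul (2 : ℝ)))
    (fun y hy => by
      have d := fun x hx => ((hder x (hmem x hx) y (hoc y (hmemt y hy))
        (hne x hx y hy)).1).hasDerivAt (hnhds y (hmemt y hy))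
      exact ((d _ mP).add (d _ mM)).sub ((d _ mS).const_mul 2))
    (fun y hy => by
      have d := fun x hx => ((hder x (hmem x hx) y (hoc y (hmemt y hy))
        (hne x hx y hy)).2.1).hasDerivAt (hnhds y (hmemt y hy))
      exact ((d _ mP).add (d _ mM)).sub ((d _ mS).const_mul 2)) hGint
  rw [cubeMeasure, integral_prod_symm _ hint]
  have e : delta₁ h (delta₂ h R) s t = R (s + h) (t + h) + R (s - h) (t + h) - 2 * R s (t + h) +
      (R (s + h) (t - h) + R (s - h) (t - h) - 2 * R s (t - h)) -
      2 * (R (s + h) t + R (s - h) t - 2 * R s t) := by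
    simp only [delta₁, delta₂]; ring
  rw [e, outer, ← integral_congr_ae hae, integral_const_mul]
  ring

end SecondDifference

/-! ### The coefficients ρ_γ as integrals over the unit cube -/

section Rho

/-- The distance between the two points of the rectangle of indices parametrized by the cube. -/
def gap (l : ℝ) (p : (ℝ × ℝ) × (ℝ × ℝ)) : ℝ := l + (p.1.1 + p.1.2) - (p.2.1 + p.2.2)

lemma continuous_gap (l : ℝ) : Continuous (gap l) := by unfold gap; fun_prop

lemma ae_gap (l : ℝ) : ∀ᵐ p ∂cubeMeasure, l - 2 < gap l p ∧ gap l p < l + 2 := by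
  filter_upwards [ae_cubeMeasure] with p hp
  obtain ⟨⟨⟨_, _⟩, _, _⟩, ⟨_, _⟩, _, _⟩ := hp
  unfold gap
  constructor <;> linarith

/-- With p = ((a,b),(c,d)), the gap is (l - 2) + a + b + (1 - c) + (1 - d), so it dominates each of
the last four terms. For positive r, spreading the power evenly bounds the integrand by a product of
four factors x^(-r/4), each integrable exactly because r < 4. -/
lemma integrable_gap_rpow {l : ℝ} (hl : 2 ≤ l) {r : ℝ} (hr : r < 4) :
    Integrable (fun p => gap l p ^ (-r)) cubeMeasure := by
  rcases le_or_gt r 0 with hr0 | hr0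
  · have hc : Continuous fun x : ℝ => x ^ (-r) := Real.continuous_rpow_const (by linarith)
    refine Integrable.of_bound (C := (l + 2) ^ (-r))
      (hc.comp (continuous_gap l)).aestronglyMeasurable ?_
    filter_upwards [ae_gap l] with p hp
    rw [Real.norm_eq_abs, abs_of_nonneg (Real.rpow_nonneg (by linarith) _)]
    exact Real.rpow_le_rpow (by linarith) hp.2.le (by linarith)
  · have i1 : Integrable (fun x : ℝ => x ^ (-(r / 4))) unitMeasure :=
      intervalIntegrable_iff_unitMeasure.1 (intervalIntegral.intervalIntegrable_rpow' (by linarith))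
    have i2 : Integrable (fun x : ℝ => (1 - x) ^ (-(r / 4))) unitMeasure := by
      refine intervalIntegrable_iff_unitMeasure.1 ?_
      have := (intervalIntegral.intervalIntegrable_rpow' (a := 1) (b := 0) (r := -(r / 4))
        (by linarith)).comp_sub_left 1
      simpa using this
    have i3 := (i1.mul_prod i1).mul_prod (i2.mul_prod i2)
    refine i3.mono' ?_ ?_
    · refine Measurable.aestronglyMeasurable ?_
      exact (continuous_gap l).measurable.pow_const _
    · filter_upwards [ae_cubeMeasure] with p hp
      obtain ⟨⟨⟨h1, _⟩, h2, _⟩, ⟨_, h3⟩, _, h4⟩ := hp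
      have h3' : 0 < 1 - p.2.1 := by linarith
      have h4' : 0 < 1 - p.2.2 := by linarith
      have g0 : 0 < gap l p := by unfold gap; linarith
      have b1 : p.1.1 ≤ gap l p := by unfold gap; linarith
      have b2 : p.1.2 ≤ gap l p := by unfold gap; linarith
      have b3 : 1 - p.2.1 ≤ gap l p := by unfold gap; linarith
      have b4 : 1 - p.2.2 ≤ gap l p := by unfold gap; linarith
      rw [Real.norm_eq_abs, abs_of_nonneg (Real.rpow_nonneg g0.le _)]
      have e : gap l p ^ (-r) = gap l p ^ (-(r / 4)) * gap l p ^ (-(r / 4)) *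
          (gap l p ^ (-(r / 4)) * gap l p ^ (-(r / 4))) := by
        rw [← Real.rpow_add g0, ← Real.rpow_add g0]
        congr 1; ring
      rw [e]
      have m : ∀ x : ℝ, 0 < x → x ≤ gap l p → gap l p ^ (-(r / 4)) ≤ x ^ (-(r / 4)) :=
        fun x hx hxg => Real.rpow_le_rpow_of_nonpos hx hxg (by linarith)
      have n : 0 ≤ gap l p ^ (-(r / 4)) := Real.rpow_nonneg g0.le _
      have nx : ∀ x : ℝ, 0 < x → 0 ≤ x ^ (-(r / 4)) := fun x hx => Real.rpow_nonneg hx.le _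
      exact mul_le_mul (mul_le_mul (m _ h1 b1) (m _ h2 b2) n (nx _ h1))
        (mul_le_mul (m _ h3' b3) (m _ h4' b4) n (nx _ h3')) (mul_nonneg n n)
        (mul_nonneg (nx _ h1) (nx _ h2))

/-- The substitutions u = l + a, v = u - 1 + b, x = c, y = x - 1 + d turn v - y into the gap; Fubini
assembles the iterated integrals. -/
lemma rho_eq_integral {γ : ℝ} (hγ : γ < 2) {l : ℕ} (hl : 2 ≤ l) :
    rho γ l = ∫ p, gap l p ^ (-(2 + γ)) ∂cubeMeasure := by
  have hl' : (2 : ℝ) ≤ l := by exact_mod_cast hl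
  have hint := integrable_gap_rpow hl' (r := 2 + γ) (by linarith)
  have shift : ∀ (c : ℝ) (f : ℝ → ℝ), ∫ x in c..(c + 1), f x = ∫ a, f (c + a) ∂unitMeasure := by
    intro c f
    rw [← intervalIntegral_eq_unitMeasure, intervalIntegral.integral_comp_add_left]
    simp
  have shift' : ∀ (c : ℝ) (f : ℝ → ℝ), ∫ x in (c - 1)..c, f x = ∫ a, f (c - 1 + a) ∂unitMeasure := by
    intro c f
    rw [← shift]; simp
  unfold rho rhoInt
  simp_rw [shift, shift']
  rw [cubeMeasure, integral_prod _ hint]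
  have h1 : ∀ᵐ q ∂squareMeasure, ∫ c, ∫ d, gap l (q, (c, d)) ^ (-(2 + γ)) ∂unitMeasure ∂unitMeasure
      = ∫ q', gap l (q, q') ^ (-(2 + γ)) ∂squareMeasure := by
    filter_upwards [hint.prod_right_ae] with q hq
    rw [squareMeasure] at hq ⊢
    rw [integral_prod _ hq]
  rw [← integral_congr_ae h1]
  have h2 : Integrable (fun q => ∫ c, ∫ d, gap l (q, (c, d)) ^ (-(2 + γ)) ∂unitMeasure ∂unitMeasure)
      squareMeasure := hint.integral_prod_left.congr (h1.mono fun _ h => h.symm)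
  rw [squareMeasure] at h2 ⊢
  rw [integral_prod _ h2]
  refine integral_congr_ae (ae_unitMeasure.mono fun a ha => ?_)
  refine integral_congr_ae (ae_unitMeasure.mono fun b hb => ?_)
  refine integral_congr_ae (ae_unitMeasure.mono fun c hc => ?_)
  refine integral_congr_ae (ae_unitMeasure.mono fun d hd => ?_)
  have e : (l : ℝ) + a - 1 + b - (0 + c - 1 + d) = gap l ((a, b), (c, d)) := by
    simp only [gap]; ring
  have g0 : 0 ≤ gap l ((a, b), (c, d)) := by
    simp only [gap]; linarith [ha.1, hb.1, hc.2, hd.2]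
  simp only
  rw [e, one_div, Real.rpow_neg g0]

end Rho

/-- The regularity assumptions on the covariance function away from and near the diagonal. -/
structure IsSingularKernel (R D C : ℝ → ℝ → ℝ) (γ : ℝ) (L : ℝ → ℝ) : Prop where
  cont : ContinuousOn (fun p : ℝ × ℝ => R p.1 p.2) (Icc 0 1 ×ˢ Icc 0 1)
  deriv : IsMixedDeriv R D
  contC : ContinuousOn (fun p : ℝ × ℝ => C p.1 p.2) {p | 0 ≤ p.2 ∧ p.2 ≤ p.1 ∧ p.1 ≤ 1}
  mem : γ ∈ Ioo (0 : ℝ) 2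
  slow : IsSlowlyVarying L
  bdd : ∀ a b : ℝ, 0 < a → b < 1 → BddAbove (L '' Icc a b)
  eq : ∀ s t : ℝ, 0 < t → t < s → s < 1 → (s - t) ^ (2 + γ) / L (s - t) * D s t = C s t

/-- The normalized second-order increment of a covariance function. -/
def normDelta (R : ℝ → ℝ → ℝ) (γ : ℝ) (L : ℝ → ℝ) (h s t : ℝ) : ℝ :=
  delta₁ h (delta₂ h R) s t / (h ^ (2 - γ) * L h)

/-! ### Normalized covariances away from the diagonal -/

section Kernel

/-- Extension of a function on the triangle `0 ≤ t ≤ s ≤ 1` by a retraction of the plane. -/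
def extTriangle (C : ℝ → ℝ → ℝ) (p : ℝ × ℝ) : ℝ :=
  C (max 0 (min p.1 1)) (min (max 0 (min p.2 1)) (max 0 (min p.1 1)))

lemma extTriangle_eq (C : ℝ → ℝ → ℝ) {s t : ℝ} (ht : 0 ≤ t) (hts : t ≤ s) (hs : s ≤ 1) :
    extTriangle C (s, t) = C s t := by
  unfold extTriangle
  simp only
  rw [min_eq_left hs, max_eq_right (ht.trans hts), min_eq_left (hts.trans hs), max_eq_right ht,
    min_eq_left hts]

variable {R D C : ℝ → ℝ → ℝ} {γ : ℝ} {L : ℝ → ℝ}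

lemma IsSingularKernel.continuous_extTriangle (H : IsSingularKernel R D C γ L) :
    Continuous (extTriangle C) := by
  refine H.contC.comp_continuous (f := fun p : ℝ × ℝ =>
    (max 0 (min p.1 1), min (max 0 (min p.2 1)) (max 0 (min p.1 1)))) (by fun_prop) fun p => ?_
  refine ⟨?_, ?_, ?_⟩
  · exact le_min (le_max_left _ _) (le_max_left _ _)
  · exact min_le_right _ _
  · exact max_le zero_le_one (min_le_right _ _)

lemma IsSingularKernel.exists_abs_extTriangle_le (H : IsSingularKernel R D C γ L) :
    ∃ K > 0, ∀ p, |extTriangle C p| ≤ K := by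
  obtain ⟨K, hK⟩ := (isCompact_Icc (a := ((0 : ℝ), (0 : ℝ))) (b := (1, 1))).exists_bound_of_continuousOn
    H.continuous_extTriangle.continuousOn
  refine ⟨max K 1, by positivity, fun p => ?_⟩
  have e : extTriangle C p = extTriangle C (max 0 (min p.1 1), max 0 (min p.2 1)) := by
    unfold extTriangle
    simp
  rw [e]
  refine (hK _ ⟨⟨le_max_left _ _, le_max_left _ _⟩, ?_, ?_⟩).trans (le_max_left _ _)
  · exact max_le zero_le_one (min_le_right _ _)
  · exact max_le zero_le_one (min_le_right _ _)

/-- The integrand representing a normalized second-order increment at distance `l h`. -/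
def kernelIntegrand (C : ℝ → ℝ → ℝ) (γ : ℝ) (L : ℝ → ℝ) (h l t : ℝ) (p : (ℝ × ℝ) × (ℝ × ℝ)) : ℝ :=
  extTriangle C (t + l * h - h + h * (p.1.1 + p.1.2), t - h + h * (p.2.1 + p.2.2)) *
    ((Ioo (0 : ℝ) 1).indicator L (h * gap l p) / L h) * gap l p ^ (-(2 + γ))

lemma IsSingularKernel.aestronglyMeasurable_kernelIntegrand (H : IsSingularKernel R D C γ L)
    (h l t : ℝ) : AEStronglyMeasurable (kernelIntegrand C γ L h l t) cubeMeasure := by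
  refine Measurable.aestronglyMeasurable ?_
  refine Measurable.mul (Measurable.mul ?_ ?_) ((continuous_gap l).measurable.pow_const _)
  · exact H.continuous_extTriangle.measurable.comp (by fun_prop)
  · refine Measurable.div_const ?_ _
    exact H.slow.measurable_indicator.comp ((continuous_gap l).measurable.const_mul h)

/-- An exponent suitable for Potter's bound. -/
def potterExp (γ : ℝ) : ℝ := γ * (2 - γ) / 2

lemma potterExp_pos (hγ : γ ∈ Ioo (0 : ℝ) 2) : 0 < potterExp γ := by
  have := mul_pos hγ.1 (sub_pos.2 hγ.2)
  unfold potterExp; linarith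

/-- This keeps 2 + γ - η at least 2, whence the inverse-square decay in the lag. -/
lemma potterExp_le (hγ : γ ∈ Ioo (0 : ℝ) 2) : potterExp γ ≤ γ := by
  unfold potterExp; nlinarith [hγ.1, hγ.2]

/-- The value 4 is the integrability threshold of `integrable_gap_rpow`, which matters at lag 2,
where the squares touch the diagonal. -/
lemma potterExp_lt (hγ : γ ∈ Ioo (0 : ℝ) 2) : 2 + γ + potterExp γ < 4 := by
  unfold potterExp; nlinarith [hγ.1, hγ.2]

/-- Potter's bound is applied to L(h · gap)/L(h). The constant does not depend on h, l or t, so the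
same estimate yields both the decay in l and the domination needed for the limit; `(l + 2) * h ≤ 1 -
ε` keeps the argument of L away from 1. -/
lemma IsSingularKernel.exists_kernelIntegrand_le (H : IsSingularKernel R D C γ L) {ε : ℝ}
    (hε : 0 < ε) : ∃ K > 0, ∃ h₀ ∈ Ioo (0 : ℝ) 1, ∀ h, 0 < h → h ≤ h₀ → ∀ l t, 2 ≤ l →
      (l + 2) * h ≤ 1 - ε → ∀ᵐ p ∂cubeMeasure, |kernelIntegrand C γ L h l t p| ≤
        K * (gap l p ^ (-(2 + γ - potterExp γ)) + gap l p ^ (-(2 + γ + potterExp γ))) := by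
  obtain ⟨K₁, hK₁, h₀, hh₀, hp⟩ := H.slow.exists_potter H.bdd (potterExp_pos H.mem) hε
  obtain ⟨K₂, hK₂, hC⟩ := H.exists_abs_extTriangle_le
  refine ⟨K₂ * K₁, by positivity, h₀, hh₀, fun h hh hhh l t hl hlh => ?_⟩
  filter_upwards [ae_gap l] with p hg
  have g0 : 0 < gap l p := by linarith [hg.1]
  have hgh : h * gap l p ≤ 1 - ε := by nlinarith [hg.2]
  have hmem : h * gap l p ∈ Ioo (0 : ℝ) 1 := ⟨by positivity, by linarith⟩
  have hLh : 0 < L h := H.slow.pos h ⟨hh, hhh.trans_lt hh₀.2⟩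
  have hLg : 0 < L (h * gap l p) := H.slow.pos _ hmem
  unfold kernelIntegrand
  rw [indicator_of_mem hmem, abs_mul, abs_mul, abs_of_pos (div_pos hLg hLh),
    abs_of_pos (Real.rpow_pos_of_pos g0 _)]
  have e1 : gap l p ^ (-(2 + γ - potterExp γ)) = gap l p ^ potterExp γ * gap l p ^ (-(2 + γ)) := by
    rw [← Real.rpow_add g0]; congr 1; ring
  have e2 : gap l p ^ (-(2 + γ + potterExp γ)) =
      gap l p ^ (-potterExp γ) * gap l p ^ (-(2 + γ)) := by
    rw [← Real.rpow_add g0]; congr 1; ring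
  rw [e1, e2, ← add_mul, mul_assoc K₂, mul_assoc, ← mul_assoc K₁]
  have h1 : L (h * gap l p) / L h ≤ K₁ * (gap l p ^ potterExp γ + gap l p ^ (-potterExp γ)) := by
    rw [div_le_iff₀ hLh]
    exact hp h hh hhh _ g0 hgh
  have hr : 0 < gap l p ^ (-(2 + γ)) := Real.rpow_pos_of_pos g0 _
  exact mul_le_mul (hC _) (mul_le_mul_of_nonneg_right h1 hr.le) (by positivity) hK₂.le

lemma integrable_potter_bound (hγ : γ ∈ Ioo (0 : ℝ) 2) {l : ℝ} (hl : 2 ≤ l) :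
    Integrable (fun p => gap l p ^ (-(2 + γ - potterExp γ)) + gap l p ^ (-(2 + γ + potterExp γ)))
      cubeMeasure := by
  have := potterExp_pos hγ
  have := potterExp_lt hγ
  exact (integrable_gap_rpow hl (by linarith)).add (integrable_gap_rpow hl (by linarith))

/-- Off the diagonal D = C · L(h · gap) · (h · gap)^(-(2+γ)), and the powers of h match: h⁴
h^(-(2+γ)) = h^(2-γ), which is the normalization. -/
lemma IsSingularKernel.normDelta_eq_integral (H : IsSingularKernel R D C γ L) {h l t : ℝ}
    (hh : 0 < h) (hh1 : h < 1) (hl : 2 ≤ l) (ht : 0 ≤ t - h) (hs : t + l * h + h ≤ 1)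
    (hint : Integrable (kernelIntegrand C γ L h l t) cubeMeasure) :
    normDelta R γ L h (t + l * h) t = ∫ p, kernelIntegrand C γ L h l t p ∂cubeMeasure := by
  have hLh : 0 < L h := H.slow.pos h ⟨hh, hh1⟩
  have hγ := H.mem
  have hae : ∀ᵐ p ∂cubeMeasure, h ^ (-(2 + γ)) * L h * kernelIntegrand C γ L h l t p =
      D (t + l * h - h + h * (p.1.1 + p.1.2)) (t - h + h * (p.2.1 + p.2.2)) := by
    filter_upwards [ae_cubeMeasure, ae_gap l] with p hp hg
    obtain ⟨⟨⟨h1, h1'⟩, h2, h2'⟩, ⟨h3, h3'⟩, h4, h4'⟩ := hp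
    set s' := t + l * h - h + h * (p.1.1 + p.1.2) with hs'
    set t' := t - h + h * (p.2.1 + p.2.2) with ht'
    have g0 : 0 < gap l p := by linarith [hg.1]
    have e : s' - t' = h * gap l p := by simp only [hs', ht', gap]; ring
    have t0 : 0 < t' := by have := mul_pos hh h3; have := mul_pos hh h4; simp only [ht']; linarith
    have s1 : s' < 1 := by
      have := mul_lt_mul_of_pos_left h1' hh
      have := mul_lt_mul_of_pos_left h2' hh
      simp only [hs']; linarith
    have ts : t' < s' := by have := mul_pos hh g0; linarith
    have hmem : h * gap l p ∈ Ioo (0 : ℝ) 1 := ⟨by positivity, by rw [← e]; linarith⟩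
    have hLg : 0 < L (h * gap l p) := H.slow.pos _ hmem
    have hD := H.eq s' t' t0 ts s1
    unfold kernelIntegrand
    rw [indicator_of_mem hmem, extTriangle_eq C t0.le ts.le s1.le, ← hD, e,
      Real.mul_rpow hh.le g0.le, Real.rpow_neg hh.le, Real.rpow_neg g0.le]
    have := (Real.rpow_pos_of_pos hh (2 + γ)).ne'
    have := (Real.rpow_pos_of_pos g0 (2 + γ)).ne'
    field_simp
  have hDint := (hint.const_mul (h ^ (-(2 + γ)) * L h)).congr hae
  rw [normDelta, H.deriv.delta_eq_integral H.cont hh ht (by nlinarith) hs hDint,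
    ← integral_congr_ae hae, integral_const_mul]
  have e4 : h ^ 4 = h ^ (2 - γ) * h ^ (2 + γ) := by
    rw [← Real.rpow_add hh, ← Real.rpow_natCast]; congr 1; push_cast; ring
  have e5 : h ^ (2 + γ) * h ^ (-(2 + γ)) = 1 := by rw [← Real.rpow_add hh]; simp
  have := (Real.rpow_pos_of_pos hh (2 - γ)).ne'
  rw [div_eq_iff (by positivity), e4]
  calc h ^ (2 - γ) * h ^ (2 + γ) * (h ^ (-(2 + γ)) * L h * ∫ p, kernelIntegrand C γ L h l t p ∂cubeMeasure)
      = (h ^ (2 + γ) * h ^ (-(2 + γ))) * ((∫ p, kernelIntegrand C γ L h l t p ∂cubeMeasure) *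
        (h ^ (2 - γ) * L h)) := by ring
    _ = _ := by rw [e5, one_mul]

/-- For l ≥ 3 the gap is at least l - 2 ≥ 1, so both Potter exponents may be lowered to 2. -/
lemma IsSingularKernel.exists_normDelta_le (H : IsSingularKernel R D C γ L) {ε : ℝ} (hε : 0 < ε) :
    ∃ K > 0, ∃ h₀ ∈ Ioo (0 : ℝ) 1, ∀ h, 0 < h → h ≤ h₀ → ∀ l t, 3 ≤ l → 0 ≤ t - h →
      t + l * h + h ≤ 1 → (l + 2) * h ≤ 1 - ε →
        |normDelta R γ L h (t + l * h) t| ≤ K / (l - 2) ^ 2 := by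
  obtain ⟨K, hK, h₀, hh₀, hb⟩ := H.exists_kernelIntegrand_le hε
  refine ⟨K * 2, by positivity, h₀, hh₀, fun h hh hhh l t hl ht hs hlh => ?_⟩
  have hb' := hb h hh hhh l t (by linarith) hlh
  have hη := potterExp_pos H.mem
  have hη' := potterExp_le H.mem
  have hint : Integrable (kernelIntegrand C γ L h l t) cubeMeasure :=
    ((integrable_potter_bound H.mem (by linarith)).const_mul K).mono'
      (H.aestronglyMeasurable_kernelIntegrand h l t) hb'
  rw [H.normDelta_eq_integral hh (hhh.trans_lt hh₀.2) (by linarith) ht hs hint]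
  have hbound : ∀ᵐ p ∂cubeMeasure, ‖kernelIntegrand C γ L h l t p‖ ≤ K * 2 / (l - 2) ^ 2 := by
    filter_upwards [hb', ae_gap l] with p hp hg
    refine hp.trans ?_
    rw [mul_div_assoc]
    refine mul_le_mul_of_nonneg_left ?_ hK.le
    have hl2 : 0 < l - 2 := by linarith
    have g1 : 1 ≤ gap l p := by linarith [hg.1]
    have key : ∀ r : ℝ, 2 ≤ r → gap l p ^ (-r) ≤ 1 / (l - 2) ^ 2 := by
      intro r hr
      have : gap l p ^ (-r) ≤ gap l p ^ (-2 : ℝ) :=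
        Real.rpow_le_rpow_of_exponent_le g1 (by linarith)
      refine this.trans ?_
      rw [Real.rpow_neg (by linarith), one_div, Real.rpow_two]
      exact inv_anti₀ (by positivity) (by nlinarith [hg.1])
    have h1 := key (2 + γ - potterExp γ) (by linarith)
    have h2 := key (2 + γ + potterExp γ) (by linarith [H.mem.1])
    calc _ ≤ 1 / (l - 2) ^ 2 + 1 / (l - 2) ^ 2 := add_le_add h1 h2
      _ = _ := by ring
  have := norm_integral_le_of_norm_le_const hbound
  simpa using this

/-- Dominated convergence: C converges to its diagonal value by continuity and the ratio of values
of L tends to 1. The choice ε = 1/2 is harmless, as l · u n → 0 for fixed l. -/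
lemma IsSingularKernel.tendsto_normDelta (H : IsSingularKernel R D C γ L) {l : ℕ} (hl : 2 ≤ l)
    {u τ : ℕ → ℝ} {t : ℝ} (ht : t ∈ Ioo (0 : ℝ) 1) (hu : Tendsto u atTop (𝓝[>] 0))
    (hτ : Tendsto τ atTop (𝓝 t)) :
    Tendsto (fun n => normDelta R γ L (u n) (τ n + l * u n) (τ n)) atTop (𝓝 (C t t * rho γ l)) := by
  have hl' : (2 : ℝ) ≤ l := by exact_mod_cast hl
  have hu0 : Tendsto u atTop (𝓝 0) := hu.mono_right nhdsWithin_le_nhds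
  have hupos : ∀ᶠ n in atTop, 0 < u n := hu.eventually self_mem_nhdsWithin
  obtain ⟨K, hK, h₀, hh₀, hb⟩ := H.exists_kernelIntegrand_le (ε := 1 / 2) (by norm_num)
  have ev1 : ∀ᶠ n in atTop, u n ≤ h₀ := (hu0.eventually (gt_mem_nhds hh₀.1)).mono fun _ h => h.le
  have ev2 : ∀ᶠ n in atTop, ((l : ℝ) + 2) * u n ≤ 1 - 1 / 2 := by
    have : Tendsto (fun n => ((l : ℝ) + 2) * u n) atTop (𝓝 0) := by simpa using hu0.const_mul _
    exact (this.eventually (gt_mem_nhds (by norm_num : (0 : ℝ) < 1 - 1 / 2))).mono fun _ h => h.le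
  have ev3 : ∀ᶠ n in atTop, 0 ≤ τ n - u n := by
    have : Tendsto (fun n => τ n - u n) atTop (𝓝 (t - 0)) := hτ.sub hu0
    exact (this.eventually (lt_mem_nhds (by simpa using ht.1))).mono fun _ h => h.le
  have ev4 : ∀ᶠ n in atTop, τ n + l * u n + u n ≤ 1 := by
    have : Tendsto (fun n => τ n + l * u n + u n) atTop (𝓝 (t + l * 0 + 0)) :=
      (hτ.add (hu0.const_mul _)).add hu0
    exact (this.eventually (gt_mem_nhds (by simpa using ht.2))).mono fun _ h => h.le
  have hbn : ∀ᶠ n in atTop, ∀ᵐ p ∂cubeMeasure, ‖kernelIntegrand C γ L (u n) l (τ n) p‖ ≤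
      K * (gap l p ^ (-(2 + γ - potterExp γ)) + gap l p ^ (-(2 + γ + potterExp γ))) := by
    filter_upwards [hupos, ev1, ev2] with n h1 h2 h3 using hb _ h1 h2 l _ hl' h3
  have hintb := (integrable_potter_bound H.mem hl').const_mul K
  have lim : Tendsto (fun n => ∫ p, kernelIntegrand C γ L (u n) l (τ n) p ∂cubeMeasure) atTop
      (𝓝 (∫ p, C t t * gap l p ^ (-(2 + γ)) ∂cubeMeasure)) := by
    refine tendsto_integral_filter_of_dominated_convergence _
      (Filter.Eventually.of_forall fun n => H.aestronglyMeasurable_kernelIntegrand _ _ _) hbn hintb ?_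
    filter_upwards [ae_gap l] with p hg
    have g0 : 0 < gap l p := by linarith [hg.1]
    refine Tendsto.mul_const _ ?_
    rw [← mul_one (C t t), ← extTriangle_eq C ht.1.le le_rfl ht.2.le]
    refine Tendsto.mul ?_ ?_
    · refine (H.continuous_extTriangle.tendsto (t, t)).comp ?_
      refine Tendsto.prodMk_nhds ?_ ?_
      · have : Tendsto (fun n => τ n + l * u n - u n + u n * (p.1.1 + p.1.2)) atTop
            (𝓝 (t + l * 0 - 0 + 0 * (p.1.1 + p.1.2))) :=
          ((hτ.add (hu0.const_mul _)).sub hu0).add (hu0.mul_const _)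
        simpa using this
      · have : Tendsto (fun n => τ n - u n + u n * (p.2.1 + p.2.2)) atTop
            (𝓝 (t - 0 + 0 * (p.2.1 + p.2.2))) :=
          (hτ.sub hu0).add (hu0.mul_const _)
        simpa using this
    · refine ((H.slow.tendsto _ g0).comp hu).congr' ?_
      filter_upwards [hupos, ev2] with n h1 h2
      have hmem : u n * gap l p ∈ Ioo (0 : ℝ) 1 := ⟨by positivity, by nlinarith [hg.2]⟩
      simp only [Function.comp]
      rw [indicator_of_mem hmem, mul_comm]
  rw [integral_const_mul, ← rho_eq_integral H.mem.2 hl] at lim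
  refine lim.congr' ?_
  filter_upwards [hupos, ev1, ev3, ev4, hbn] with n h1 h2 h3 h4 h5
  exact (H.normDelta_eq_integral h1 (h2.trans_lt hh₀.2) hl' h3 h4
    (hintb.mono' (H.aestronglyMeasurable_kernelIntegrand _ _ _) h5)).symm

end Kernel

/-! ### Positive semidefinite kernels on finite sets -/

section PSD

/-- The quadratic form attached to a kernel restricted to a finite set. -/
def quadForm (s : Finset ℕ) (c : ℕ → ℕ → ℝ) (x y : ℕ → ℝ) : ℝ :=
  ∑ i ∈ s, ∑ j ∈ s, x i * y j * c i j

/-- A symmetric kernel that is positive semidefinite on a finite set. -/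
structure IsPSDOn (s : Finset ℕ) (c : ℕ → ℕ → ℝ) : Prop where
  symm : ∀ i ∈ s, ∀ j ∈ s, c i j = c j i
  nonneg : ∀ x, 0 ≤ quadForm s c x x

variable {s : Finset ℕ} {c : ℕ → ℕ → ℝ}

lemma IsPSDOn.comm (h : IsPSDOn s c) (x y : ℕ → ℝ) : quadForm s c x y = quadForm s c y x := by
  unfold quadForm
  rw [Finset.sum_comm]
  refine Finset.sum_congr rfl fun i hi => Finset.sum_congr rfl fun j hj => ?_
  rw [h.symm j hj i hi]; ring

lemma IsPSDOn.expand (h : IsPSDOn s c) (x y : ℕ → ℝ) (a : ℝ) :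
    quadForm s c (fun i => x i + a * y i) (fun i => x i + a * y i) =
      quadForm s c x x + 2 * a * quadForm s c x y + a ^ 2 * quadForm s c y y := by
  have : quadForm s c (fun i => x i + a * y i) (fun i => x i + a * y i) =
      quadForm s c x x + a * quadForm s c x y + a * quadForm s c y x + a ^ 2 * quadForm s c y y := by
    unfold quadForm
    simp only [Finset.mul_sum, ← Finset.sum_add_distrib]
    exact Finset.sum_congr rfl fun i _ => Finset.sum_congr rfl fun j _ => by ring
  rw [this, h.comm y x]; ring

lemma quadForm_single_right (x : ℕ → ℝ) {i : ℕ} (hi : i ∈ s) :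
    quadForm s c x (Pi.single i 1) = ∑ j ∈ s, x j * c j i := by
  unfold quadForm
  refine Finset.sum_congr rfl fun j _ => ?_
  rw [Finset.sum_eq_single_of_mem i hi fun k _ hk => by simp [Pi.single_eq_of_ne hk]]
  simp

lemma quadForm_single_single {i j : ℕ} (hi : i ∈ s) (hj : j ∈ s) :
    quadForm s c (Pi.single i 1) (Pi.single j 1) = c i j := by
  rw [quadForm_single_right _ hj,
    Finset.sum_eq_single_of_mem i hi fun k _ hk => by simp [Pi.single_eq_of_ne hk]]
  simp

/-- Testing on e_i ± e_j gives 2 |c_ij| ≤ c_ii + c_jj. -/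
lemma IsPSDOn.abs_le (h : IsPSDOn s c) {K : ℝ} (hK : ∀ i ∈ s, c i i ≤ K) {i j : ℕ} (hi : i ∈ s)
    (hj : j ∈ s) : |c i j| ≤ K := by
  have key : ∀ a : ℝ, 0 ≤ c i i + 2 * a * c i j + a ^ 2 * c j j := by
    intro a
    have := h.nonneg (fun k => Pi.single (M := fun _ => ℝ) i 1 k + a * Pi.single (M := fun _ => ℝ) j 1 k)
    rwa [h.expand, quadForm_single_single hi hi, quadForm_single_single hi hj,
      quadForm_single_single hj hj] at this
  rw [_root_.abs_le]
  constructor <;> linarith [key 1, key (-1), hK i hi, hK j hj]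

/-- Bessel's inequality. -/
lemma IsPSDOn.sum_sq_le (h : IsPSDOn s c) {K : ℝ}
    (hK : ∀ x, quadForm s c x x ≤ K * ∑ i ∈ s, x i ^ 2) {i : ℕ} (hi : i ∈ s) :
    ∑ j ∈ s, c i j ^ 2 ≤ K * c i i := by
  have e1 : quadForm s c (c i) (Pi.single i 1) = ∑ j ∈ s, c i j ^ 2 := by
    rw [quadForm_single_right _ hi]
    exact Finset.sum_congr rfl fun j hj => by rw [h.symm j hj i hi]; ring
  -- With Σ = ∑_j c_ij², positivity at c_i - K e_i reads Q(c_i) - 2KΣ + K² c_ii ≥ 0; combined with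
  -- Q(c_i) ≤ KΣ it gives K (Σ - K c_ii) ≤ 0.
  have h1 := h.nonneg (fun k => c i k + (-K) * Pi.single (M := fun _ => ℝ) i 1 k)
  rw [h.expand, e1, quadForm_single_single hi hi] at h1
  have h2 := hK (c i)
  have hcii : 0 ≤ c i i := by
    have := h.nonneg (Pi.single i 1)
    rwa [quadForm_single_single hi hi] at this
  have h3 : K * (∑ j ∈ s, c i j ^ 2 - K * c i i) ≤ 0 := by nlinarith
  have hcK : c i i ≤ K := by
    have := hK (Pi.single i 1)
    rw [quadForm_single_single hi hi, Finset.sum_eq_single_of_mem i hi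
      fun k _ hk => by simp [Pi.single_eq_of_ne hk]] at this
    simpa using this
  -- When K = 0 the previous inequality is empty; testing on e_i - c_i forces Σ ≤ 0 instead.
  rcases (hcii.trans hcK).eq_or_lt with hK0 | hK0
  · subst hK0
    have hz : c i i = 0 := le_antisymm hcK hcii
    have h4 := h.nonneg (fun k => Pi.single (M := fun _ => ℝ) i 1 k + (-1) * c i k)
    rw [h.expand, h.comm (Pi.single i 1) (c i), e1, quadForm_single_single hi hi, hz] at h4
    have h5 := hK (c i)
    linarith
  · nlinarith [nonpos_of_mul_nonpos_right h3 hK0]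

/-- Schur's test. -/
lemma quadForm_le_of_row_sum_le (hsymm : ∀ i ∈ s, ∀ j ∈ s, c i j = c j i) {K : ℝ}
    (hK : ∀ i ∈ s, ∑ j ∈ s, |c i j| ≤ K) (x : ℕ → ℝ) :
    quadForm s c x x ≤ K * ∑ i ∈ s, x i ^ 2 := by
  have h1 : quadForm s c x x ≤
      ∑ i ∈ s, ∑ j ∈ s, (x i ^ 2 * |c i j| / 2 + x j ^ 2 * |c i j| / 2) := by
    refine Finset.sum_le_sum fun i _ => Finset.sum_le_sum fun j _ => ?_
    have h2 : x i * x j * c i j ≤ |x i| * |x j| * |c i j| := by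
      rw [← abs_mul, ← abs_mul]; exact le_abs_self _
    refine h2.trans ?_
    have h3 : 0 ≤ (|x i| - |x j|) ^ 2 * |c i j| := by positivity
    rw [sub_sq, sq_abs, sq_abs] at h3
    linarith
  refine h1.trans ?_
  simp only [Finset.sum_add_distrib]
  have h2 : ∑ i ∈ s, ∑ j ∈ s, x j ^ 2 * |c i j| / 2 = ∑ i ∈ s, ∑ j ∈ s, x i ^ 2 * |c i j| / 2 := by
    rw [Finset.sum_comm]
    refine Finset.sum_congr rfl fun i hi => Finset.sum_congr rfl fun j hj => ?_
    rw [hsymm j hj i hi]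
  rw [h2, ← Finset.sum_add_distrib, Finset.mul_sum]
  refine Finset.sum_le_sum fun i hi => ?_
  have h3 := mul_le_mul_of_nonneg_left (hK i hi) (sq_nonneg (x i))
  rw [Finset.mul_sum] at h3
  rw [← Finset.sum_add_distrib]
  refine le_trans (le_of_eq ?_) (h3.trans_eq (mul_comm _ _))
  exact Finset.sum_congr rfl fun j _ => by ring

/-- A quadratic form is controlled by its two diagonal blocks. -/
lemma IsPSDOn.quadForm_le_of_blocks {p : ℕ → Prop} [DecidablePred p] (h : IsPSDOn s c) {K : ℝ}
    (h1 : ∀ i ∈ s, p i → ∑ j ∈ s with p j, |c i j| ≤ K)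
    (h2 : ∀ i ∈ s, ¬ p i → ∑ j ∈ s with ¬ p j, |c i j| ≤ K) (x : ℕ → ℝ) :
    quadForm s c x x ≤ 2 * K * ∑ i ∈ s, x i ^ 2 := by
  set y : ℕ → ℝ := fun i => if p i then x i else 0 with hy
  set z : ℕ → ℝ := fun i => if ¬ p i then x i else 0 with hz
  have hyz : x = fun i => y i + 1 * z i := by
    funext i; simp only [hy, hz]; split_ifs <;> simp
  have e1 := h.expand y z 1
  have e2 := h.expand y z (-1)
  have e3 := h.nonneg (fun i => y i + -1 * z i)
  rw [← hyz] at e1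
  have cut : ∀ (q : ℕ → Prop) [DecidablePred q],
      (∀ i ∈ s, q i → ∑ j ∈ s with q j, |c i j| ≤ K) →
      quadForm s c (fun i => if q i then x i else 0) (fun i => if q i then x i else 0) ≤
        K * ∑ i ∈ s with q i, x i ^ 2 := by
    intro q _ hq
    have e : quadForm s c (fun i => if q i then x i else 0) (fun i => if q i then x i else 0) =
        quadForm (s.filter q) c x x := by
      unfold quadForm
      rw [Finset.sum_filter]
      refine Finset.sum_congr rfl fun i _ => ?_
      split_ifs with hi
      · rw [Finset.sum_filter]
        refine Finset.sum_congr rfl fun j _ => ?_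
        by_cases hj : q j <;> simp [hi, hj]
      · simp [hi]
    rw [e]
    refine quadForm_le_of_row_sum_le (fun i hi j hj => ?_) (fun i hi => ?_) x
    · exact h.symm i (Finset.mem_filter.1 hi).1 j (Finset.mem_filter.1 hj).1
    · exact hq i (Finset.mem_filter.1 hi).1 (Finset.mem_filter.1 hi).2
  have c1 := cut p h1
  have c2 := cut (fun i => ¬ p i) h2
  have e4 := Finset.sum_filter_add_sum_filter_not s p (fun i => x i ^ 2)
  rw [← e4]
  -- Parallelogram identity Q(y+z) + Q(y-z) = 2Q(y) + 2Q(z), with Q(y-z) ≥ 0 discarded.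
  have : quadForm s c x x ≤ 2 * quadForm s c y y + 2 * quadForm s c z z := by linarith
  refine this.trans ?_
  have c1' : quadForm s c y y ≤ K * ∑ i ∈ s with p i, x i ^ 2 := c1
  have c2' : quadForm s c z z ≤ K * ∑ i ∈ s with ¬ p i, x i ^ 2 := c2
  linarith

end PSD

/-! ### Operator norm and square sums of decaying arrays -/

section Array

/-- Arrays of normalized covariances whose entries decay away from the diagonal, except possibly
near the corner opposite to it. -/
structure IsDecayingArray (c : ℕ → ℕ → ℕ → ℝ) : Prop where
  psd : ∀ᶠ N in atTop, IsPSDOn (Finset.Ico 1 N) (c N)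
  diag : ∃ K, ∀ᶠ N in atTop, ∀ i ∈ Finset.Ico 1 N, c N i i ≤ K
  decay : ∀ ε : ℝ, 0 < ε → ∃ K > 0, ∀ᶠ N : ℕ in atTop, ∀ j l : ℕ, 1 ≤ j → 3 ≤ l → j + l < N →
    (l : ℝ) + 2 ≤ (1 - ε) * N → |c N (j + l) j| ≤ K / ((l : ℝ) - 2) ^ 2

/-- The decay profile of the entries of an array. -/
def decayProfile (K₀ K : ℝ) (z : ℤ) : ℝ :=
  if z.natAbs ≤ 2 then K₀ else K / ((z.natAbs : ℝ) - 2) ^ 2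

lemma decayProfile_nonneg {K₀ K : ℝ} (h₀ : 0 ≤ K₀) (h : 0 ≤ K) (z : ℤ) :
    0 ≤ decayProfile K₀ K z := by
  unfold decayProfile; split_ifs <;> positivity

lemma summable_decayProfile (K₀ K : ℝ) : Summable (decayProfile K₀ K) := by
  have h1 : Summable fun n : ℕ => decayProfile K₀ K n := by
    rw [← summable_nat_add_iff 3]
    have : Summable fun n : ℕ => K * (1 / ((n + 1 : ℕ) : ℝ) ^ 2) :=
      ((summable_nat_add_iff 1).2 (Real.summable_one_div_nat_pow.2 one_lt_two)).mul_left K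
    refine this.congr fun n => ?_
    unfold decayProfile
    rw [if_neg (by omega)]
    simp only [Int.natAbs_natCast]
    push_cast
    rw [show (n : ℝ) + 3 - 2 = n + 1 by ring]
    ring
  refine Summable.of_nat_of_neg h1 (h1.congr fun n => ?_)
  unfold decayProfile; simp

lemma summable_decayProfile_sq {K₀ K : ℝ} (h₀ : 0 ≤ K₀) (h : 0 ≤ K) :
    Summable fun z => decayProfile K₀ K z ^ 2 := by
  have h1 := summable_decayProfile K₀ K
  refine Summable.of_nonneg_of_le (fun z => sq_nonneg _) (fun z => ?_)
    (h1.mul_left (max K₀ K))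
  have h2 := decayProfile_nonneg h₀ h z
  rw [sq]
  refine mul_le_mul_of_nonneg_right ?_ h2
  unfold decayProfile
  split_ifs with hz
  · exact le_max_left _ _
  · refine le_trans ?_ (le_max_right _ _)
    have : (3 : ℝ) ≤ z.natAbs := by exact_mod_cast (by omega : 3 ≤ z.natAbs)
    refine div_le_self h ?_
    nlinarith

lemma sum_int_sub_le_tsum {u : ℤ → ℝ} (hu : Summable u) (h0 : ∀ z, 0 ≤ u z) (s : Finset ℕ) (i : ℕ) :
    ∑ j ∈ s, u ((i : ℤ) - j) ≤ ∑' z, u z := by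
  have inj : Set.InjOn (fun j : ℕ => (i : ℤ) - j) s := by
    intro a _ b _ hab
    simp only at hab
    omega
  rw [← Finset.sum_image (f := u) inj]
  exact hu.sum_le_tsum _ fun z _ => h0 z

variable {c : ℕ → ℕ → ℕ → ℝ}

lemma IsDecayingArray.exists_abs_le (H : IsDecayingArray c) :
    ∃ K > 0, ∀ᶠ N in atTop, ∀ i ∈ Finset.Ico 1 N, ∀ j ∈ Finset.Ico 1 N, |c N i j| ≤ K := by
  obtain ⟨K, hK⟩ := H.diag
  refine ⟨max K 1, by positivity, ?_⟩
  filter_upwards [hK, H.psd] with N h1 h2 i hi j hj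
  exact (h2.abs_le h1 hi hj).trans (le_max_left _ _)

lemma IsDecayingArray.exists_abs_le_decayProfile (H : IsDecayingArray c) {ε : ℝ} (hε : 0 < ε) :
    ∃ K₀ > 0, ∃ K > 0, ∀ᶠ N : ℕ in atTop, ∀ i ∈ Finset.Ico 1 N, ∀ j ∈ Finset.Ico 1 N,
      ((((i : ℤ) - j).natAbs : ℕ) : ℝ) + 2 ≤ (1 - ε) * N →
        |c N i j| ≤ decayProfile K₀ K ((i : ℤ) - j) := by
  obtain ⟨K₀, hK₀, h0⟩ := H.exists_abs_le
  obtain ⟨K, hK, h1⟩ := H.decay ε hε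
  refine ⟨K₀, hK₀, K, hK, ?_⟩
  filter_upwards [h0, h1, H.psd] with N h0 h1 h2 i hi j hj hij
  unfold decayProfile
  split_ifs with hz
  · exact h0 i hi j hj
  · have hi' := Finset.mem_Ico.1 hi
    have hj' := Finset.mem_Ico.1 hj
    rcases le_total i j with hle | hle
    · obtain ⟨l, rfl⟩ := Nat.exists_eq_add_of_le hle
      have e : ((i : ℤ) - (i + l : ℕ)).natAbs = l := by omega
      rw [e] at hz hij ⊢
      rw [h2.symm i hi _ hj]
      exact h1 i l hi'.1 (by omega) hj'.2 hij
    · obtain ⟨l, rfl⟩ := Nat.exists_eq_add_of_le hle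
      have e : (((j + l : ℕ) : ℤ) - j).natAbs = l := by omega
      rw [e] at hz hij ⊢
      exact h1 j l hj'.1 (by omega) hi'.2 hij

/-- Schur's test cannot be applied to full rows, since nothing summable bounds the entries with |i -
j| close to N. Cutting the indices at N/2 leaves two blocks in which |i - j| ≤ N/2, and positivity
absorbs the off-diagonal blocks. With ε = 1/4 the decay condition is N/2 + 2 ≤ 3N/4, true for large
N. -/
lemma IsDecayingArray.exists_quadForm_le (H : IsDecayingArray c) : ∃ K > 0, ∀ᶠ N in atTop,
    ∀ x, quadForm (Finset.Ico 1 N) (c N) x x ≤ K * ∑ i ∈ Finset.Ico 1 N, x i ^ 2 := by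
  obtain ⟨K₀, hK₀, K, hK, h⟩ := H.exists_abs_le_decayProfile (ε := 1 / 4) (by norm_num)
  have hs := summable_decayProfile K₀ K
  have hn := decayProfile_nonneg hK₀.le hK.le
  set W := ∑' z, decayProfile K₀ K z with hW
  have hW0 : 0 ≤ W := tsum_nonneg hn
  refine ⟨2 * W + 1, by positivity, ?_⟩
  filter_upwards [h, H.psd, eventually_ge_atTop 12] with N h1 h2 h3 x
  have hN : (12 : ℝ) ≤ N := by exact_mod_cast h3
  have row : ∀ (q : ℕ → Prop) [DecidablePred q] (i : ℕ), i ∈ Finset.Ico 1 N →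
      (∀ j ∈ Finset.Ico 1 N, q j → 2 * ((i : ℤ) - j).natAbs ≤ N) →
      ∑ j ∈ Finset.Ico 1 N with q j, |c N i j| ≤ W := by
    intro q _ i hi hq
    refine le_trans (Finset.sum_le_sum fun j hj => ?_)
      (sum_int_sub_le_tsum hs hn ((Finset.Ico 1 N).filter q) i)
    have hj' := Finset.mem_filter.1 hj
    refine h1 i hi j hj'.1 ?_
    have : (2 : ℝ) * ((((i : ℤ) - j).natAbs : ℕ) : ℝ) ≤ N := by exact_mod_cast hq j hj'.1 hj'.2
    linarith
  refine (h2.quadForm_le_of_blocks (p := fun i => 2 * i ≤ N) (K := W) ?_ ?_ x).trans ?_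
  · intro i hi hpi
    refine row _ i hi fun j hj hqj => ?_
    omega
  · intro i hi hpi
    refine row _ i hi fun j hj hqj => ?_
    have := Finset.mem_Ico.1 hi
    have := Finset.mem_Ico.1 hj
    omega
  · exact mul_le_mul_of_nonneg_right (by linarith) (Finset.sum_nonneg fun i _ => sq_nonneg _)

/-- Bessel's inequality bounds the whole row, including the entries near the corner where no decay
is known. -/
lemma IsDecayingArray.exists_sum_sq_le (H : IsDecayingArray c) : ∃ K > 0, ∀ᶠ N in atTop,
    ∀ i ∈ Finset.Ico 1 N, ∑ j ∈ Finset.Ico 1 N, c N i j ^ 2 ≤ K := by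
  obtain ⟨K₀, hK₀, h0⟩ := H.exists_abs_le
  obtain ⟨K, hK, h⟩ := H.exists_quadForm_le
  refine ⟨K * K₀, by positivity, ?_⟩
  filter_upwards [h0, h, H.psd] with N h0 h1 h2 i hi
  exact (h2.sum_sq_le h1 hi).trans
    (mul_le_mul_of_nonneg_left ((le_abs_self _).trans (h0 i hi i hi)) hK.le)

/-- The entries far from the diagonal are negligible in mean square. -/
lemma IsDecayingArray.exists_sum_sq_tail_le (H : IsDecayingArray c) {δ : ℝ} (hδ : 0 < δ) :
    ∃ M : ℕ, ∀ᶠ N : ℕ in atTop, ∑ i ∈ Finset.Ico 1 N,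
      ∑ j ∈ (Finset.Ico 1 N).filter (fun j : ℕ => M < ((i : ℤ) - j).natAbs), c N i j ^ 2 ≤ δ * N := by
  obtain ⟨B, hB, hrow⟩ := H.exists_sum_sq_le
  -- Rows and columns reaching the corner will cost 2B(εN + 3) = δN/4 + 6B; the other entries cost
  -- δN/2, and 6B ≤ δN/4 for large N.
  set ε := δ / (8 * B) with hε
  have hε0 : 0 < ε := by positivity
  obtain ⟨K₀, hK₀, K, hK, hdec⟩ := H.exists_abs_le_decayProfile hε0
  have hn := decayProfile_nonneg hK₀.le hK.le
  obtain ⟨S, hS⟩ := summable_iff_vanishing_norm.1 (summable_decayProfile_sq hK₀.le hK.le) (δ / 2)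
    (by positivity)
  obtain ⟨M, hM⟩ : ∃ M : ℕ, ∀ z ∈ S, z.natAbs ≤ M :=
    ⟨S.sup Int.natAbs, fun z hz => Finset.le_sup (f := Int.natAbs) hz⟩
  refine ⟨M, ?_⟩
  have hlarge : ∀ᶠ N : ℕ in atTop, 6 * B ≤ δ / 4 * N := by
    have : Tendsto (fun N : ℕ => δ / 4 * (N : ℝ)) atTop atTop :=
      tendsto_natCast_atTop_atTop.const_mul_atTop (by positivity)
    exact this.eventually_ge_atTop _
  filter_upwards [hrow, hdec, hlarge, H.psd] with N h1 h2 h3 h4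
  set s := Finset.Ico 1 N with hs
  -- Since |i - j| ≤ max(i, j), a pair violating the decay condition has at least one far index, and
  -- there are at most εN + 3 of those.
  set far : ℕ → Prop := fun i => (1 - ε) * N < (i : ℝ) + 2 with hfar
  classical
  have hcard : (((s.filter far).card : ℕ) : ℝ) ≤ ε * N + 3 := by
    have hsub : s.filter far ⊆ Finset.Ico (⌊(1 - ε) * N⌋₊ - 2) N := by
      intro i hi
      have hi' := Finset.mem_filter.1 hi
      refine Finset.mem_Ico.2 ⟨?_, (Finset.mem_Ico.1 hi'.1).2⟩
      have : ⌊(1 - ε) * N⌋₊ ≤ i + 2 := Nat.floor_le_of_le (by push_cast; exact hi'.2.le)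
      omega
    have h5 := Finset.card_le_card hsub
    rw [Nat.card_Ico] at h5
    have h6 : N ≤ (N - (⌊(1 - ε) * N⌋₊ - 2)) + (⌊(1 - ε) * N⌋₊ - 2) ∨ N < ⌊(1 - ε) * N⌋₊ - 2 := by omega
    have h7 : (1 - ε) * N < ⌊(1 - ε) * N⌋₊ + 1 := Nat.lt_floor_add_one _
    have h8 : (s.filter far).card + ⌊(1 - ε) * N⌋₊ ≤ N + 2 := by
      have : ⌊(1 - ε) * N⌋₊ ≤ N := by
        refine Nat.floor_le_of_le ?_
        nlinarith [(Nat.cast_nonneg N : (0 : ℝ) ≤ N)]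
      omega
    have h9 : ((s.filter far).card : ℝ) + (⌊(1 - ε) * N⌋₊ : ℝ) ≤ N + 2 := by exact_mod_cast h8
    linarith
  have hfarsum : ∑ i ∈ s.filter far, ∑ j ∈ s, c N i j ^ 2 ≤ B * (ε * N + 3) := by
    refine (Finset.sum_le_sum fun i hi => h1 i (Finset.mem_filter.1 hi).1).trans ?_
    rw [Finset.sum_const, nsmul_eq_mul, mul_comm]
    exact mul_le_mul_of_nonneg_left hcard hB.le
  have hpt : ∀ i ∈ s, ∀ j ∈ s, (if M < ((i : ℤ) - j).natAbs then c N i j ^ 2 else 0) ≤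
      (if M < ((i : ℤ) - j).natAbs then decayProfile K₀ K ((i : ℤ) - j) ^ 2 else 0) +
        ((if far i then c N i j ^ 2 else 0) + (if far j then c N i j ^ 2 else 0)) := by
    intro i hi j hj
    have hc := sq_nonneg (c N i j)
    have hd := sq_nonneg (decayProfile K₀ K ((i : ℤ) - j))
    by_cases hi' : far i
    · rw [if_pos hi']; split_ifs <;> linarith
    by_cases hj' : far j
    · rw [if_pos hj']; split_ifs <;> linarith
    have hle : |c N i j| ≤ decayProfile K₀ K ((i : ℤ) - j) := by
      refine h2 i hi j hj ?_
      simp only [hfar, not_lt] at hi' hj'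
      have hi1 := (Finset.mem_Ico.1 hi).1
      have hj1 := (Finset.mem_Ico.1 hj).1
      have : ((i : ℤ) - j).natAbs ≤ max i j := by omega
      have h5 : ((((i : ℤ) - j).natAbs : ℕ) : ℝ) ≤ max (i : ℝ) j := by exact_mod_cast this
      rcases le_max_iff.1 h5 with h5 | h5 <;> linarith
    have hsq := sq_le_sq' (by linarith [abs_nonneg (c N i j)]) hle
    rw [sq_abs] at hsq
    rw [if_neg hi', if_neg hj']
    split_ifs <;> linarith
  have hbulk : ∀ i ∈ s, ∑ j ∈ s, (if M < ((i : ℤ) - j).natAbs then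
      decayProfile K₀ K ((i : ℤ) - j) ^ 2 else 0) ≤ δ / 2 := by
    intro i _
    rw [← Finset.sum_filter]
    have inj : Set.InjOn (fun j : ℕ => (i : ℤ) - j) (s.filter fun j : ℕ => M < ((i : ℤ) - j).natAbs : Finset ℕ) := by
      intro a _ b _ hab
      simp only at hab
      omega
    rw [← Finset.sum_image (f := fun z => decayProfile K₀ K z ^ 2) inj]
    have := hS ((s.filter fun j : ℕ => M < ((i : ℤ) - j).natAbs).image fun j : ℕ => (i : ℤ) - j) (by
      rw [Finset.disjoint_left]
      intro z hz hzS
      obtain ⟨j, hj, rfl⟩ := Finset.mem_image.1 hz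
      have := (Finset.mem_filter.1 hj).2
      have := hM _ hzS
      omega)
    exact (le_abs_self _).trans this.le
  calc ∑ i ∈ s, ∑ j ∈ s.filter (fun j : ℕ => M < ((i : ℤ) - j).natAbs), c N i j ^ 2
      ≤ ∑ i ∈ s, ∑ j ∈ s, ((if M < ((i : ℤ) - j).natAbs then
          decayProfile K₀ K ((i : ℤ) - j) ^ 2 else 0) +
          ((if far i then c N i j ^ 2 else 0) + (if far j then c N i j ^ 2 else 0))) := by
        refine Finset.sum_le_sum fun i hi => ?_
        rw [Finset.sum_filter]
        exact Finset.sum_le_sum fun j hj => hpt i hi j hj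
    _ = ∑ i ∈ s, ∑ j ∈ s, (if M < ((i : ℤ) - j).natAbs then
          decayProfile K₀ K ((i : ℤ) - j) ^ 2 else 0) + 2 * ∑ i ∈ s.filter far, ∑ j ∈ s, c N i j ^ 2 := by
        simp only [Finset.sum_add_distrib]
        have e1 : ∑ i ∈ s, ∑ j ∈ s, (if far i then c N i j ^ 2 else 0) =
            ∑ i ∈ s.filter far, ∑ j ∈ s, c N i j ^ 2 := by
          rw [Finset.sum_filter]
          refine Finset.sum_congr rfl fun i _ => ?_
          split_ifs <;> simp
        have e2 : ∑ i ∈ s, ∑ j ∈ s, (if far j then c N i j ^ 2 else 0) =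
            ∑ i ∈ s.filter far, ∑ j ∈ s, c N i j ^ 2 := by
          rw [← e1, Finset.sum_comm]
          refine Finset.sum_congr rfl fun i hi => Finset.sum_congr rfl fun j hj => ?_
          rw [h4.symm j hj i hi]
        rw [e1, e2]; ring
    _ ≤ ∑ i ∈ s, δ / 2 + 2 * (B * (ε * N + 3)) := by
        gcongr with i hi
        exact hbulk i hi
    _ ≤ δ / 2 * N + 2 * (B * (ε * N + 3)) := by
        have h5 : (s.card : ℝ) ≤ N := by
          rw [hs, Nat.card_Ico]; exact_mod_cast Nat.sub_le _ _
        rw [Finset.sum_const, nsmul_eq_mul, mul_comm]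
        gcongr
    _ ≤ δ * N := by
        have h6 : B * ε = δ / 8 := by rw [hε]; field_simp
        have h7 : 2 * (B * (ε * N + 3)) = 2 * (B * ε) * N + 6 * B := by ring
        rw [h7, h6]
        linarith

end Array

/-! ### Riemann sums as integrals of step functions -/

section Riemann

lemma integral_floor_piece (F : ℕ → ℝ) {n : ℕ} (hn : 0 < n) (k : ℕ) :
    IntervalIntegrable (fun t : ℝ => F ⌊(n : ℝ) * t⌋₊) volume ((k : ℝ) / n) (((k + 1 : ℕ) : ℝ) / n) ∧
      ∫ t in ((k : ℝ) / n)..(((k + 1 : ℕ) : ℝ) / n), F ⌊(n : ℝ) * t⌋₊ = 1 / n * F k := by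
  have hn' : (0 : ℝ) < n := by exact_mod_cast hn
  have hle : (k : ℝ) / n ≤ ((k + 1 : ℕ) : ℝ) / n := by
    gcongr; exact Nat.le_succ k
  have hfl : ∀ t ∈ Ioo ((k : ℝ) / n) (((k + 1 : ℕ) : ℝ) / n), F k = F ⌊(n : ℝ) * t⌋₊ := by
    intro t ht
    have h1 := (div_lt_iff₀ hn').1 ht.1
    have h2 := (lt_div_iff₀ hn').1 ht.2
    push_cast at h2
    have : ⌊(n : ℝ) * t⌋₊ = k := by
      rw [Nat.floor_eq_iff (by nlinarith [(Nat.cast_nonneg k : (0 : ℝ) ≤ k)])]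
      constructor <;> nlinarith
    rw [this]
  constructor
  · rw [intervalIntegrable_iff_integrableOn_Ioo_of_le hle]
    exact (integrableOn_const (C := F k) (by simp)).congr_fun hfl measurableSet_Ioo
  · rw [intervalIntegral.integral_of_le hle, integral_Ioc_eq_integral_Ioo,
      ← setIntegral_congr_fun measurableSet_Ioo hfl, setIntegral_const]
    simp only [Real.volume_real_Ioo_of_le hle, smul_eq_mul]
    push_cast
    field_simp
    ring

/-- On each cell [k/n, (k+1)/n[ the floor is constant, so the sum is exactly an integral. Limits of
such sums then need only pointwise convergence and a bound. -/
lemma sum_eq_integral_floor (F : ℕ → ℝ) {n : ℕ} (hn : 0 < n) :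
    1 / (n : ℝ) * ∑ k ∈ Finset.range n, F k = ∫ t, F ⌊(n : ℝ) * t⌋₊ ∂unitMeasure := by
  have hn' : (0 : ℝ) < n := by exact_mod_cast hn
  have := intervalIntegral.sum_integral_adjacent_intervals (f := fun t : ℝ => F ⌊(n : ℝ) * t⌋₊)
    (a := fun k : ℕ => (k : ℝ) / n) (n := n) (μ := volume)
    fun k _ => (integral_floor_piece F hn k).1
  simp only [Nat.cast_zero, zero_div] at this
  rw [div_self hn'.ne'] at this
  rw [← intervalIntegral_eq_unitMeasure, ← this, Finset.mul_sum]
  exact Finset.sum_congr rfl fun k _ => (integral_floor_piece F hn k).2.symm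

lemma sum_Ico_eq_integral_floor (F : ℕ → ℝ) {n : ℕ} (hn : 0 < n) :
    1 / (n : ℝ) * ∑ k ∈ Finset.Ico 1 n, F k =
      ∫ t, (if 1 ≤ ⌊(n : ℝ) * t⌋₊ then F ⌊(n : ℝ) * t⌋₊ else 0) ∂unitMeasure := by
  rw [← sum_eq_integral_floor (fun k => if 1 ≤ k then F k else 0) hn]
  congr 1
  rw [Finset.range_eq_Ico, ← Finset.sum_filter]
  refine Finset.sum_congr ?_ fun _ _ => rfl
  ext k
  simp only [Finset.mem_Ico, Finset.mem_filter]
  omega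

lemma tendsto_floor_mul {t : ℝ} (ht : 0 < t) :
    Tendsto (fun n : ℕ => ⌊(n : ℝ) * t⌋₊) atTop atTop :=
  tendsto_nat_floor_atTop.comp (tendsto_natCast_atTop_atTop.atTop_mul_const ht)

lemma tendsto_floor_mul_div {t : ℝ} (ht : 0 ≤ t) :
    Tendsto (fun n : ℕ => ((⌊(n : ℝ) * t⌋₊ : ℕ) : ℝ) / n) atTop (𝓝 t) := by
  have := (tendsto_nat_floor_mul_div_atTop ht).comp (tendsto_natCast_atTop_atTop (R := ℝ))
  refine this.congr fun n => ?_
  simp [Function.comp, mul_comm]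

/-- Convergence of Riemann sums by dominated convergence. -/
lemma tendsto_sum_Ico {F : ℕ → ℕ → ℝ} {f : ℝ → ℝ} {K : ℝ}
    (hK : ∀ᶠ n in atTop, ∀ k ∈ Finset.Ico 1 n, |F n k| ≤ K)
    (hlim : ∀ t ∈ Ioo (0 : ℝ) 1, Tendsto (fun n : ℕ => F n ⌊(n : ℝ) * t⌋₊) atTop (𝓝 (f t))) :
    Tendsto (fun n : ℕ => 1 / (n : ℝ) * ∑ k ∈ Finset.Ico 1 n, F n k) atTop
      (𝓝 (∫ t in (0 : ℝ)..1, f t)) := by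
  rw [intervalIntegral_eq_unitMeasure]
  have key : Tendsto (fun n : ℕ => ∫ t, (if 1 ≤ ⌊(n : ℝ) * t⌋₊ then F n ⌊(n : ℝ) * t⌋₊ else 0)
      ∂unitMeasure) atTop (𝓝 (∫ t, f t ∂unitMeasure)) := by
    refine tendsto_integral_filter_of_dominated_convergence (fun _ => |K|)
      (Filter.Eventually.of_forall fun n => ?_) ?_ (integrable_const _) ?_
    · refine Measurable.aestronglyMeasurable ?_
      exact (measurable_from_nat (f := fun k => if 1 ≤ k then F n k else 0)).comp
        (Nat.measurable_floor.comp (by fun_prop))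
    · filter_upwards [hK] with n hn
      filter_upwards [ae_unitMeasure] with t ht
      split_ifs with h1
      · refine (hn _ (Finset.mem_Ico.2 ⟨h1, ?_⟩)).trans (le_abs_self K)
        by_contra hcon
        rw [not_lt] at hcon
        have h2 := Nat.floor_le (a := (n : ℝ) * t) (mul_nonneg (Nat.cast_nonneg n) ht.1.le)
        have h3 : (n : ℝ) ≤ (⌊(n : ℝ) * t⌋₊ : ℝ) := by exact_mod_cast hcon
        rcases (Nat.cast_nonneg n : (0 : ℝ) ≤ n).eq_or_lt with h0 | h0
        · rw [← h0] at h1; simp at h1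
        · nlinarith [ht.2]
      · simp
    · filter_upwards [ae_unitMeasure] with t ht
      refine (hlim t ht).congr' ?_
      filter_upwards [(tendsto_floor_mul ht.1).eventually_ge_atTop 1] with n hn
      rw [if_pos hn]
  refine key.congr' ?_
  filter_upwards [eventually_gt_atTop 0] with n hn
  exact (sum_Ico_eq_integral_floor (F n) hn).symm

end Riemann

/-! ### Convergence of normalized sums of squares -/

section ArrayLimit

/-- Extension by zero of an array to integer indices. -/
def extArray (c : ℕ → ℕ → ℕ → ℝ) (N : ℕ) (i j : ℤ) : ℝ :=
  if (1 ≤ i ∧ i < N) ∧ (1 ≤ j ∧ j < N) then c N i.toNat j.toNat else 0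

/-- The entries of an array converge along the diagonals. -/
def HasDiagonalLimit (c : ℕ → ℕ → ℕ → ℝ) (r : ℝ → ℕ → ℝ) : Prop :=
  ∀ t ∈ Ioo (0 : ℝ) 1, ∀ (l : ℕ) (N k : ℕ → ℕ), Tendsto N atTop atTop →
    Tendsto (fun n => (k n : ℝ) / N n) atTop (𝓝 t) →
      Tendsto (fun n => c (N n) (k n + l) (k n)) atTop (𝓝 (r t l))

variable {c : ℕ → ℕ → ℕ → ℝ} {r : ℝ → ℕ → ℝ}

lemma eventually_floor_mem {t : ℝ} (ht : t ∈ Ioo (0 : ℝ) 1) {m : ℕ} (hm : 0 < m) (x : ℤ) :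
    ∀ᶠ n : ℕ in atTop, 1 ≤ (m : ℤ) * ⌊(n : ℝ) * t⌋₊ + x ∧
      (m : ℤ) * ⌊(n : ℝ) * t⌋₊ + x < ((m * n : ℕ) : ℤ) := by
  have h1 : Tendsto (fun n : ℕ => (n : ℝ) * (1 - t)) atTop atTop :=
    tendsto_natCast_atTop_atTop.atTop_mul_const (by linarith [ht.2])
  filter_upwards [(tendsto_floor_mul ht.1).eventually_ge_atTop (x.natAbs + 1),
    h1.eventually_gt_atTop (x.natAbs : ℝ)] with n h2 h3
  have h4 := Nat.floor_le (a := (n : ℝ) * t) (mul_nonneg (Nat.cast_nonneg n) ht.1.le)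
  have h5 : (⌊(n : ℝ) * t⌋₊ : ℝ) + x.natAbs < n := by linarith
  have h6 : ⌊(n : ℝ) * t⌋₊ + x.natAbs < n := by exact_mod_cast h5
  set k := ⌊(n : ℝ) * t⌋₊
  have h7 : (x.natAbs : ℤ) + 1 ≤ k := by exact_mod_cast h2
  have h8 : (k : ℤ) + x.natAbs < n := by exact_mod_cast h6
  have h9 : (1 : ℤ) ≤ m := by exact_mod_cast hm
  have h10 : (x.natAbs : ℤ) = |x| := Int.natCast_natAbs x
  rw [h10] at h7 h8
  have := le_abs_self x
  have := neg_abs_le x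
  have := abs_nonneg x
  push_cast
  constructor <;> nlinarith

/-- The smaller of the two positions serves as base index, so that the lag is a natural number;
symmetry of the array covers l < a. -/
lemma HasDiagonalLimit.tendsto_extArray (H : HasDiagonalLimit c r) (hc : IsDecayingArray c)
    {m : ℕ} (hm : 0 < m) (l a : ℤ) {t : ℝ} (ht : t ∈ Ioo (0 : ℝ) 1) :
    Tendsto (fun n : ℕ => extArray c (m * n) (m * (⌊(n : ℝ) * t⌋₊ : ℤ) + l)
      (m * (⌊(n : ℝ) * t⌋₊ : ℤ) + a)) atTop (𝓝 (r t (l - a).natAbs)) := by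
  have hN : Tendsto (fun n : ℕ => m * n) atTop atTop :=
    tendsto_id.const_mul_atTop' hm
  set J : ℕ → ℕ := fun n => (m * (⌊(n : ℝ) * t⌋₊ : ℤ) + min l a).toNat with hJ
  have hm' : (0 : ℝ) < m := by exact_mod_cast hm
  have hJt : Tendsto (fun n => (J n : ℝ) / ((m * n : ℕ) : ℝ)) atTop (𝓝 t) := by
    have h1 : Tendsto (fun n : ℕ => ((⌊(n : ℝ) * t⌋₊ : ℕ) : ℝ) / n + ((min l a : ℤ) : ℝ) / m * (1 / n))
        atTop (𝓝 (t + ((min l a : ℤ) : ℝ) / m * 0)) :=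
      (tendsto_floor_mul_div ht.1.le).add (tendsto_one_div_atTop_nhds_zero_nat.const_mul _)
    rw [mul_zero, add_zero] at h1
    refine h1.congr' ?_
    filter_upwards [eventually_floor_mem ht hm (min l a), eventually_gt_atTop 0] with n hn hn0
    have e : (J n : ℤ) = m * (⌊(n : ℝ) * t⌋₊ : ℤ) + min l a := Int.toNat_of_nonneg (by omega)
    have e' : (J n : ℝ) = m * (⌊(n : ℝ) * t⌋₊ : ℝ) + ((min l a : ℤ) : ℝ) := by exact_mod_cast e
    have hn' : (0 : ℝ) < n := by exact_mod_cast hn0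
    rw [e']
    push_cast
    field_simp
  refine (H t ht (l - a).natAbs (fun n => m * n) J hN hJt).congr' ?_
  filter_upwards [eventually_floor_mem ht hm l, eventually_floor_mem ht hm a,
    hN.eventually hc.psd] with n h1 h2 h3
  unfold extArray
  rw [if_pos ⟨h1, h2⟩]
  rcases le_total a l with hal | hal
  · have e1 : J n = (m * (⌊(n : ℝ) * t⌋₊ : ℤ) + a).toNat := by simp only [hJ, min_eq_right hal]
    have e2 : J n + (l - a).natAbs = (m * (⌊(n : ℝ) * t⌋₊ : ℤ) + l).toNat := by rw [e1]; omega
    rw [e2, e1]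
  · have e1 : J n = (m * (⌊(n : ℝ) * t⌋₊ : ℤ) + l).toNat := by simp only [hJ, min_eq_left hal]
    have e2 : J n + (l - a).natAbs = (m * (⌊(n : ℝ) * t⌋₊ : ℤ) + a).toNat := by rw [e1]; omega
    rw [e2, e1]
    refine h3.symm _ (Finset.mem_Ico.2 ⟨?_, ?_⟩) _ (Finset.mem_Ico.2 ⟨?_, ?_⟩) <;> omega

/-- Linear combinations of three neighbouring columns of an array. -/
def combArray (c : ℕ → ℕ → ℕ → ℝ) (m : ℕ) (w : ℤ → ℝ) (n k : ℕ) (l : ℤ) : ℝ :=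
  ∑ a ∈ Finset.Icc (-1 : ℤ) 1, w a * extArray c (m * n) (m * k + l) (m * k + a)

/-- The limit of `combArray` along diagonals. -/
def combLimit (r : ℝ → ℕ → ℝ) (w : ℤ → ℝ) (t : ℝ) (l : ℤ) : ℝ :=
  ∑ a ∈ Finset.Icc (-1 : ℤ) 1, w a * r t (l - a).natAbs

lemma IsDecayingArray.exists_abs_combArray_le (hc : IsDecayingArray c) {m : ℕ} (hm : 0 < m)
    (w : ℤ → ℝ) : ∃ K, ∀ᶠ n in atTop, ∀ k l, |combArray c m w n k l| ≤ K := by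
  obtain ⟨K, hK, h⟩ := hc.exists_abs_le
  refine ⟨∑ a ∈ Finset.Icc (-1 : ℤ) 1, |w a| * K, ?_⟩
  have hN : Tendsto (fun n : ℕ => m * n) atTop atTop :=
    tendsto_id.const_mul_atTop' hm
  filter_upwards [hN.eventually h] with n hn k l
  refine (Finset.abs_sum_le_sum_abs _ _).trans (Finset.sum_le_sum fun a _ => ?_)
  rw [abs_mul]
  refine mul_le_mul_of_nonneg_left ?_ (abs_nonneg _)
  unfold extArray
  split_ifs with hcond
  · refine hn _ (Finset.mem_Ico.2 ⟨?_, ?_⟩) _ (Finset.mem_Ico.2 ⟨?_, ?_⟩) <;> omega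
  · simpa using hK.le

/-- For fixed a, the map (k, l) ↦ (mk + l, mk + a) is injective, so the left side is part of the
tail of the full array. An offset |a| ≤ 1 changes the lag by at most one, whence M + 1 on one side
and M on the other. -/
lemma sum_extArray_sq_le {m : ℕ} (hm : 0 < m) (n : ℕ) (a : ℤ) (ha : a ∈ Finset.Icc (-1 : ℤ) 1)
    (M : ℕ) (S : Finset ℤ) :
    ∑ k ∈ Finset.Ico 1 n, ∑ l ∈ S.filter (fun l => M + 1 < l.natAbs),
      extArray c (m * n) (m * k + l) (m * k + a) ^ 2 ≤
    ∑ i ∈ Finset.Ico 1 (m * n), ∑ j ∈ (Finset.Ico 1 (m * n)).filter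
      (fun j : ℕ => M < ((i : ℤ) - j).natAbs), c (m * n) i j ^ 2 := by
  have ha' := Finset.mem_Icc.1 ha
  rw [← Finset.sum_product', Finset.sum_sigma']
  set good : ℕ × ℤ → Prop := fun p => ((1 : ℤ) ≤ m * p.1 + p.2 ∧ (m : ℤ) * p.1 + p.2 < (m * n : ℕ)) ∧
    ((1 : ℤ) ≤ m * p.1 + a ∧ (m : ℤ) * p.1 + a < (m * n : ℕ)) with hgood
  classical
  set T := Finset.Ico 1 n ×ˢ S.filter (fun l => M + 1 < l.natAbs) with hT
  have e1 : ∑ p ∈ T, extArray c (m * n) (m * p.1 + p.2) (m * p.1 + a) ^ 2 =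
      ∑ p ∈ T.filter good, c (m * n) ((m : ℤ) * p.1 + p.2).toNat ((m : ℤ) * p.1 + a).toNat ^ 2 := by
    rw [Finset.sum_filter]
    refine Finset.sum_congr rfl fun p _ => ?_
    unfold extArray
    by_cases hp : good p
    · rw [if_pos hp, if_pos hp]
    · rw [if_neg hp, if_neg hp]; simp
  rw [e1]
  set f : ℕ × ℤ → (_ : ℕ) × ℕ := fun p => ⟨((m : ℤ) * p.1 + p.2).toNat, ((m : ℤ) * p.1 + a).toNat⟩ with hf
  have inj : Set.InjOn f (T.filter good : Finset (ℕ × ℤ)) := by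
    rintro ⟨k, l⟩ hp ⟨k', l'⟩ hp' hpp
    have g1 := (Finset.mem_filter.1 hp).2
    have g2 := (Finset.mem_filter.1 hp').2
    simp only [hgood] at g1 g2
    simp only [hf, Sigma.mk.injEq, heq_eq_eq] at hpp
    obtain ⟨hpp1, hpp2⟩ := hpp
    have h1 : (m : ℤ) * k + a = m * k' + a := by omega
    have h2 : (m : ℤ) * k + l = m * k' + l' := by omega
    have h3 : (m : ℤ) * k = m * k' := by omega
    have h4 : (k : ℤ) = k' := mul_left_cancel₀ (by exact_mod_cast hm.ne') h3
    have h5 : k = k' := by exact_mod_cast h4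
    have h6 : l = l' := by omega
    rw [h5, h6]
  rw [← Finset.sum_image (f := fun q : (_ : ℕ) × ℕ => c (m * n) q.1 q.2 ^ 2) inj]
  refine Finset.sum_le_sum_of_subset_of_nonneg (fun q hq => ?_) fun _ _ _ => sq_nonneg _
  obtain ⟨p, hp, rfl⟩ := Finset.mem_image.1 hq
  obtain ⟨hpT, g⟩ := Finset.mem_filter.1 hp
  have hpl := (Finset.mem_filter.1 (Finset.mem_product.1 hpT).2).2
  simp only [hgood] at g
  simp only [hf, Finset.mem_sigma, Finset.mem_Ico, Finset.mem_filter]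
  refine ⟨⟨?_, ?_⟩, ⟨?_, ?_⟩, ?_⟩ <;> omega

lemma combArray_sq_le (m : ℕ) (w : ℤ → ℝ) (n k : ℕ) (l : ℤ) : combArray c m w n k l ^ 2 ≤
    (∑ a ∈ Finset.Icc (-1 : ℤ) 1, w a ^ 2) *
      ∑ a ∈ Finset.Icc (-1 : ℤ) 1, extArray c (m * n) (m * k + l) (m * k + a) ^ 2 :=
  Finset.sum_mul_sq_le_sq_mul_sq _ _ _

lemma IsDecayingArray.exists_combArray_tail_le (hc : IsDecayingArray c) {m : ℕ} (hm : 0 < m)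
    (w : ℤ → ℝ) {δ : ℝ} (hδ : 0 < δ) : ∃ M : ℕ, ∀ᶠ n : ℕ in atTop, ∀ S : Finset ℤ,
      ∑ k ∈ Finset.Ico 1 n, ∑ l ∈ S.filter (fun l => M < l.natAbs), combArray c m w n k l ^ 2
        ≤ δ * n := by
  set B := ∑ a ∈ Finset.Icc (-1 : ℤ) 1, w a ^ 2 with hB
  have hB0 : 0 ≤ B := Finset.sum_nonneg fun _ _ => sq_nonneg _
  have hm' : (0 : ℝ) < m := by exact_mod_cast hm
  -- The denominator accounts for three columns, the Cauchy–Schwarz factor B and the level m n; B +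
  -- 1 avoids division by zero.
  obtain ⟨M, hM⟩ := hc.exists_sum_sq_tail_le (δ := δ / (3 * (B + 1) * m)) (by positivity)
  refine ⟨M + 1, ?_⟩
  have hN : Tendsto (fun n : ℕ => m * n) atTop atTop := tendsto_id.const_mul_atTop' hm
  filter_upwards [hN.eventually hM] with n hn S
  calc ∑ k ∈ Finset.Ico 1 n, ∑ l ∈ S.filter (fun l => M + 1 < l.natAbs), combArray c m w n k l ^ 2
      ≤ ∑ k ∈ Finset.Ico 1 n, ∑ l ∈ S.filter (fun l => M + 1 < l.natAbs), B *
        ∑ a ∈ Finset.Icc (-1 : ℤ) 1, extArray c (m * n) (m * k + l) (m * k + a) ^ 2 :=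
        Finset.sum_le_sum fun k _ => Finset.sum_le_sum fun l _ => combArray_sq_le m w n k l
    _ = B * ∑ a ∈ Finset.Icc (-1 : ℤ) 1, ∑ k ∈ Finset.Ico 1 n,
        ∑ l ∈ S.filter (fun l => M + 1 < l.natAbs),
          extArray c (m * n) (m * k + l) (m * k + a) ^ 2 := by
        simp only [← Finset.mul_sum]
        congr 1
        rw [Finset.sum_comm (s := Finset.Icc (-1 : ℤ) 1)]
        exact Finset.sum_congr rfl fun k _ => Finset.sum_comm
    _ ≤ B * ∑ a ∈ Finset.Icc (-1 : ℤ) 1, δ / (3 * (B + 1) * m) * ((m * n : ℕ) : ℝ) := by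
        gcongr with a ha
        exact (sum_extArray_sq_le hm n a ha M S).trans hn
    _ ≤ δ * n := by
        rw [Finset.sum_const, nsmul_eq_mul]
        have e : ((Finset.Icc (-1 : ℤ) 1).card : ℝ) = 3 := by simp
        rw [e]
        push_cast
        have : B * (3 * (δ / (3 * (B + 1) * m) * (m * n))) = B / (B + 1) * (δ * n) := by
          field_simp
        rw [this]
        refine mul_le_of_le_one_left (by positivity) ?_
        rw [div_le_one (by positivity)]; linarith

/-- Each fixed lag gives a convergent Riemann sum. The tail over large lags is small uniformly in n,
which allows the sum over lags and the limit to be exchanged. -/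
lemma HasDiagonalLimit.tendsto_sum_combArray_sq (H : HasDiagonalLimit c r) (hc : IsDecayingArray c)
    {m : ℕ} (hm : 0 < m) (w : ℤ → ℝ) {v : ℝ}
    (hv : HasSum (fun l => ∫ t in (0 : ℝ)..1, combLimit r w t l ^ 2) v)
    (S : ℕ → Finset ℤ) (hS : ∀ M : ℕ, ∀ᶠ n in atTop, Finset.Icc (-(M : ℤ)) M ⊆ S n) :
    Tendsto (fun n : ℕ => 1 / (n : ℝ) * ∑ k ∈ Finset.Ico 1 n, ∑ l ∈ S n, combArray c m w n k l ^ 2)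
      atTop (𝓝 v) := by
  obtain ⟨K, hK⟩ := hc.exists_abs_combArray_le hm w
  have hdiag : ∀ l : ℤ, Tendsto (fun n : ℕ => 1 / (n : ℝ) * ∑ k ∈ Finset.Ico 1 n,
      combArray c m w n k l ^ 2) atTop (𝓝 (∫ t in (0 : ℝ)..1, combLimit r w t l ^ 2)) := by
    intro l
    refine tendsto_sum_Ico (F := fun n k => combArray c m w n k l ^ 2) (K := K ^ 2) ?_ ?_
    · filter_upwards [hK] with n hn k _
      rw [abs_of_nonneg (sq_nonneg _)]
      exact sq_le_sq' (by linarith [neg_abs_le (combArray c m w n k l), hn k l])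
        ((le_abs_self _).trans (hn k l))
    · intro t ht
      refine Tendsto.pow ?_ 2
      refine tendsto_finsetSum _ fun a _ => Tendsto.const_mul _ ?_
      exact H.tendsto_extArray hc hm l a ht
  rw [Metric.tendsto_atTop']
  intro ε hε
  obtain ⟨M₁, hM₁⟩ := hc.exists_combArray_tail_le hm w (δ := ε / 4) (by positivity)
  obtain ⟨T, hT⟩ := (Metric.tendsto_atTop.1 hv) (ε / 4) (by positivity)
  obtain ⟨M₂, hM₂⟩ : ∃ M : ℕ, ∀ z ∈ T, z.natAbs ≤ M :=
    ⟨T.sup Int.natAbs, fun z hz => Finset.le_sup (f := Int.natAbs) hz⟩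
  set M := max M₁ M₂ with hM
  set I := Finset.Icc (-(M : ℤ)) M with hI
  have hmain : Tendsto (fun n : ℕ => 1 / (n : ℝ) * ∑ k ∈ Finset.Ico 1 n, ∑ l ∈ I,
      combArray c m w n k l ^ 2) atTop (𝓝 (∑ l ∈ I, ∫ t in (0 : ℝ)..1, combLimit r w t l ^ 2)) := by
    refine (tendsto_finsetSum I fun l _ => hdiag l).congr fun n => ?_
    rw [← Finset.mul_sum, Finset.sum_comm]
  have hTI : T ⊆ I := fun z hz => by
    have := hM₂ z hz
    rw [hI, Finset.mem_Icc]
    have : M₂ ≤ M := le_max_right _ _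
    omega
  have h1 := hT I hTI
  have h2 := (Metric.tendsto_nhds.1 hmain) (ε / 4) (by positivity)
  obtain ⟨n₀, hn₀⟩ := eventually_atTop.1
    (((h2.and hM₁).and (hS M)).and (eventually_gt_atTop 0))
  refine ⟨n₀, fun n hn => ?_⟩
  obtain ⟨⟨⟨h2, h3⟩, h4⟩, hn0⟩ := hn₀ n hn.le
  have hn' : (0 : ℝ) < n := by exact_mod_cast hn0
  have hsplit : ∀ k, ∑ l ∈ S n, combArray c m w n k l ^ 2 = ∑ l ∈ I, combArray c m w n k l ^ 2 +
      ∑ l ∈ (S n).filter (fun l => M < l.natAbs), combArray c m w n k l ^ 2 := by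
    intro k
    have : I = (S n).filter (fun l => ¬ M < l.natAbs) := by
      ext l
      simp only [Finset.mem_filter]
      constructor
      · intro hl
        have := Finset.mem_Icc.1 hl
        exact ⟨h4 hl, by omega⟩
      · intro hl
        rw [hI, Finset.mem_Icc]
        omega
    rw [this, add_comm]
    exact (Finset.sum_filter_add_sum_filter_not _ _ _).symm
  have htail : 1 / (n : ℝ) * ∑ k ∈ Finset.Ico 1 n, ∑ l ∈ (S n).filter (fun l => M < l.natAbs),
      combArray c m w n k l ^ 2 ≤ ε / 4 := by
    have h5 : ∑ k ∈ Finset.Ico 1 n, ∑ l ∈ (S n).filter (fun l => M < l.natAbs),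
        combArray c m w n k l ^ 2 ≤ ε / 4 * n := by
      refine le_trans (Finset.sum_le_sum fun k _ => ?_) (h3 (S n))
      refine Finset.sum_le_sum_of_subset_of_nonneg (fun l hl => ?_) fun _ _ _ => sq_nonneg _
      have := Finset.mem_filter.1 hl
      exact Finset.mem_filter.2 ⟨this.1, (le_max_left _ _).trans_lt this.2⟩
    rw [one_div, inv_mul_le_iff₀ hn', mul_comm]
    exact h5
  have htail0 : 0 ≤ 1 / (n : ℝ) * ∑ k ∈ Finset.Ico 1 n,
      ∑ l ∈ (S n).filter (fun l => M < l.natAbs), combArray c m w n k l ^ 2 := by positivity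
  simp_rw [hsplit, Finset.sum_add_distrib, mul_add]
  rw [Real.dist_eq] at h1 h2 ⊢
  rw [abs_lt] at h1 h2 ⊢
  constructor <;> linarith [h1.1, h1.2, h2.1, h2.2]

end ArrayLimit

/-! ### Summability of products of ρ_γ -/

section RhoSummable

lemma rho_nonneg {γ : ℝ} (hγ : γ < 2) {l : ℕ} (hl : 2 ≤ l) : 0 ≤ rho γ l := by
  rw [rho_eq_integral hγ hl]
  have hl' : (2 : ℝ) ≤ l := by exact_mod_cast hl
  exact integral_nonneg_of_ae ((ae_gap l).mono fun p hp => Real.rpow_nonneg (by linarith [hp.1]) _)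

lemma rho_le {γ : ℝ} (hγ : γ ∈ Ioo (0 : ℝ) 2) {l : ℕ} (hl : 3 ≤ l) :
    rho γ l ≤ 1 / ((l : ℝ) - 2) ^ 2 := by
  have hl' : (3 : ℝ) ≤ l := by exact_mod_cast hl
  rw [rho_eq_integral hγ.2 (by omega)]
  have : ∀ᵐ p ∂cubeMeasure, ‖gap l p ^ (-(2 + γ))‖ ≤ 1 / ((l : ℝ) - 2) ^ 2 := by
    filter_upwards [ae_gap l] with p hp
    have g1 : 1 ≤ gap l p := by linarith [hp.1]
    rw [Real.norm_eq_abs, abs_of_nonneg (Real.rpow_nonneg (by linarith) _)]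
    have h1 : gap l p ^ (-(2 + γ)) ≤ gap l p ^ (-2 : ℝ) :=
      Real.rpow_le_rpow_of_exponent_le g1 (by linarith [hγ.1])
    refine h1.trans ?_
    rw [Real.rpow_neg (by linarith), one_div, Real.rpow_two]
    have hl2 : 0 < (l : ℝ) - 2 := by linarith
    exact inv_anti₀ (by positivity) (by nlinarith [hp.1])
  have h2 := norm_integral_le_of_norm_le_const this
  exact (le_abs_self _).trans (by simpa using h2)

lemma summable_rho_sq {γ : ℝ} (hγ : γ ∈ Ioo (0 : ℝ) 2) :
    Summable fun l : ℕ => rho γ (l + 2) ^ 2 := by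
  rw [← summable_nat_add_iff 1]
  have h1 : Summable fun n : ℕ => 1 / ((n + 1 : ℕ) : ℝ) ^ 2 :=
    (summable_nat_add_iff 1).2 (Real.summable_one_div_nat_pow.2 one_lt_two)
  refine Summable.of_nonneg_of_le (fun _ => sq_nonneg _) (fun n => ?_) h1
  have h2 := rho_le hγ (l := n + 1 + 2) (by omega)
  have h3 := rho_nonneg hγ.2 (l := n + 1 + 2) (by omega)
  push_cast at h2 ⊢
  rw [show (n : ℝ) + 1 + 2 - 2 = n + 1 by ring] at h2
  have h4 : 1 / ((n : ℝ) + 1) ^ 2 ≤ 1 := by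
    rw [div_le_one (by positivity)]; nlinarith [(Nat.cast_nonneg n : (0 : ℝ) ≤ n)]
  nlinarith

lemma summable_rho_mul {γ : ℝ} (hγ : γ ∈ Ioo (0 : ℝ) 2) (k : ℕ) :
    Summable fun l : ℕ => rho γ (l + k + 2) * rho γ (l + 2) := by
  have h1 := summable_rho_sq hγ
  have h2 := (summable_nat_add_iff k).2 h1
  refine Summable.of_nonneg_of_le (fun n => mul_nonneg (rho_nonneg hγ.2 (by omega))
    (rho_nonneg hγ.2 (by omega))) (fun n => ?_) (h2.add h1)
  nlinarith [sq_nonneg (rho γ (n + k + 2) - rho γ (n + 2)), sq_nonneg (rho γ (n + k + 2)),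
    sq_nonneg (rho γ (n + 2))]

end RhoSummable

/-! ### Identification of the limiting variances -/

section LimitSums

/-- The limits of the normalized covariances along the diagonals. -/
def diagLimit (γ : ℝ) (C : ℝ → ℝ → ℝ) (g₀ gt : ℝ → ℝ) (t : ℝ) : ℕ → ℝ
  | 0 => g₀ t
  | 1 => gt t
  | l + 2 => C t t * rho γ (l + 2)

variable {γ : ℝ} {C : ℝ → ℝ → ℝ} {g₀ gt : ℝ → ℝ}

/-- Integrated products of the diagonal limits at lag `k`. -/
def lagProduct (γ : ℝ) (C : ℝ → ℝ → ℝ) (g₀ gt : ℝ → ℝ) (k l : ℤ) : ℝ :=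
  ∫ t in (0 : ℝ)..1, diagLimit γ C g₀ gt t l.natAbs * diagLimit γ C g₀ gt t (l + k).natAbs

lemma integral_tail_mul_tail (i j : ℕ) : ∫ t in (0 : ℝ)..1,
    diagLimit γ C g₀ gt t (i + 2) * diagLimit γ C g₀ gt t (j + 2) =
      (∫ t in (0 : ℝ)..1, C t t ^ 2) * (rho γ (i + 2) * rho γ (j + 2)) := by
  rw [← intervalIntegral.integral_mul_const]
  congr 1
  funext t
  simp only [diagLimit]; ring

/-- Summing over ℤ counts lag 0 once and every other lag twice, which yields half of σ². -/
lemma hasSum_lagProduct_zero (hγ : γ ∈ Ioo (0 : ℝ) 2) :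
    HasSum (lagProduct γ C g₀ gt 0) (sigmaSq γ C g₀ gt / 2) := by
  have hρ : HasSum (fun l : ℕ => (∫ t in (0 : ℝ)..1, C t t ^ 2) * (rho γ (l + 2) * rho γ (l + 2)))
      ((∫ t in (0 : ℝ)..1, C t t ^ 2) * rhoNormSq γ) := by
    have := (summable_rho_sq hγ).hasSum.mul_left (∫ t in (0 : ℝ)..1, C t t ^ 2)
    simpa only [sq, rhoNormSq] using this
  have e : ∀ n : ℕ, lagProduct γ C g₀ gt 0 n =
      ∫ t in (0 : ℝ)..1, diagLimit γ C g₀ gt t n * diagLimit γ C g₀ gt t n := fun n => by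
    simp [lagProduct]
  have e' : ∀ n : ℕ, lagProduct γ C g₀ gt 0 (-(n + 1 : ℤ)) =
      ∫ t in (0 : ℝ)..1, diagLimit γ C g₀ gt t (n + 1) * diagLimit γ C g₀ gt t (n + 1) := fun n => by
    have : (-(n + 1 : ℤ)).natAbs = n + 1 := by omega
    rw [lagProduct, add_zero, this]
  have h1 : HasSum (fun n : ℕ => lagProduct γ C g₀ gt 0 n) ((∫ t in (0 : ℝ)..1, C t t ^ 2) * rhoNormSq γ +
      ∑ n ∈ Finset.range 2, lagProduct γ C g₀ gt 0 n) := by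
    refine (hasSum_nat_add_iff 2).1 ?_
    refine hρ.congr_fun fun n => ?_
    rw [e, integral_tail_mul_tail]
  have h2 : HasSum (fun n : ℕ => lagProduct γ C g₀ gt 0 (-(n + 1 : ℤ)))
      ((∫ t in (0 : ℝ)..1, C t t ^ 2) * rhoNormSq γ +
      ∑ n ∈ Finset.range 1, lagProduct γ C g₀ gt 0 (-(n + 1 : ℤ))) := by
    refine (hasSum_nat_add_iff (f := fun n : ℕ => lagProduct γ C g₀ gt 0 (-(n + 1 : ℤ))) 1).1 ?_
    refine hρ.congr_fun fun n => ?_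
    rw [e', integral_tail_mul_tail]
  have h3 := HasSum.of_nat_of_neg_add_one h1 h2
  convert h3 using 1
  simp only [Finset.sum_range_succ, Finset.sum_range_zero, e, e']
  simp only [diagLimit, sigmaSq, ← sq, zero_add]
  ring

/-- The reflection l ↦ -1 - l exchanges the two factors, so the negative half of the sum repeats the
nonnegative one. -/
lemma hasSum_lagProduct_one (hγ : γ ∈ Ioo (0 : ℝ) 2) :
    HasSum (lagProduct γ C g₀ gt 1) (sigmaSqCov₂ γ C g₀ gt / 2) := by
  have hρ : HasSum (fun l : ℕ => (∫ t in (0 : ℝ)..1, C t t ^ 2) * (rho γ (l + 3) * rho γ (l + 2)))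
      ((∫ t in (0 : ℝ)..1, C t t ^ 2) * ∑' l : ℕ, rho γ (l + 3) * rho γ (l + 2)) :=
    (summable_rho_mul hγ 1).hasSum.mul_left (∫ t in (0 : ℝ)..1, C t t ^ 2)
  have e : ∀ n : ℕ, lagProduct γ C g₀ gt 1 n =
      ∫ t in (0 : ℝ)..1, diagLimit γ C g₀ gt t n * diagLimit γ C g₀ gt t (n + 1) := fun n => by
    have : ((n : ℤ) + 1).natAbs = n + 1 := by omega
    simp [lagProduct, this]
  have e' : ∀ n : ℕ, lagProduct γ C g₀ gt 1 (-(n + 1 : ℤ)) =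
      ∫ t in (0 : ℝ)..1, diagLimit γ C g₀ gt t (n + 1) * diagLimit γ C g₀ gt t n := fun n => by
    have h1 : (-(n + 1 : ℤ)).natAbs = n + 1 := by omega
    have h2 : (-(n + 1 : ℤ) + 1).natAbs = n := by omega
    rw [lagProduct, h1, h2]
  have h1 : HasSum (fun n : ℕ => lagProduct γ C g₀ gt 1 n)
      ((∫ t in (0 : ℝ)..1, C t t ^ 2) * (∑' l : ℕ, rho γ (l + 3) * rho γ (l + 2)) +
      ∑ n ∈ Finset.range 2, lagProduct γ C g₀ gt 1 n) := by
    refine (hasSum_nat_add_iff 2).1 ?_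
    refine hρ.congr_fun fun n => ?_
    rw [e, show n + 2 + 1 = n + 1 + 2 by ring, integral_tail_mul_tail]
    ring_nf
  have h2 : HasSum (fun n : ℕ => lagProduct γ C g₀ gt 1 (-(n + 1 : ℤ)))
      ((∫ t in (0 : ℝ)..1, C t t ^ 2) * (∑' l : ℕ, rho γ (l + 3) * rho γ (l + 2)) +
      ∑ n ∈ Finset.range 2, lagProduct γ C g₀ gt 1 (-(n + 1 : ℤ))) := by
    refine (hasSum_nat_add_iff (f := fun n : ℕ => lagProduct γ C g₀ gt 1 (-(n + 1 : ℤ))) 2).1 ?_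
    refine hρ.congr_fun fun n => ?_
    rw [e', show n + 2 + 1 = n + 1 + 2 by ring, integral_tail_mul_tail]
  have h3 := HasSum.of_nat_of_neg_add_one h1 h2
  convert h3 using 1
  simp only [Finset.sum_range_succ, Finset.sum_range_zero, e, e']
  simp only [diagLimit, sigmaSqCov₂, zero_add]
  have i1 : ∫ t in (0 : ℝ)..1, gt t * (C t t * rho γ 2) =
      rho γ 2 * ∫ t in (0 : ℝ)..1, gt t * C t t := by
    rw [← intervalIntegral.integral_const_mul]; congr 1; funext t; ring
  have i2 : ∫ t in (0 : ℝ)..1, C t t * rho γ 2 * gt t =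
      rho γ 2 * ∫ t in (0 : ℝ)..1, gt t * C t t := by
    rw [← intervalIntegral.integral_const_mul]; congr 1; funext t; ring
  have i3 : ∫ t in (0 : ℝ)..1, gt t * g₀ t = ∫ t in (0 : ℝ)..1, g₀ t * gt t := by
    congr 1; funext t; ring
  rw [i1, i2, i3]
  ring

/-- The reflection l ↦ -2 - l fixes l = -1, which contributes ∫ g̃² once; every other term appears
twice. This extra term is why three negative indices are split off against two nonnegative ones. -/
lemma hasSum_lagProduct_two (hγ : γ ∈ Ioo (0 : ℝ) 2) :
    HasSum (lagProduct γ C g₀ gt 2) (sigmaSqCov₁ γ C g₀ gt / 2) := by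
  have hρ : HasSum (fun l : ℕ => (∫ t in (0 : ℝ)..1, C t t ^ 2) * (rho γ (l + 4) * rho γ (l + 2)))
      ((∫ t in (0 : ℝ)..1, C t t ^ 2) * ∑' l : ℕ, rho γ (l + 4) * rho γ (l + 2)) :=
    (summable_rho_mul hγ 2).hasSum.mul_left (∫ t in (0 : ℝ)..1, C t t ^ 2)
  have e : ∀ n : ℕ, lagProduct γ C g₀ gt 2 n =
      ∫ t in (0 : ℝ)..1, diagLimit γ C g₀ gt t n * diagLimit γ C g₀ gt t (n + 2) := fun n => by
    have : ((n : ℤ) + 2).natAbs = n + 2 := by omega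
    simp [lagProduct, this]
  have e0 : lagProduct γ C g₀ gt 2 (-((0 : ℕ) + 1 : ℤ)) =
      ∫ t in (0 : ℝ)..1, diagLimit γ C g₀ gt t 1 * diagLimit γ C g₀ gt t 1 := rfl
  have e' : ∀ n : ℕ, lagProduct γ C g₀ gt 2 (-((n + 1 : ℕ) + 1 : ℤ)) =
      ∫ t in (0 : ℝ)..1, diagLimit γ C g₀ gt t (n + 2) * diagLimit γ C g₀ gt t n := fun n => by
    have h1 : (-((n + 1 : ℕ) + 1 : ℤ)).natAbs = n + 2 := by omega
    have h2 : (-((n + 1 : ℕ) + 1 : ℤ) + 2).natAbs = n := by omega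
    rw [lagProduct, h1, h2]
  have h1 : HasSum (fun n : ℕ => lagProduct γ C g₀ gt 2 n)
      ((∫ t in (0 : ℝ)..1, C t t ^ 2) * (∑' l : ℕ, rho γ (l + 4) * rho γ (l + 2)) +
      ∑ n ∈ Finset.range 2, lagProduct γ C g₀ gt 2 n) := by
    refine (hasSum_nat_add_iff 2).1 ?_
    refine hρ.congr_fun fun n => ?_
    rw [e, integral_tail_mul_tail]
    ring_nf
  have h2 : HasSum (fun n : ℕ => lagProduct γ C g₀ gt 2 (-(n + 1 : ℤ)))
      ((∫ t in (0 : ℝ)..1, C t t ^ 2) * (∑' l : ℕ, rho γ (l + 4) * rho γ (l + 2)) +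
      ∑ n ∈ Finset.range 3, lagProduct γ C g₀ gt 2 (-(n + 1 : ℤ))) := by
    refine (hasSum_nat_add_iff (f := fun n : ℕ => lagProduct γ C g₀ gt 2 (-(n + 1 : ℤ))) 3).1 ?_
    refine hρ.congr_fun fun n => ?_
    rw [show n + 3 = (n + 2) + 1 by ring, e', integral_tail_mul_tail]
  have h3 := HasSum.of_nat_of_neg_add_one h1 h2
  convert h3 using 1
  rw [Finset.sum_range_succ' (n := 2)]
  simp only [Finset.sum_range_succ, Finset.sum_range_zero, e, e', e0]
  simp only [diagLimit, sigmaSqCov₁, zero_add, Nat.reduceAdd, ← sq]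
  have i1 : ∫ t in (0 : ℝ)..1, gt t * (C t t * rho γ 3) =
      rho γ 3 * ∫ t in (0 : ℝ)..1, gt t * C t t := by
    rw [← intervalIntegral.integral_const_mul]; congr 1; funext t; ring
  have i2 : ∫ t in (0 : ℝ)..1, C t t * rho γ 3 * gt t =
      rho γ 3 * ∫ t in (0 : ℝ)..1, gt t * C t t := by
    rw [← intervalIntegral.integral_const_mul]; congr 1; funext t; ring
  have i3 : ∫ t in (0 : ℝ)..1, g₀ t * (C t t * rho γ 2) =
      rho γ 2 * ∫ t in (0 : ℝ)..1, g₀ t * C t t := by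
    rw [← intervalIntegral.integral_const_mul]; congr 1; funext t; ring
  have i4 : ∫ t in (0 : ℝ)..1, C t t * rho γ 2 * g₀ t =
      rho γ 2 * ∫ t in (0 : ℝ)..1, g₀ t * C t t := by
    rw [← intervalIntegral.integral_const_mul]; congr 1; funext t; ring
  rw [i1, i2, i3, i4]
  ring

lemma sum_Icc_neg_one_one (f : ℤ → ℝ) : ∑ a ∈ Finset.Icc (-1 : ℤ) 1, f a = f (-1) + f 0 + f 1 := by
  have : Finset.Icc (-1 : ℤ) 1 = {-1, 0, 1} := by decide
  rw [this]
  simp [add_assoc]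

/-- Weights selecting a single column. -/
def weightOne (a : ℤ) : ℝ := if a = 0 then 1 else 0

/-- Weights expressing an increment of step `2h` through increments of step `h`. -/
def weightTwo (a : ℤ) : ℝ := if a = 0 then 2 else 1

lemma hasSum_combLimit_weightOne (hγ : γ ∈ Ioo (0 : ℝ) 2) :
    HasSum (fun l => ∫ t in (0 : ℝ)..1, combLimit (diagLimit γ C g₀ gt) weightOne t l ^ 2)
      (sigmaSq γ C g₀ gt / 2) := by
  refine (hasSum_lagProduct_zero hγ).congr_fun fun l => ?_
  unfold lagProduct
  congr 1
  funext t
  simp [combLimit, weightOne, sq]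

/-- Squaring r(l+1) + 2r(l) + r(l-1) produces lag 0 with total weight 1 + 4 + 1, lag 1 with 4 + 4
and lag 2 with 2, up to translations of ℤ. As each lag sum is half of the corresponding σ², the
total is 3σ² + 4σ²_{2,cov} + σ²_{1,cov}. -/
lemma hasSum_combLimit_weightTwo (hγ : γ ∈ Ioo (0 : ℝ) 2)
    (hint : ∀ i j, IntervalIntegrable
      (fun t => diagLimit γ C g₀ gt t i * diagLimit γ C g₀ gt t j) volume 0 1) :
    HasSum (fun l => ∫ t in (0 : ℝ)..1, combLimit (diagLimit γ C g₀ gt) weightTwo t l ^ 2)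
      (sigmaStarSq γ C g₀ gt) := by
  have shift : ∀ {f : ℤ → ℝ} {v : ℝ} (b : ℤ), HasSum f v → HasSum (fun l => f (l + b)) v :=
    fun {f v} b h => (Equiv.addRight b).hasSum_iff.2 h
  have h0 := hasSum_lagProduct_zero (C := C) (g₀ := g₀) (gt := gt) hγ
  have h1 := hasSum_lagProduct_one (C := C) (g₀ := g₀) (gt := gt) hγ
  have h2 := hasSum_lagProduct_two (C := C) (g₀ := g₀) (gt := gt) hγ
  have total := ((((shift 1 h0).add (h0.mul_left 4)).add (shift (-1) h0)).add
    ((h1.mul_left 4).add ((shift (-1) h1).mul_left 4))).add ((shift (-1) h2).mul_left 2)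
  have ev : sigmaStarSq γ C g₀ gt = sigmaSq γ C g₀ gt / 2 + 4 * (sigmaSq γ C g₀ gt / 2) +
      sigmaSq γ C g₀ gt / 2 + (4 * (sigmaSqCov₂ γ C g₀ gt / 2) + 4 * (sigmaSqCov₂ γ C g₀ gt / 2)) +
      2 * (sigmaSqCov₁ γ C g₀ gt / 2) := by
    unfold sigmaStarSq; ring
  rw [ev]
  refine total.congr_fun fun l => ?_
  unfold lagProduct
  set r := diagLimit γ C g₀ gt with hr
  have e1 : ∀ t, combLimit r weightTwo t l ^ 2 =
      r t (l + 1).natAbs * r t (l + 1).natAbs + 4 * (r t l.natAbs * r t l.natAbs) +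
      r t (l - 1).natAbs * r t (l - 1).natAbs + (4 * (r t l.natAbs * r t (l + 1).natAbs) +
      4 * (r t (l - 1).natAbs * r t l.natAbs)) + 2 * (r t (l - 1).natAbs * r t (l + 1).natAbs) := by
    intro t
    simp only [combLimit, sum_Icc_neg_one_one, weightTwo, sub_neg_eq_add, sub_zero]
    norm_num
    ring
  simp_rw [e1]
  rw [intervalIntegral.integral_add
      ((((hint _ _).add ((hint _ _).const_mul 4)).add (hint _ _)).add
        (((hint _ _).const_mul 4).add ((hint _ _).const_mul 4))) ((hint _ _).const_mul 2),
    intervalIntegral.integral_add (((hint _ _).add ((hint _ _).const_mul 4)).add (hint _ _))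
        (((hint _ _).const_mul 4).add ((hint _ _).const_mul 4)),
    intervalIntegral.integral_add ((hint _ _).add ((hint _ _).const_mul 4)) (hint _ _),
    intervalIntegral.integral_add (hint _ _) ((hint _ _).const_mul 4),
    intervalIntegral.integral_add ((hint _ _).const_mul 4) ((hint _ _).const_mul 4)]
  simp only [intervalIntegral.integral_const_mul]
  have a1 : l + 1 + 0 = l + 1 := by ring
  have a2 : l + -1 + 0 = l - 1 := by ring
  have a3 : l + -1 + 1 = l := by ring
  have a4 : l + -1 + 2 = l + 1 := by ring
  have a5 : l + -1 = l - 1 := by ring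
  have a6 : l + 0 = l := by ring
  rw [a1, a2, a3, a4, a5, a6]

end LimitSums

/-! ### Passage from lags to matrix indices -/

section Reindex

variable {c : ℕ → ℕ → ℕ → ℝ}

/-- The range of relative positions of rows with respect to a column. -/
def lagRange (m n : ℕ) : Finset ℤ := Finset.Icc (-((m * n : ℕ) : ℤ)) (m * n : ℕ)

lemma sum_lagRange {m n k : ℕ} (hk : k < n) (f : ℕ → ℝ) :
    ∑ l ∈ lagRange m n, (if 1 ≤ (m : ℤ) * k + l ∧ (m : ℤ) * k + l < (m * n : ℕ) then
      f ((m : ℤ) * k + l).toNat else 0) = ∑ i ∈ Finset.Ico 1 (m * n), f i := by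
  have hmk : m * k ≤ m * n := Nat.mul_le_mul_left m hk.le
  have hmk' : (m : ℤ) * k ≤ (m * n : ℕ) := by exact_mod_cast hmk
  have hmk0 : 0 ≤ (m : ℤ) * k := by positivity
  rw [← Finset.sum_filter]
  symm
  refine Finset.sum_bij' (fun i _ => (i : ℤ) - m * k) (fun l _ => ((m : ℤ) * k + l).toNat)
    ?_ ?_ ?_ ?_ ?_
  · intro i hi
    have := Finset.mem_Ico.1 hi
    simp only [lagRange, Finset.mem_filter, Finset.mem_Icc]
    refine ⟨⟨?_, ?_⟩, ?_, ?_⟩ <;> omega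
  · intro l hl
    have := Finset.mem_filter.1 hl
    simp only [Finset.mem_Ico]
    constructor <;> omega
  · intro i _
    simp
  · intro l hl
    have := (Finset.mem_filter.1 hl).2
    rw [Int.toNat_of_nonneg (by omega)]; ring
  · intro i _
    simp

lemma sum_combArray_weightOne (n : ℕ) :
    ∑ k ∈ Finset.Ico 1 n, ∑ l ∈ lagRange 1 n, combArray c 1 weightOne n k l ^ 2 =
      ∑ k ∈ Finset.Ico 1 n, ∑ i ∈ Finset.Ico 1 n, c n i k ^ 2 := by
  refine Finset.sum_congr rfl fun k hk => ?_
  have hk' := Finset.mem_Ico.1 hk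
  have := sum_lagRange (m := 1) hk'.2 (fun i => c n i k ^ 2)
  rw [one_mul] at this
  rw [← this]
  refine Finset.sum_congr rfl fun l _ => ?_
  simp only [combArray, sum_Icc_neg_one_one, weightOne, extArray]
  norm_num
  have h1 : (1 : ℤ) ≤ k := by exact_mod_cast hk'.1
  have h2 : (k : ℤ) < n := by exact_mod_cast hk'.2
  simp [hk'.1, hk'.2]

lemma sum_combArray_weightTwo (n : ℕ) :
    ∑ k ∈ Finset.Ico 1 n, ∑ l ∈ lagRange 2 n, combArray c 2 weightTwo n k l ^ 2 =
      ∑ k ∈ Finset.Ico 1 n, ∑ i ∈ Finset.Ico 1 (2 * n),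
        (c (2 * n) i (2 * k + 1) + 2 * c (2 * n) i (2 * k) + c (2 * n) i (2 * k - 1)) ^ 2 := by
  refine Finset.sum_congr rfl fun k hk => ?_
  have hk' := Finset.mem_Ico.1 hk
  rw [← sum_lagRange (m := 2) hk'.2]
  refine Finset.sum_congr rfl fun l _ => ?_
  simp only [combArray, sum_Icc_neg_one_one, extArray]
  have w1 : weightTwo (-1) = 1 := by norm_num [weightTwo]
  have w2 : weightTwo 0 = 2 := by norm_num [weightTwo]
  have w3 : weightTwo 1 = 1 := by norm_num [weightTwo]
  have t1 : (((2 : ℕ) : ℤ) * k + 1).toNat = 2 * k + 1 := by omega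
  have t2 : (((2 : ℕ) : ℤ) * k + 0).toNat = 2 * k := by omega
  have t3 : (((2 : ℕ) : ℤ) * k + -1).toNat = 2 * k - 1 := by omega
  have c1 : (1 : ℤ) ≤ ((2 : ℕ) : ℤ) * k + 1 ∧ ((2 : ℕ) : ℤ) * k + 1 < (2 * n : ℕ) := by omega
  have c2 : (1 : ℤ) ≤ ((2 : ℕ) : ℤ) * k + 0 ∧ ((2 : ℕ) : ℤ) * k + 0 < (2 * n : ℕ) := by omega
  have c3 : (1 : ℤ) ≤ ((2 : ℕ) : ℤ) * k + -1 ∧ ((2 : ℕ) : ℤ) * k + -1 < (2 * n : ℕ) := by omega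
  rw [t1, t2, t3, w1, w2, w3]
  by_cases hrow : 1 ≤ ((2 : ℕ) : ℤ) * k + l ∧ ((2 : ℕ) : ℤ) * k + l < (2 * n : ℕ)
  · rw [if_pos hrow, if_pos ⟨hrow, c3⟩, if_pos ⟨hrow, c2⟩, if_pos ⟨hrow, c1⟩]
    ring
  · rw [if_neg hrow, if_neg (fun h => hrow h.1), if_neg (fun h => hrow h.1),
      if_neg (fun h => hrow h.1)]
    ring

lemma eventually_Icc_subset_lagRange {m : ℕ} (hm : 0 < m) (M : ℕ) :
    ∀ᶠ n in atTop, Finset.Icc (-(M : ℤ)) M ⊆ lagRange m n := by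
  filter_upwards [eventually_ge_atTop M] with n hn
  have : M ≤ m * n := hn.trans (Nat.le_mul_of_pos_left n hm)
  refine Finset.Icc_subset_Icc ?_ ?_ <;> omega

end Reindex

/-! ### Joint limit for two levels of a Gaussian array -/

section Refinement

variable {Ω : Type*} [MeasurableSpace Ω] {P : Measure Ω}

/-- The members of levels `n` and `2n` of a triangular array, as a single family. -/
def twoLevels (Y : ℕ → ℕ → Ω → ℝ) (n : ℕ) : Finset.Ico 1 n ⊕ Finset.Ico 1 (2 * n) → Ω → ℝ :=
  Sum.elim (fun k => Y n k) (fun i => Y (2 * n) i)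

/-- A centred Gaussian triangular array whose level `n` is obtained from level `2n` by combining
three neighbours, up to the factor `s n`. -/
structure IsRefiningArray (Y : ℕ → ℕ → Ω → ℝ) (P : Measure Ω) (c : ℕ → ℕ → ℕ → ℝ) (s : ℕ → ℝ) :
    Prop where
  gauss : ∀ n, HasGaussianLaw (fun ω => (twoLevels Y n · ω)) P
  mean : ∀ N, ∀ k ∈ Finset.Ico 1 N, P[Y N k] = 0
  cov_eq : ∀ N, ∀ i ∈ Finset.Ico 1 N, ∀ j ∈ Finset.Ico 1 N, cov[Y N i, Y N j; P] = c N i j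
  refine : ∀ n, ∀ k ∈ Finset.Ico 1 n, Y n k =
    fun ω => s n * (Y (2 * n) (2 * k + 1) ω + 2 * Y (2 * n) (2 * k) ω + Y (2 * n) (2 * k - 1) ω)

variable {Y : ℕ → ℕ → Ω → ℝ} {c : ℕ → ℕ → ℕ → ℝ} {s : ℕ → ℝ}

lemma sum_subtype_extend {α : Type*} [DecidableEq α] (t : Finset α) (x : t → ℝ) :
    ∃ y : α → ℝ, ∀ i : t, y i = x i :=
  ⟨fun i => if h : i ∈ t then x ⟨i, h⟩ else 0, fun i => by simp⟩

lemma IsRefiningArray.memLp (H : IsRefiningArray Y P c s) {N k : ℕ} (hk : k ∈ Finset.Ico 1 N) :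
    MemLp (Y N k) 2 P :=
  ((H.gauss N).eval (Sum.inl ⟨k, hk⟩)).memLp_two

lemma IsRefiningArray.isPSDOn [IsProbabilityMeasure P] (H : IsRefiningArray Y P c s) (N : ℕ) :
    IsPSDOn (Finset.Ico 1 N) (c N) where
  symm i hi j hj := by
    rw [← H.cov_eq N i hi j hj, ← H.cov_eq N j hj i hi, covariance_comm]
  nonneg x := by
    have h : 0 ≤ Var[fun ω => ∑ i : Finset.Ico 1 N, x i * Y N i ω; P] := variance_nonneg _ _
    rw [← dotProduct_covMatrix_mulVec (Z := fun i : Finset.Ico 1 N => Y N i)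
      (fun i => H.memLp i.2) (fun i => x i)] at h
    refine h.trans_eq ?_
    simp only [dotProduct, Matrix.mulVec, covMatrix, Matrix.of_apply, Finset.mul_sum, quadForm]
    rw [← Finset.sum_coe_sort (Finset.Ico 1 N)]
    refine Finset.sum_congr rfl fun i _ => ?_
    rw [← Finset.sum_coe_sort (Finset.Ico 1 N)]
    refine Finset.sum_congr rfl fun j _ => ?_
    rw [H.cov_eq N i i.2 j j.2]; ring

/-- Changing the sign of the second block and using positivity bounds the cross terms by the
diagonal ones. -/
lemma sum_sum_le_of_nonneg {α β : Type*} [Fintype α] [Fintype β] {f : α ⊕ β → α ⊕ β → ℝ}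
    (hf : ∀ x : α ⊕ β → ℝ, 0 ≤ ∑ p, ∑ q, x p * x q * f p q) (x : α ⊕ β → ℝ) :
    ∑ p, ∑ q, x p * x q * f p q ≤
      2 * (∑ i, ∑ j, x (.inl i) * x (.inl j) * f (.inl i) (.inl j)) +
      2 * (∑ i, ∑ j, x (.inr i) * x (.inr j) * f (.inr i) (.inr j)) := by
  have h := hf (Sum.elim (fun i => x (.inl i)) (fun i => - x (.inr i)))
  simp only [Fintype.sum_sum_type, Sum.elim_inl, Sum.elim_inr, mul_neg, neg_mul,
    Finset.sum_add_distrib, Finset.sum_neg_distrib] at h ⊢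
  linarith

/-- Cross-level covariances need no estimate: positivity of the joint covariance reduces the bound
to each level separately. -/
lemma IsRefiningArray.exists_sum_cov_le [IsProbabilityMeasure P] (H : IsRefiningArray Y P c s)
    (hc : IsDecayingArray c) : ∃ K, ∀ᶠ n in atTop,
      ∀ x : Finset.Ico 1 n ⊕ Finset.Ico 1 (2 * n) → ℝ,
        ∑ p, ∑ q, x p * x q * cov[twoLevels Y n p, twoLevels Y n q; P] ≤ K * ∑ p, x p ^ 2 := by
  obtain ⟨K, hK, h⟩ := hc.exists_quadForm_le
  have h2 : Tendsto (fun n : ℕ => 2 * n) atTop atTop := tendsto_id.const_mul_atTop' two_pos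
  refine ⟨2 * K, ?_⟩
  filter_upwards [h, h2.eventually h] with n h1 h2 x
  have nonneg : ∀ x : Finset.Ico 1 n ⊕ Finset.Ico 1 (2 * n) → ℝ,
      0 ≤ ∑ p, ∑ q, x p * x q * cov[twoLevels Y n p, twoLevels Y n q; P] := by
    intro x
    have := variance_nonneg (fun ω => ∑ p, x p * twoLevels Y n p ω) P
    rw [← dotProduct_covMatrix_mulVec (fun p => ((H.gauss n).eval p).memLp_two)] at this
    refine this.trans_eq ?_
    simp only [dotProduct, Matrix.mulVec, covMatrix, Matrix.of_apply, Finset.mul_sum]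
    exact Finset.sum_congr rfl fun i _ => Finset.sum_congr rfl fun j _ => by ring
  refine (sum_sum_le_of_nonneg nonneg x).trans ?_
  have level : ∀ (N : ℕ) (x : Finset.Ico 1 N → ℝ),
      (∀ x, quadForm (Finset.Ico 1 N) (c N) x x ≤ K * ∑ i ∈ Finset.Ico 1 N, x i ^ 2) →
      ∑ i, ∑ j, x i * x j * cov[Y N i, Y N j; P] ≤ K * ∑ i, x i ^ 2 := by
    intro N x hN
    obtain ⟨y, hy⟩ := sum_subtype_extend _ x
    have := hN y
    rw [quadForm, ← Finset.sum_coe_sort (Finset.Ico 1 N),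
      ← Finset.sum_coe_sort (Finset.Ico 1 N)] at this
    simp only [hy] at this
    refine le_trans (le_of_eq ?_) this
    refine Finset.sum_congr rfl fun i _ => ?_
    rw [← Finset.sum_coe_sort (Finset.Ico 1 N)]
    refine Finset.sum_congr rfl fun j _ => ?_
    rw [H.cov_eq N i i.2 j j.2, hy]
  have l1 := level n (fun i => x (.inl i)) h1
  have l2 := level (2 * n) (fun i => x (.inr i)) h2
  rw [Fintype.sum_sum_type (fun p => x p ^ 2)]
  simp only [twoLevels, Sum.elim_inl, Sum.elim_inr]
  linarith

lemma IsRefiningArray.cov_cross [IsProbabilityMeasure P] (H : IsRefiningArray Y P c s) {n k i : ℕ}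
    (hk : k ∈ Finset.Ico 1 n) (hi : i ∈ Finset.Ico 1 (2 * n)) :
    cov[Y n k, Y (2 * n) i; P] =
      s n * (c (2 * n) i (2 * k + 1) + 2 * c (2 * n) i (2 * k) + c (2 * n) i (2 * k - 1)) := by
  have hk' := Finset.mem_Ico.1 hk
  have m1 : 2 * k + 1 ∈ Finset.Ico 1 (2 * n) := by rw [Finset.mem_Ico]; omega
  have m2 : 2 * k ∈ Finset.Ico 1 (2 * n) := by rw [Finset.mem_Ico]; omega
  have m3 : 2 * k - 1 ∈ Finset.Ico 1 (2 * n) := by rw [Finset.mem_Ico]; omega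
  rw [covariance_comm, H.refine n k hk, covariance_const_mul_right]
  have e : (fun ω => Y (2 * n) (2 * k + 1) ω + 2 * Y (2 * n) (2 * k) ω + Y (2 * n) (2 * k - 1) ω) =
      (Y (2 * n) (2 * k + 1) + fun ω => 2 * Y (2 * n) (2 * k) ω) + Y (2 * n) (2 * k - 1) := rfl
  rw [e, covariance_add_right (H.memLp hi) ((H.memLp m1).add ((H.memLp m2).const_mul 2)) (H.memLp m3),
    covariance_add_right (H.memLp hi) (H.memLp m1) ((H.memLp m2).const_mul 2),
    covariance_const_mul_right, H.cov_eq _ _ hi _ m1, H.cov_eq _ _ hi _ m2, H.cov_eq _ _ hi _ m3]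

/-- Normalized sum of the squared entries of an array. -/
def sqSum (c : ℕ → ℕ → ℕ → ℝ) (n : ℕ) : ℝ :=
  1 / (n : ℝ) * ∑ k ∈ Finset.Ico 1 n, ∑ i ∈ Finset.Ico 1 n, c n i k ^ 2

/-- Normalized sum of the squared covariances between two consecutive levels. -/
def crossSqSum (c : ℕ → ℕ → ℕ → ℝ) (n : ℕ) : ℝ :=
  1 / (n : ℝ) * ∑ k ∈ Finset.Ico 1 n, ∑ i ∈ Finset.Ico 1 (2 * n),
    (c (2 * n) i (2 * k + 1) + 2 * c (2 * n) i (2 * k) + c (2 * n) i (2 * k - 1)) ^ 2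

/-- Weights of the squares of the two levels. -/
def levelWeight (a b : ℝ) (n : ℕ) : Finset.Ico 1 n ⊕ Finset.Ico 1 (2 * n) → ℝ :=
  Sum.elim (fun _ => a / √n) (fun _ => b / (2 * √n))

/-- The weights are √n times the averaging factors 1/n and 1/(2n). Their products are a²/n, b²/(4n)
= (b²/2)/(2n), and ab/(2n) occurring twice. -/
lemma IsRefiningArray.sum_cov_sq [IsProbabilityMeasure P] (H : IsRefiningArray Y P c s) (a b : ℝ)
    {n : ℕ} (hn : 0 < n) :
    ∑ p, ∑ q, levelWeight a b n p * levelWeight a b n q *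
        cov[twoLevels Y n p, twoLevels Y n q; P] ^ 2 =
      a ^ 2 * sqSum c n + a * b * s n ^ 2 * crossSqSum c n + b ^ 2 / 2 * sqSum c (2 * n) := by
  have hn' : (0 : ℝ) < n := by exact_mod_cast hn
  have hsq : √(n : ℝ) * √(n : ℝ) = n := Real.mul_self_sqrt hn'.le
  have hs : (0 : ℝ) < √n := Real.sqrt_pos.2 hn'
  have level : ∀ (N : ℕ) (v : ℝ), ∑ i : Finset.Ico 1 N, ∑ j : Finset.Ico 1 N,
      v * cov[Y N i, Y N j; P] ^ 2 = v * ∑ k ∈ Finset.Ico 1 N, ∑ i ∈ Finset.Ico 1 N, c N i k ^ 2 := by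
    intro N v
    rw [Finset.sum_comm, ← Finset.sum_coe_sort (Finset.Ico 1 N), Finset.mul_sum]
    refine Finset.sum_congr rfl fun i _ => ?_
    rw [← Finset.sum_coe_sort (Finset.Ico 1 N), Finset.mul_sum]
    refine Finset.sum_congr rfl fun j _ => ?_
    rw [H.cov_eq N j j.2 i i.2]
  have cross : ∀ v : ℝ, ∑ k : Finset.Ico 1 n, ∑ i : Finset.Ico 1 (2 * n),
      v * cov[Y n k, Y (2 * n) i; P] ^ 2 = v * s n ^ 2 * (n * crossSqSum c n) := by
    intro v
    rw [crossSqSum, ← mul_assoc (n : ℝ), mul_one_div_cancel hn'.ne', one_mul,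
      ← Finset.sum_coe_sort (Finset.Ico 1 n), Finset.mul_sum]
    refine Finset.sum_congr rfl fun k _ => ?_
    rw [← Finset.sum_coe_sort (Finset.Ico 1 (2 * n)), Finset.mul_sum]
    refine Finset.sum_congr rfl fun i _ => ?_
    rw [H.cov_cross k.2 i.2]; ring
  have cross' : ∀ v : ℝ, ∑ i : Finset.Ico 1 (2 * n), ∑ k : Finset.Ico 1 n,
      v * cov[Y (2 * n) i, Y n k; P] ^ 2 = v * s n ^ 2 * (n * crossSqSum c n) := by
    intro v
    rw [← cross v, Finset.sum_comm]
    exact Finset.sum_congr rfl fun k _ => Finset.sum_congr rfl fun i _ => by rw [covariance_comm]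
  simp only [Fintype.sum_sum_type, levelWeight, twoLevels, Sum.elim_inl, Sum.elim_inr,
    Finset.sum_add_distrib]
  rw [level, level, cross, cross', sqSum, sqSum]
  push_cast
  have e1 : a / √n * (a / √n) = a ^ 2 / n := by rw [div_mul_div_comm, hsq, sq]
  have e2 : a / √n * (b / (2 * √n)) = a * b / (2 * n) := by
    rw [div_mul_div_comm, mul_left_comm, hsq]
  have e3 : b / (2 * √n) * (a / √n) = a * b / (2 * n) := by rw [mul_comm, e2]
  have e4 : b / (2 * √n) * (b / (2 * √n)) = b ^ 2 / (4 * n) := by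
    rw [div_mul_div_comm, mul_mul_mul_comm, hsq, sq]; norm_num
  rw [e1, e2, e3, e4]
  field_simp
  ring

/-- Centred quadratic variations of two consecutive levels are asymptotically jointly Gaussian. -/
theorem IsRefiningArray.tendsto_charFun [IsProbabilityMeasure P] (H : IsRefiningArray Y P c s)
    (hc : IsDecayingArray c) {u r v : ℝ} (hu : Tendsto (sqSum c) atTop (𝓝 u))
    (hr : Tendsto (fun n => s n ^ 2) atTop (𝓝 r)) (hv : Tendsto (crossSqSum c) atTop (𝓝 v))
    (a b : ℝ) :
    0 ≤ a ^ 2 * u + a * b * r * v + b ^ 2 / 2 * u ∧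
    Tendsto (fun n : ℕ => ∫ ω, Complex.exp (((
        a / √n * ∑ k ∈ Finset.Ico 1 n, (Y n k ω ^ 2 - c n k k) +
        b / (2 * √n) * ∑ k ∈ Finset.Ico 1 (2 * n), (Y (2 * n) k ω ^ 2 - c (2 * n) k k) : ℝ) : ℂ) *
          Complex.I) ∂P) atTop
      (𝓝 (Complex.exp (-((a ^ 2 * u + a * b * r * v + b ^ 2 / 2 * u : ℝ) : ℂ)))) := by
  have h2 : Tendsto (fun n : ℕ => 2 * n) atTop atTop := tendsto_id.const_mul_atTop' two_pos
  set B : ℕ → ℝ := fun n => a ^ 2 * sqSum c n + a * b * s n ^ 2 * crossSqSum c n +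
    b ^ 2 / 2 * sqSum c (2 * n) with hB
  set l := a ^ 2 * u + a * b * r * v + b ^ 2 / 2 * u with hl
  have hBl : Tendsto B atTop (𝓝 l) :=
    ((hu.const_mul _).add ((hr.const_mul _).mul hv)).add ((hu.comp h2).const_mul _)
  obtain ⟨K, hK⟩ := H.exists_sum_cov_le hc
  have main : ∀ ε : ℝ, 0 < ε → ∀ᶠ n : ℕ in atTop, 0 ≤ B n ∧
      ‖(∫ ω, Complex.exp (((
        a / √n * ∑ k ∈ Finset.Ico 1 n, (Y n k ω ^ 2 - c n k k) +
        b / (2 * √n) * ∑ k ∈ Finset.Ico 1 (2 * n), (Y (2 * n) k ω ^ 2 - c (2 * n) k k) : ℝ) : ℂ) *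
          Complex.I) ∂P) - Complex.exp (-((B n : ℝ) : ℂ))‖ ≤ ε * B n := by
    intro ε hε
    obtain ⟨δ, hδ, h⟩ := exists_norm_charFun_quadratic_sub_le hε
    -- Largest weight times operator norm: the eigenvalues of the diagonalized form are O(n^(-1/2)).
    have hW : Tendsto (fun n : ℕ => (|a| + |b|) / √n * K) atTop (𝓝 0) := by
      have : Tendsto (fun n : ℕ => (|a| + |b|) / √(n : ℝ)) atTop (𝓝 0) :=
        (Real.tendsto_sqrt_atTop.comp tendsto_natCast_atTop_atTop).const_div_atTop _
      simpa using this.mul_const K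
    filter_upwards [hK, hW.eventually (ge_mem_nhds hδ), eventually_gt_atTop 0] with n h1 h3 h4
    have hs : (0 : ℝ) < √n := Real.sqrt_pos.2 (by exact_mod_cast h4)
    have hw : ∀ p, |levelWeight a b n p| ≤ (|a| + |b|) / √n := by
      rintro (p | p)
      · simp only [levelWeight, Sum.elim_inl, abs_div, abs_of_pos hs]
        gcongr
        linarith [abs_nonneg b]
      · simp only [levelWeight, Sum.elim_inr, abs_div, abs_mul, abs_of_pos hs, abs_two]
        rw [← div_div]
        gcongr
        linarith [abs_nonneg a, abs_nonneg b]
    have hm : ∀ p, P[twoLevels Y n p] = 0 := by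
      rintro (p | p)
      · exact H.mean n p p.2
      · exact H.mean (2 * n) p p.2
    have key := h (H.gauss n) hm (levelWeight a b n) hw h1 h3
    rw [H.sum_cov_sq a b h4] at key
    refine ⟨key.1, ?_⟩
    convert key.2 using 8 with ω
    rw [Fintype.sum_sum_type]
    simp only [levelWeight, twoLevels, Sum.elim_inl, Sum.elim_inr]
    rw [Finset.mul_sum, Finset.mul_sum, ← Finset.sum_coe_sort (Finset.Ico 1 n),
      ← Finset.sum_coe_sort (Finset.Ico 1 (2 * n))]
    congr 1
    · exact Finset.sum_congr rfl fun k _ => by rw [H.cov_eq n k k.2 k k.2]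
    · exact Finset.sum_congr rfl fun k _ => by rw [H.cov_eq (2 * n) k k.2 k k.2]
  have hl0 : 0 ≤ l := ge_of_tendsto hBl ((main 1 one_pos).mono fun n hn => hn.1)
  refine ⟨hl0, ?_⟩
  have hexp : Tendsto (fun n => Complex.exp (-((B n : ℝ) : ℂ))) atTop
      (𝓝 (Complex.exp (-((l : ℝ) : ℂ)))) :=
    (Complex.continuous_exp.tendsto _).comp
      ((Complex.continuous_ofReal.tendsto _).comp hBl).neg
  refine (tendsto_iff_of_dist ?_).2 hexp
  rw [Metric.tendsto_atTop']
  intro η hη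
  -- The error is ε B n and eventually B n ≤ l + 1, so this ε makes it at most η/2.
  have hε : 0 < η / (2 * (l + 1)) := by positivity
  obtain ⟨n₀, hn₀⟩ := eventually_atTop.1 ((main _ hε).and (hBl.eventually (ge_mem_nhds (lt_add_one l))))
  refine ⟨n₀, fun n hn => ?_⟩
  obtain ⟨⟨_, h2⟩, h3⟩ := hn₀ n hn.le
  rw [Real.dist_0_eq_abs, abs_of_nonneg dist_nonneg, dist_eq_norm]
  refine h2.trans_lt ?_
  calc η / (2 * (l + 1)) * B n ≤ η / (2 * (l + 1)) * (l + 1) := by gcongr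
    _ = η / 2 := by field_simp
    _ < η := by linarith

end Refinement

/-! ### Riemann sum errors for Hölder functions -/

section RiemannError

variable {f : ℝ → ℝ} {K p : ℝ≥0}

lemma exists_abs_le_of_holderOnWith (hf : HolderOnWith K p f (Ioo 0 1)) :
    ∃ B > 0, ∀ t ∈ Ioo (0 : ℝ) 1, |f t| ≤ B := by
  refine ⟨|f (1 / 2)| + K + 1, by positivity, fun t ht => ?_⟩
  have h1 := hf.dist_le ht (y := 1 / 2) (by norm_num)
  have h2 : dist t (1 / 2) ^ (p : ℝ) ≤ 1 := by
    refine Real.rpow_le_one dist_nonneg ?_ p.2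
    rw [Real.dist_eq, abs_le]
    constructor <;> linarith [ht.1, ht.2]
  have h3 : (K : ℝ) * dist t (1 / 2) ^ (p : ℝ) ≤ K * 1 := by gcongr
  rw [Real.dist_eq] at h1
  have h4 := abs_sub_abs_le_abs_sub (f t) (f (1 / 2))
  linarith

/-- Error of the Riemann sums of a Hölder function. -/
lemma exists_abs_riemann_error_le (hp : 0 < p) (hf : HolderOnWith K p f (Ioo 0 1)) :
    ∃ B : ℝ, ∀ n : ℕ, 0 < n →
      |1 / (n : ℝ) * ∑ k ∈ Finset.Ico 1 n, f (k / n) - ∫ t in (0 : ℝ)..1, f t| ≤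
        K * (n : ℝ) ^ (-(p : ℝ)) + B * (1 / n) := by
  obtain ⟨B, hB, hb⟩ := exists_abs_le_of_holderOnWith hf
  refine ⟨B, fun n hn => ?_⟩
  have hn' : (0 : ℝ) < n := by exact_mod_cast hn
  have hint : Integrable f unitMeasure := by
    refine Integrable.of_bound ((hf.continuousOn hp).aestronglyMeasurable measurableSet_Ioo) B ?_
    filter_upwards [ae_unitMeasure] with t ht using hb t ht
  have floor_facts : ∀ t ∈ Ioo (0 : ℝ) 1, 1 ≤ ⌊(n : ℝ) * t⌋₊ →
      ((⌊(n : ℝ) * t⌋₊ : ℝ) / n ∈ Ioo (0 : ℝ) 1) ∧ dist ((⌊(n : ℝ) * t⌋₊ : ℝ) / n) t ≤ 1 / n := by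
    intro t ht h1
    have e1 : (⌊(n : ℝ) * t⌋₊ : ℝ) / n ≤ t := by
      rw [div_le_iff₀ hn', mul_comm]
      exact Nat.floor_le (by have := ht.1; positivity)
    have e2 : t < (⌊(n : ℝ) * t⌋₊ : ℝ) / n + 1 / n := by
      rw [← add_div, lt_div_iff₀ hn', mul_comm]
      exact Nat.lt_floor_add_one _
    have e3 : (0 : ℝ) < ⌊(n : ℝ) * t⌋₊ := by exact_mod_cast h1
    refine ⟨⟨by positivity, e1.trans_lt ht.2⟩, ?_⟩
    rw [Real.dist_eq, abs_le]
    constructor <;> linarith [one_div_pos.2 hn']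
  have hint2 : Integrable (fun t => if 1 ≤ ⌊(n : ℝ) * t⌋₊ then f ((⌊(n : ℝ) * t⌋₊ : ℝ) / n) else 0)
      unitMeasure := by
    refine Integrable.of_bound (C := B) (Measurable.aestronglyMeasurable ?_) ?_
    · exact (measurable_from_nat (f := fun k : ℕ => if 1 ≤ k then f ((k : ℝ) / n) else 0)).comp
        (Nat.measurable_floor.comp (by fun_prop))
    · filter_upwards [ae_unitMeasure] with t ht
      split_ifs with h1
      · exact hb _ (floor_facts t ht h1).1
      · simpa using hB.le
  rw [sum_Ico_eq_integral_floor (fun k => f (k / n)) hn, intervalIntegral_eq_unitMeasure,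
    ← integral_sub hint2 hint, ← Real.norm_eq_abs]
  -- The cell k = 0 is absent from the sum; there the step function is 0 and the error is at most B
  -- on a set of measure at most 1/n.
  have hE : Integrable (fun t => K * (n : ℝ) ^ (-(p : ℝ)) +
      (Iio (1 / (n : ℝ))).indicator (fun _ => B) t) unitMeasure :=
    (integrable_const _).add ((integrable_const B).indicator measurableSet_Iio)
  refine (norm_integral_le_of_norm_le hE ?_).trans ?_
  · filter_upwards [ae_unitMeasure] with t ht
    by_cases h1 : 1 ≤ ⌊(n : ℝ) * t⌋₊
    · rw [if_pos h1]
      obtain ⟨e1, e2⟩ := floor_facts t ht h1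
      have e3 := hf.dist_le_of_le e1 ht e2
      rw [Real.dist_eq] at e3
      have e4 : (1 / (n : ℝ)) ^ (p : ℝ) = (n : ℝ) ^ (-(p : ℝ)) := by
        rw [one_div, Real.inv_rpow hn'.le, Real.rpow_neg hn'.le]
      rw [e4] at e3
      have e5 : 0 ≤ (Iio (1 / (n : ℝ))).indicator (fun _ => B) t :=
        indicator_nonneg (fun _ _ => hB.le) t
      rw [Real.norm_eq_abs]
      linarith
    · rw [if_neg h1]
      have h2 : (n : ℝ) * t < 1 := by
        by_contra hcon
        exact h1 (Nat.le_floor (by simpa using not_lt.1 hcon))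
      have h3 : t ∈ Iio (1 / (n : ℝ)) := by rw [mem_Iio, lt_div_iff₀ hn', mul_comm]; exact h2
      rw [indicator_of_mem h3, zero_sub, norm_neg]
      have h4 : (0 : ℝ) ≤ K * (n : ℝ) ^ (-(p : ℝ)) := by positivity
      have := hb t ht
      rw [Real.norm_eq_abs]
      linarith
  · rw [integral_add (integrable_const _) ((integrable_const B).indicator measurableSet_Iio),
      integral_indicator_const B measurableSet_Iio]
    simp only [integral_const, probReal_univ, smul_eq_mul, one_mul]
    have : unitMeasure.real (Iio (1 / (n : ℝ))) ≤ 1 / n := by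
      rw [measureReal_def, unitMeasure, Measure.restrict_apply measurableSet_Iio]
      have hsub : Iio (1 / (n : ℝ)) ∩ Ioo 0 1 ⊆ Ioo 0 (1 / (n : ℝ)) := fun x hx => ⟨hx.2.1, hx.1⟩
      have h5 := ENNReal.toReal_mono (by simp) (measure_mono (μ := volume) hsub)
      refine h5.trans ?_
      rw [Real.volume_Ioo, sub_zero, ENNReal.toReal_ofReal (by positivity)]
    nlinarith

/-- A Hölder exponent above 1/2 is what makes n^(-p) negligible against n^(-1/2). -/
lemma tendsto_sqrt_mul_riemann_error (hp : 1 / 2 < p) (hf : HolderOnWith K p f (Ioo 0 1)) :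
    Tendsto (fun n : ℕ => √(n : ℝ) *
      (1 / (n : ℝ) * ∑ k ∈ Finset.Ico 1 n, f (k / n) - ∫ t in (0 : ℝ)..1, f t)) atTop (𝓝 0) := by
  have hp' : (1 : ℝ) / 2 < p := by exact_mod_cast hp
  obtain ⟨B, hB⟩ := exists_abs_riemann_error_le (lt_trans (by norm_num) hp) hf
  have h1 : Tendsto (fun n : ℕ => (K : ℝ) * (n : ℝ) ^ (-((p : ℝ) - 1 / 2)) +
      B * (n : ℝ) ^ (-(1 / 2 : ℝ))) atTop (𝓝 (K * 0 + B * 0)) :=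
    (((tendsto_rpow_neg_atTop (by linarith)).comp tendsto_natCast_atTop_atTop).const_mul _).add
      (((tendsto_rpow_neg_atTop (by norm_num)).comp tendsto_natCast_atTop_atTop).const_mul _)
  simp only [mul_zero, add_zero] at h1
  refine squeeze_zero_norm' ?_ h1
  filter_upwards [eventually_gt_atTop 0] with n hn
  have hn' : (0 : ℝ) < n := by exact_mod_cast hn
  rw [norm_mul, Real.norm_eq_abs, Real.norm_eq_abs, abs_of_nonneg (Real.sqrt_nonneg _)]
  refine (mul_le_mul_of_nonneg_left (hB n hn) (Real.sqrt_nonneg _)).trans (le_of_eq ?_)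
  have e1 : √(n : ℝ) * (n : ℝ) ^ (-(p : ℝ)) = (n : ℝ) ^ (-((p : ℝ) - 1 / 2)) := by
    rw [Real.sqrt_eq_rpow, ← Real.rpow_add hn']; ring_nf
  have e2 : √(n : ℝ) * (1 / n) = (n : ℝ) ^ (-(1 / 2 : ℝ)) := by
    rw [Real.sqrt_eq_rpow, one_div (n : ℝ), ← Real.rpow_neg_one, ← Real.rpow_add hn']; norm_num
  rw [← e1, ← e2]; ring

end RiemannError

/-! ### Normalized covariances on and near the diagonal, and the bias -/

section Expansion

/-- Expansion of the normalized second differences of `R` on the diagonal, and their limit next to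
the diagonal. -/
structure HasDiagonalExpansion (R : ℝ → ℝ → ℝ) (γ : ℝ) (L : ℝ → ℝ) {q : ℕ}
    (g : Fin (q + 1) → ℝ → ℝ) (ν : Fin q → ℝ) (φ gt : ℝ → ℝ) : Prop where
  nu_pos : ∀ i, 0 < ν i
  lip : ∀ i : Fin q, ∃ K : ℝ≥0, LipschitzOnWith K (g i.castSucc) (Ioo 0 1)
  holder : ∃ α K : ℝ≥0, 0 < α ∧ α ≤ 1 / 2 ∧ HolderOnWith K (1 / 2 + α) (g (Fin.last q)) (Ioo 0 1)
  expansion : ∀ ε : ℝ, 0 < ε → ∀ᶠ h in 𝓝[>] (0 : ℝ), ∀ t ∈ Icc h (1 - h),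
    1 / √h * |normDelta R γ L h t t - g 0 t - ∑ i : Fin q, g i.succ t * φ h ^ ν i| ≤ ε
  phi_lim : q ≠ 0 → Tendsto φ (𝓝[>] 0) (𝓝 0)
  bdd : ∃ K : ℝ, ∀ t ∈ Ioo (0 : ℝ) 1, |gt t| ≤ K
  next : ∀ ε : ℝ, 0 < ε → ∀ᶠ h in 𝓝[>] (0 : ℝ), ∀ t ∈ Icc h (1 - 2 * h),
    |normDelta R γ L h (t + h) t - gt t| ≤ ε

variable {R D C : ℝ → ℝ → ℝ} {γ : ℝ} {L : ℝ → ℝ} {q : ℕ} {g : Fin (q + 1) → ℝ → ℝ} {ν : Fin q → ℝ}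
  {φ gt : ℝ → ℝ}

lemma HasDiagonalExpansion.exists_holderOnWith (E : HasDiagonalExpansion R γ L g ν φ gt)
    (i : Fin (q + 1)) : ∃ K p : ℝ≥0, 1 / 2 < p ∧ HolderOnWith K p (g i) (Ioo 0 1) := by
  induction i using Fin.lastCases with
  | last =>
    obtain ⟨α, K, hα, _, h⟩ := E.holder
    exact ⟨K, 1 / 2 + α, lt_add_of_pos_right _ hα, h⟩
  | cast i =>
    obtain ⟨K, h⟩ := E.lip i
    exact ⟨K, 1, by
      rw [div_lt_one two_pos]; exact one_lt_two, holderOnWith_one.2 h⟩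

lemma HasDiagonalExpansion.exists_abs_le (E : HasDiagonalExpansion R γ L g ν φ gt)
    (i : Fin (q + 1)) : ∃ B > 0, ∀ t ∈ Ioo (0 : ℝ) 1, |g i t| ≤ B := by
  obtain ⟨K, p, _, h⟩ := E.exists_holderOnWith i
  exact exists_abs_le_of_holderOnWith h

lemma HasDiagonalExpansion.continuousOn (E : HasDiagonalExpansion R γ L g ν φ gt)
    (i : Fin (q + 1)) : ContinuousOn (g i) (Ioo 0 1) := by
  obtain ⟨K, p, hp, h⟩ := E.exists_holderOnWith i
  exact h.continuousOn (lt_trans (by norm_num) hp)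

lemma HasDiagonalExpansion.tendsto_phi_rpow (E : HasDiagonalExpansion R γ L g ν φ gt) (i : Fin q) :
    Tendsto (fun h => φ h ^ ν i) (𝓝[>] 0) (𝓝 0) := by
  have := (E.phi_lim (by have := i.2; omega)).rpow_const (p := ν i) (Or.inr (E.nu_pos i).le)
  rwa [Real.zero_rpow (E.nu_pos i).ne'] at this

/-- Uniform convergence on the diagonal. -/
lemma HasDiagonalExpansion.diag (E : HasDiagonalExpansion R γ L g ν φ gt) {ε : ℝ} (hε : 0 < ε) :
    ∀ᶠ h in 𝓝[>] (0 : ℝ), ∀ t ∈ Icc h (1 - h), |normDelta R γ L h t t - g 0 t| ≤ ε := by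
  choose B hB hb using fun i : Fin q => E.exists_abs_le i.succ
  have h1 : Tendsto (fun h => ∑ i, B i * |φ h ^ ν i|) (𝓝[>] 0) (𝓝 (∑ i : Fin q, B i * |(0 : ℝ)|)) :=
    tendsto_finsetSum _ fun i _ => (E.tendsto_phi_rpow i).abs.const_mul _
  simp only [abs_zero, mul_zero, Finset.sum_const_zero] at h1
  filter_upwards [E.expansion (ε / 2) (by positivity), h1.eventually (ge_mem_nhds (half_pos hε)),
    Ioo_mem_nhdsGT (zero_lt_one (α := ℝ))] with h e1 e2 e3 t ht
  have hs : 0 < √h := Real.sqrt_pos.2 e3.1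
  have hs1 : √h ≤ 1 := Real.sqrt_le_iff.2 ⟨zero_le_one, by simpa using e3.2.le⟩
  have e4 := e1 t ht
  rw [one_div, inv_mul_le_iff₀ hs] at e4
  have e5 : √h * (ε / 2) ≤ ε / 2 := by nlinarith
  have htm : t ∈ Ioo (0 : ℝ) 1 := ⟨e3.1.trans_le ht.1, by linarith [ht.2, e3.1]⟩
  have e6 : |∑ i : Fin q, g i.succ t * φ h ^ ν i| ≤ ∑ i, B i * |φ h ^ ν i| := by
    refine (Finset.abs_sum_le_sum_abs _ _).trans (Finset.sum_le_sum fun i _ => ?_)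
    rw [abs_mul]
    exact mul_le_mul_of_nonneg_right (hb i t htm) (abs_nonneg _)
  calc |normDelta R γ L h t t - g 0 t| = |(normDelta R γ L h t t - g 0 t -
        ∑ i : Fin q, g i.succ t * φ h ^ ν i) + ∑ i : Fin q, g i.succ t * φ h ^ ν i| := by
        rw [sub_add_cancel]
    _ ≤ _ := abs_add_le _ _
    _ ≤ ε := by linarith

lemma continuousAt_normDelta_next (hR : ContinuousOn (fun p : ℝ × ℝ => R p.1 p.2) (Icc 0 1 ×ˢ Icc 0 1))
    {h t : ℝ} (hh : 0 < h) (ht : t ∈ Ioo h (1 - 2 * h)) :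
    ContinuousAt (fun t => normDelta R γ L h (t + h) t) t := by
  have key : ∀ a b : ℝ, t + a ∈ Ioo (0 : ℝ) 1 → t + b ∈ Ioo (0 : ℝ) 1 →
      ContinuousAt (fun t => R (t + a) (t + b)) t := by
    intro a b ha hb
    have h1 : ContinuousAt (fun p : ℝ × ℝ => R p.1 p.2) (t + a, t + b) :=
      hR.continuousAt (prod_mem_nhds (Icc_mem_nhds ha.1 ha.2) (Icc_mem_nhds hb.1 hb.2))
    exact ContinuousAt.comp (f := fun t : ℝ => (t + a, t + b)) h1 (by fun_prop)
  have mem : ∀ a, -h ≤ a → a ≤ 2 * h → t + a ∈ Ioo (0 : ℝ) 1 := fun a h1 h2 =>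
    ⟨by linarith [ht.1], by linarith [ht.2]⟩
  have e : (fun t => normDelta R γ L h (t + h) t) = fun t =>
      ((R (t + 2 * h) (t + h) + R (t + 2 * h) (t + -h) - 2 * R (t + 2 * h) (t + 0)) +
        (R (t + 0) (t + h) + R (t + 0) (t + -h) - 2 * R (t + 0) (t + 0)) -
        2 * (R (t + h) (t + h) + R (t + h) (t + -h) - 2 * R (t + h) (t + 0))) /
        (h ^ (2 - γ) * L h) := by
    funext t
    simp only [normDelta, delta₁, delta₂]
    rw [show t + h + h = t + 2 * h by ring, show t + h - h = t by ring]
    simp only [add_zero, sub_eq_add_neg]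
  rw [e]
  have k := fun a b h1 h2 h3 h4 => key a b (mem a h1 h2) (mem b h3 h4)
  refine ContinuousAt.div_const (((((k _ _ ?_ ?_ ?_ ?_).add (k _ _ ?_ ?_ ?_ ?_)).sub
    ((k _ _ ?_ ?_ ?_ ?_).const_mul 2)).add
    (((k _ _ ?_ ?_ ?_ ?_).add (k _ _ ?_ ?_ ?_ ?_)).sub ((k _ _ ?_ ?_ ?_ ?_).const_mul 2))).sub
    ((((k _ _ ?_ ?_ ?_ ?_).add (k _ _ ?_ ?_ ?_ ?_)).sub
      ((k _ _ ?_ ?_ ?_ ?_).const_mul 2)).const_mul 2)) _ <;> linarith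

/-- Only boundedness of `gt` is assumed; continuity, needed for Riemann sums and measurability, is
inherited from the locally uniform approximation by normalized increments, which are continuous in t
for fixed h. -/
lemma HasDiagonalExpansion.continuousOn_next (E : HasDiagonalExpansion R γ L g ν φ gt)
    (hR : ContinuousOn (fun p : ℝ × ℝ => R p.1 p.2) (Icc 0 1 ×ˢ Icc 0 1)) :
    ContinuousOn gt (Ioo 0 1) := by
  intro t ht
  refine ContinuousAt.continuousWithinAt ?_
  refine continuousAt_of_locally_uniform_approx_of_continuousAt fun u hu => ?_
  obtain ⟨ε, hε, hεu⟩ := Metric.mem_uniformity_dist.1 hu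
  have hpos : 0 < min t ((1 - t) / 2) := lt_min ht.1 (by linarith [ht.2])
  obtain ⟨h, h1, h2⟩ := ((E.next (ε / 2) (by positivity)).and (Ioo_mem_nhdsGT hpos)).exists
  have h3 := lt_min_iff.1 h2.2
  have hmem : t ∈ Ioo h (1 - 2 * h) := ⟨h3.1, by linarith [h3.2]⟩
  refine ⟨Ioo h (1 - 2 * h), Ioo_mem_nhds hmem.1 hmem.2, _,
    continuousAt_normDelta_next (γ := γ) (L := L) hR h2.1 hmem, fun y hy => hεu ?_⟩
  rw [dist_comm, Real.dist_eq]
  exact (h1 y ⟨hy.1.le, hy.2.le⟩).trans_lt (by linarith)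

lemma tendsto_one_div_nhdsGT_zero {N : ℕ → ℕ} (hN : Tendsto N atTop atTop) :
    Tendsto (fun n => 1 / (N n : ℝ)) atTop (𝓝[>] 0) := by
  refine tendsto_nhdsWithin_iff.2 ⟨tendsto_one_div_atTop_nhds_zero_nat.comp hN, ?_⟩
  filter_upwards [hN.eventually_gt_atTop 0] with n hn
  have hn' : (0 : ℝ) < N n := by exact_mod_cast hn
  exact one_div_pos.2 hn'

lemma div_mem_Icc {N k : ℕ} (hk : k ∈ Finset.Ico 1 N) :
    (k : ℝ) / N ∈ Icc (1 / (N : ℝ)) (1 - 1 / N) := by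
  have hk' := Finset.mem_Ico.1 hk
  have hN : (0 : ℝ) < N := by exact_mod_cast (by omega : 0 < N)
  have h1 : (1 : ℝ) ≤ k := by exact_mod_cast hk'.1
  have h2 : (k : ℝ) + 1 ≤ N := by exact_mod_cast hk'.2
  refine ⟨by gcongr, ?_⟩
  rw [le_sub_iff_add_le, ← add_div, div_le_one hN]
  exact h2

lemma div_mem_Ioo {N k : ℕ} (hk : k ∈ Finset.Ico 1 N) : (k : ℝ) / N ∈ Ioo (0 : ℝ) 1 := by
  have hk' := Finset.mem_Ico.1 hk
  have hN : (0 : ℝ) < 1 / N := one_div_pos.2 (by exact_mod_cast (by omega : 0 < N))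
  have := div_mem_Icc hk
  exact ⟨by linarith [this.1], by linarith [this.2]⟩

/-- Normalized covariances of the second order increments of step `1 / N`. -/
def entries (R : ℝ → ℝ → ℝ) (γ : ℝ) (L : ℝ → ℝ) (N i j : ℕ) : ℝ :=
  normDelta R γ L (1 / (N : ℝ)) ((i : ℝ) / N) ((j : ℝ) / N)

lemma hasDiagonalLimit_entries (H : IsSingularKernel R D C γ L)
    (E : HasDiagonalExpansion R γ L g ν φ gt) :
    HasDiagonalLimit (entries R γ L) (diagLimit γ C (g 0) gt) := by
  intro t ht l N k hN hk
  have hh := tendsto_one_div_nhdsGT_zero hN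
  have hh0 : Tendsto (fun n => 1 / (N n : ℝ)) atTop (𝓝 0) := hh.mono_right nhdsWithin_le_nhds
  have hlow : ∀ᶠ n in atTop, 1 / (N n : ℝ) ≤ (k n : ℝ) / N n := by
    filter_upwards [hk.eventually (lt_mem_nhds (show t / 2 < t by linarith [ht.1])),
      hh0.eventually (gt_mem_nhds (half_pos ht.1))] with n h1 h2
    linarith
  have hupp : ∀ᶠ n in atTop, (k n : ℝ) / N n ≤ 1 - 2 * (1 / (N n : ℝ)) := by
    filter_upwards [hk.eventually (gt_mem_nhds (show t < (1 + t) / 2 by linarith [ht.2])),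
      hh0.eventually (gt_mem_nhds (show 0 < (1 - t) / 4 by linarith [ht.2]))] with n h1 h2
    linarith
  have hpos : ∀ᶠ n in atTop, 0 < 1 / (N n : ℝ) := hh.eventually self_mem_nhdsWithin
  match l with
  | 0 =>
    have h1 : Tendsto (fun n => g 0 ((k n : ℝ) / N n)) atTop (𝓝 (g 0 t)) :=
      ((E.continuousOn 0).continuousAt (Ioo_mem_nhds ht.1 ht.2)).tendsto.comp hk
    refine (tendsto_iff_of_dist ?_).1 h1
    refine Metric.tendsto_nhds.2 fun ε hε => ?_
    filter_upwards [hh.eventually (E.diag (half_pos hε)), hlow, hupp, hpos] with n h2 h3 h4 h5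
    have h6 := h2 _ ⟨h3, by linarith⟩
    rw [Real.dist_0_eq_abs, abs_of_nonneg dist_nonneg, dist_comm, Real.dist_eq]
    exact lt_of_le_of_lt h6 (by linarith)
  | 1 =>
    have h1 : Tendsto (fun n => gt ((k n : ℝ) / N n)) atTop (𝓝 (gt t)) :=
      ((E.continuousOn_next H.cont).continuousAt (Ioo_mem_nhds ht.1 ht.2)).tendsto.comp hk
    refine (tendsto_iff_of_dist ?_).1 h1
    refine Metric.tendsto_nhds.2 fun ε hε => ?_
    filter_upwards [hh.eventually (E.next _ (half_pos hε)), hlow, hupp] with n h2 h3 h4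
    have h6 := h2 _ ⟨h3, h4⟩
    rw [Real.dist_0_eq_abs, abs_of_nonneg dist_nonneg, dist_comm, Real.dist_eq]
    rw [← add_div] at h6
    simp only [entries, Nat.cast_add, Nat.cast_one]
    exact lt_of_le_of_lt h6 (by linarith)
  | l + 2 =>
    refine (H.tendsto_normDelta (l := l + 2) (by omega) ht hh hk).congr fun n => ?_
    simp only [entries]
    congr 1
    push_cast
    ring

lemma isDecayingArray_entries (H : IsSingularKernel R D C γ L)
    (E : HasDiagonalExpansion R γ L g ν φ gt)
    (hpsd : ∀ N, IsPSDOn (Finset.Ico 1 N) (entries R γ L N)) : IsDecayingArray (entries R γ L) where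
  psd := Eventually.of_forall hpsd
  diag := by
    obtain ⟨B, _, hb⟩ := E.exists_abs_le 0
    refine ⟨B + 1, ?_⟩
    filter_upwards [(tendsto_one_div_nhdsGT_zero tendsto_id).eventually (E.diag one_pos)]
      with N hN i hi
    have h1 := hN _ (div_mem_Icc hi)
    have h2 := hb _ (div_mem_Ioo hi)
    have h3 := (abs_le.1 h1).2
    have h4 := (abs_le.1 h2).2
    simp only [id] at h3
    unfold entries
    linarith
  decay := by
    intro ε hε
    obtain ⟨K, hK, h₀, hh₀, h⟩ := H.exists_normDelta_le hε
    refine ⟨K, hK, ?_⟩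
    have hh := tendsto_one_div_nhdsGT_zero tendsto_id
    filter_upwards [hh.eventually self_mem_nhdsWithin,
      (hh.mono_right nhdsWithin_le_nhds).eventually (ge_mem_nhds hh₀.1), eventually_gt_atTop 0]
      with N h1 h2 h3 j l hj hl hjl hε'
    have hN : (0 : ℝ) < N := by exact_mod_cast h3
    have hj' : (1 : ℝ) ≤ j := by exact_mod_cast hj
    have hjl' : (j : ℝ) + l + 1 ≤ N := by exact_mod_cast hjl
    have := h (1 / (N : ℝ)) h1 h2 (l : ℝ) ((j : ℝ) / N) (by exact_mod_cast hl)
      (by rw [← sub_div]; exact div_nonneg (by linarith) hN.le)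
      (by rw [mul_one_div, ← add_div, ← add_div, div_le_one hN]; exact hjl')
      (by rw [mul_one_div, div_le_iff₀ hN]; exact hε')
    rw [mul_one_div, ← add_div] at this
    simpa only [entries, Nat.cast_add] using this

lemma intervalIntegrable_diagLimit_mul (H : IsSingularKernel R D C γ L)
    (E : HasDiagonalExpansion R γ L g ν φ gt) (i j : ℕ) :
    IntervalIntegrable (fun t => diagLimit γ C (g 0) gt t i * diagLimit γ C (g 0) gt t j)
      volume 0 1 := by
  have key : ∀ l : ℕ, ContinuousOn (fun t => diagLimit γ C (g 0) gt t l) (Ioo 0 1) ∧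
      ∃ B, ∀ t ∈ Ioo (0 : ℝ) 1, |diagLimit γ C (g 0) gt t l| ≤ B := by
    intro l
    match l with
    | 0 => exact ⟨E.continuousOn 0, (E.exists_abs_le 0).imp fun B h => h.2⟩
    | 1 => exact ⟨E.continuousOn_next H.cont, E.bdd⟩
    | l + 2 =>
      have e : ∀ t ∈ Ioo (0 : ℝ) 1, extTriangle C (t, t) = C t t := fun t ht =>
        extTriangle_eq C ht.1.le le_rfl ht.2.le
      constructor
      · refine ContinuousOn.mul ?_ continuousOn_const
        have h1 : ContinuousOn (fun t : ℝ => extTriangle C (t, t)) (Ioo 0 1) :=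
          (H.continuous_extTriangle.comp (by fun_prop : Continuous fun t : ℝ => (t, t))).continuousOn
        exact h1.congr fun t ht => (e t ht).symm
      · obtain ⟨K, _, hK⟩ := H.exists_abs_extTriangle_le
        refine ⟨K * |rho γ (l + 2)|, fun t ht => ?_⟩
        simp only [diagLimit, abs_mul]
        rw [← e t ht]
        exact mul_le_mul_of_nonneg_right (hK _) (abs_nonneg _)
  obtain ⟨ci, Bi, hi⟩ := key i
  obtain ⟨cj, Bj, hj⟩ := key j
  rw [intervalIntegrable_iff_unitMeasure]
  refine Integrable.of_bound ((ci.mul cj).aestronglyMeasurable measurableSet_Ioo) (Bi * Bj) ?_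
  filter_upwards [ae_unitMeasure] with t ht
  rw [norm_mul, Real.norm_eq_abs, Real.norm_eq_abs]
  exact mul_le_mul (hi t ht) (hj t ht) (abs_nonneg _) ((abs_nonneg _).trans (hi t ht))

/-- The bias of the normalized quadratic variation. -/
lemma HasDiagonalExpansion.tendsto_bias (E : HasDiagonalExpansion R γ L g ν φ gt) :
    Tendsto (fun N : ℕ => √(N : ℝ) * (1 / (N : ℝ) * ∑ k ∈ Finset.Ico 1 N, entries R γ L N k k -
      (∫ x in (0 : ℝ)..1, g 0 x) -
      ∑ i : Fin q, (∫ x in (0 : ℝ)..1, g i.succ x) * φ (1 / (N : ℝ)) ^ ν i)) atTop (𝓝 0) := by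
  have hh := tendsto_one_div_nhdsGT_zero tendsto_id
  have riem : ∀ i, Tendsto (fun N : ℕ => √(N : ℝ) *
      (1 / (N : ℝ) * ∑ k ∈ Finset.Ico 1 N, g i (k / N) - ∫ t in (0 : ℝ)..1, g i t))
      atTop (𝓝 0) := fun i => by
    obtain ⟨K, p, hp, h⟩ := E.exists_holderOnWith i
    exact tendsto_sqrt_mul_riemann_error hp h
  -- The expansion bounds each term by a small multiple of 1/√N, and averaging over k preserves
  -- this.
  have h1 : Tendsto (fun N : ℕ => √(N : ℝ) * (1 / (N : ℝ) * ∑ k ∈ Finset.Ico 1 N,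
      (entries R γ L N k k - g 0 (k / N) -
        ∑ i : Fin q, g i.succ (k / N) * φ (1 / (N : ℝ)) ^ ν i))) atTop (𝓝 0) := by
    refine Metric.tendsto_nhds.2 fun ε hε => ?_
    filter_upwards [hh.eventually (E.expansion (ε / 2) (half_pos hε)), eventually_gt_atTop 0]
      with N h2 h3
    have hN : (0 : ℝ) < N := by exact_mod_cast h3
    have h4 : ∀ k ∈ Finset.Ico 1 N, |entries R γ L N k k - g 0 (k / N) -
        ∑ i : Fin q, g i.succ (k / N) * φ (1 / (N : ℝ)) ^ ν i| ≤ ε / 2 / √(N : ℝ) := by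
      intro k hk
      have := h2 _ (div_mem_Icc hk)
      simp only [id] at this
      rw [Real.sqrt_div zero_le_one, Real.sqrt_one, one_div_one_div, mul_comm] at this
      rw [le_div_iff₀ (Real.sqrt_pos.2 hN)]
      exact this
    rw [Real.dist_eq, sub_zero, abs_mul, abs_mul, abs_of_nonneg (Real.sqrt_nonneg _),
      abs_of_pos (one_div_pos.2 hN)]
    have h5 : |∑ k ∈ Finset.Ico 1 N, (entries R γ L N k k - g 0 (k / N) -
        ∑ i : Fin q, g i.succ (k / N) * φ (1 / (N : ℝ)) ^ ν i)| ≤ N * (ε / 2 / √(N : ℝ)) := by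
      refine (Finset.abs_sum_le_sum_abs _ _).trans ((Finset.sum_le_card_nsmul _ _ _ h4).trans ?_)
      rw [Nat.card_Ico, nsmul_eq_mul]
      have : ((N - 1 : ℕ) : ℝ) ≤ N := by exact_mod_cast Nat.sub_le N 1
      gcongr
    have hs := Real.sqrt_pos.2 hN
    calc √(N : ℝ) * (1 / N * |∑ k ∈ Finset.Ico 1 N, (entries R γ L N k k - g 0 (k / N) -
        ∑ i : Fin q, g i.succ (k / N) * φ (1 / (N : ℝ)) ^ ν i)|)
        ≤ √(N : ℝ) * (1 / N * (N * (ε / 2 / √(N : ℝ)))) := by gcongr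
      _ = ε / 2 := by rw [← mul_assoc (1 / (N : ℝ)), one_div_mul_cancel hN.ne', one_mul, mul_div_cancel₀ _ hs.ne']
      _ < ε := by linarith
  have h2 : Tendsto (fun N : ℕ => ∑ i : Fin q, √(N : ℝ) *
      (1 / (N : ℝ) * ∑ k ∈ Finset.Ico 1 N, g i.succ (k / N) - ∫ t in (0 : ℝ)..1, g i.succ t) *
        φ (1 / (N : ℝ)) ^ ν i) atTop (𝓝 (∑ _i : Fin q, (0 : ℝ) * 0)) :=
    tendsto_finsetSum _ fun i _ => (riem i.succ).mul ((E.tendsto_phi_rpow i).comp hh)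
  simp only [mul_zero, Finset.sum_const_zero] at h2
  have h3 := (h1.add (riem 0)).add h2
  simp only [add_zero] at h3
  refine h3.congr fun N => ?_
  have e1 : ∑ k ∈ Finset.Ico 1 N, ∑ i : Fin q, g i.succ ((k : ℝ) / N) * φ (1 / (N : ℝ)) ^ ν i =
      ∑ i : Fin q, (∑ k ∈ Finset.Ico 1 N, g i.succ ((k : ℝ) / N)) * φ (1 / (N : ℝ)) ^ ν i := by
    rw [Finset.sum_comm]
    exact Finset.sum_congr rfl fun i _ => (Finset.sum_mul _ _ _).symm
  have e2 : ∑ i : Fin q, √(N : ℝ) *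
      (1 / (N : ℝ) * ∑ k ∈ Finset.Ico 1 N, g i.succ (k / N) - ∫ t in (0 : ℝ)..1, g i.succ t) *
        φ (1 / (N : ℝ)) ^ ν i =
      √(N : ℝ) * (1 / (N : ℝ) * (∑ i : Fin q, (∑ k ∈ Finset.Ico 1 N, g i.succ ((k : ℝ) / N)) *
        φ (1 / (N : ℝ)) ^ ν i) -
        ∑ i : Fin q, (∫ x in (0 : ℝ)..1, g i.succ x) * φ (1 / (N : ℝ)) ^ ν i) := by
    rw [Finset.mul_sum, ← Finset.sum_sub_distrib, Finset.mul_sum]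
    exact Finset.sum_congr rfl fun i _ => by ring
  rw [e2, Finset.sum_sub_distrib, Finset.sum_sub_distrib, e1]
  ring

end Expansion

/-! ### Second-order increments and their normalization -/

section Increments

variable {Ω : Type*} {γ : ℝ} {L : ℝ → ℝ}

/-- The second order increments of step `1 / N`. -/
def incr (X : ℝ → Ω → ℝ) (N k : ℕ) (ω : Ω) : ℝ :=
  X (((k : ℝ) + 1) / N) ω + X (((k : ℝ) - 1) / N) ω - 2 * X ((k : ℝ) / N) ω

/-- The order of magnitude of the variance of the increments of step `h`. -/
def varScale (γ : ℝ) (L : ℝ → ℝ) (h : ℝ) : ℝ := h ^ (2 - γ) * L h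

/-- The normalized second order increments. -/
def normIncr (X : ℝ → Ω → ℝ) (γ : ℝ) (L : ℝ → ℝ) (N k : ℕ) (ω : Ω) : ℝ :=
  (√(varScale γ L (1 / (N : ℝ))))⁻¹ * incr X N k ω

lemma grid_mem {N k : ℕ} (hk : k ∈ Finset.Ico 1 N) :
    ((k : ℝ) + 1) / N ∈ Icc (0 : ℝ) 1 ∧ ((k : ℝ) - 1) / N ∈ Icc (0 : ℝ) 1 ∧
      (k : ℝ) / N ∈ Icc (0 : ℝ) 1 := by
  have h := div_mem_Icc hk
  have h0 := div_mem_Ioo hk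
  rw [add_div, sub_div]
  refine ⟨⟨?_, ?_⟩, ⟨?_, ?_⟩, ⟨?_, ?_⟩⟩ <;> linarith [h.1, h.2, h0.1, h0.2, one_div_nonneg.2 (Nat.cast_nonneg (α := ℝ) N)]

lemma one_div_mem_Ioo {N k : ℕ} (hk : k ∈ Finset.Ico 1 N) : 1 / (N : ℝ) ∈ Ioo (0 : ℝ) 1 := by
  have := Finset.mem_Ico.1 hk
  have hN : (1 : ℝ) < N := by exact_mod_cast (by omega : 1 < N)
  exact ⟨by positivity, by rw [div_lt_one (by linarith)]; exact hN⟩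

lemma varScale_pos (hL : IsSlowlyVarying L) {h : ℝ} (hh : h ∈ Ioo (0 : ℝ) 1) :
    0 < varScale γ L h :=
  mul_pos (Real.rpow_pos_of_pos hh.1 _) (hL.pos h hh)

/-- In terms of the shift z by one fine step, this is (z² - 1)² = (z + 1)² (z - 1)². -/
lemma incr_refine (X : ℝ → Ω → ℝ) {n k : ℕ} (hk : 1 ≤ k) (hn : 0 < n) (ω : Ω) :
    incr X n k ω = incr X (2 * n) (2 * k + 1) ω + 2 * incr X (2 * n) (2 * k) ω +
      incr X (2 * n) (2 * k - 1) ω := by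
  have hn' : (n : ℝ) ≠ 0 := by exact_mod_cast hn.ne'
  have e1 : ((k : ℝ) + 1) / n = ((2 * k + 1 : ℝ) + 1) / (2 * n) := by field_simp; ring
  have e2 : ((k : ℝ) - 1) / n = ((2 * k - 1 : ℝ) - 1) / (2 * n) := by field_simp; ring
  have e3 : (k : ℝ) / n = (2 * k : ℝ) / (2 * n) := by field_simp
  have e4 : (k : ℝ) / n = ((2 * k + 1 : ℝ) - 1) / (2 * n) := by field_simp; ring
  have e5 : (k : ℝ) / n = ((2 * k - 1 : ℝ) + 1) / (2 * n) := by field_simp; ring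
  simp only [incr]
  push_cast [Nat.cast_sub (show 1 ≤ 2 * k by omega)]
  rw [← e1, ← e2, ← e3, ← e4, ← e5]
  ring

/-- The factor N^(1-γ)/L(1/N) is 1/N divided by the variance scale, so the variation becomes a plain
average. -/
lemma variation_eq_sum (X : ℝ → Ω → ℝ) (hL : IsSlowlyVarying L) (N : ℕ) (ω : Ω) :
    (N : ℝ) ^ (1 - γ) / L (1 / (N : ℝ)) * V X N ω =
      1 / (N : ℝ) * ∑ k ∈ Finset.Ico 1 N, normIncr X γ L N k ω ^ 2 := by
  rw [V, Finset.mul_sum, Finset.mul_sum]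
  refine Finset.sum_congr rfl fun k hk => ?_
  have hm := one_div_mem_Ioo hk
  have hN : (0 : ℝ) < N := one_div_pos.1 hm.1
  have hl := hL.pos _ hm
  rw [normIncr, mul_pow, inv_pow, Real.sq_sqrt (varScale_pos hL hm).le, varScale, incr]
  have e1 : (1 / (N : ℝ)) ^ (2 - γ) = ((N : ℝ) ^ (1 - γ) * N)⁻¹ := by
    rw [one_div, Real.inv_rpow hN.le, ← Real.rpow_add_one hN.ne']; ring_nf
  rw [e1]
  have h3 := Real.rpow_pos_of_pos hN (1 - γ)
  field_simp

end Increments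

/-! ### Covariances and scaling of the Gaussian increments -/

section GaussianIncrements

variable {Ω : Type*} [MeasurableSpace Ω] {P : Measure Ω} {X : ℝ → Ω → ℝ} {R : ℝ → ℝ → ℝ} {γ : ℝ}
  {L : ℝ → ℝ}

lemma isGaussianProcess_normIncr (hX : IsGaussianProcess (fun t : Icc (0 : ℝ) 1 => X t) P)
    (γ : ℝ) (L : ℝ → ℝ) :
    IsGaussianProcess (fun p : {p : ℕ × ℕ // p.2 ∈ Finset.Ico 1 p.1} =>
      normIncr X γ L p.1.1 p.1.2) P := by
  classical
  refine hX.of_isGaussianProcess fun p => ?_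
  obtain ⟨h1, h2, h3⟩ := grid_mem p.2
  refine ⟨{⟨_, h1⟩, ⟨_, h2⟩, ⟨_, h3⟩},
    (√(varScale γ L (1 / (p.1.1 : ℝ))))⁻¹ • (ContinuousLinearMap.proj ⟨⟨_, h1⟩, by simp⟩ +
      ContinuousLinearMap.proj ⟨⟨_, h2⟩, by simp⟩ -
      (2 : ℝ) • ContinuousLinearMap.proj ⟨⟨_, h3⟩, by simp⟩), fun ω => ?_⟩
  simp [normIncr, incr]

lemma covariance_incr [IsProbabilityMeasure P]
    (hX : ∀ t ∈ Icc (0 : ℝ) 1, MemLp (X t) 2 P)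
    (hR : ∀ s ∈ Icc (0 : ℝ) 1, ∀ t ∈ Icc (0 : ℝ) 1, R s t = cov[X s, X t; P]) {N i j : ℕ}
    (hi : i ∈ Finset.Ico 1 N) (hj : j ∈ Finset.Ico 1 N) :
    cov[incr X N i, incr X N j; P] =
      delta₁ (1 / (N : ℝ)) (delta₂ (1 / (N : ℝ)) R) ((i : ℝ) / N) ((j : ℝ) / N) := by
  obtain ⟨i1, i2, i3⟩ := grid_mem hi
  obtain ⟨j1, j2, j3⟩ := grid_mem hj
  have right : ∀ s ∈ Icc (0 : ℝ) 1, cov[X s, incr X N j; P] =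
      delta₂ (1 / (N : ℝ)) R s ((j : ℝ) / N) := by
    intro s hs
    have e : incr X N j = X (((j : ℝ) + 1) / N) + X (((j : ℝ) - 1) / N) -
      fun ω => 2 * X ((j : ℝ) / N) ω := rfl
    rw [e, covariance_sub_right (hX s hs) ((hX _ j1).add (hX _ j2)) ((hX _ j3).const_mul 2),
      covariance_add_right (hX s hs) (hX _ j1) (hX _ j2), covariance_const_mul_right, delta₂,
      hR s hs _ j3, ← add_div, ← sub_div, hR s hs _ j1, hR s hs _ j2]
  have hY : MemLp (incr X N j) 2 P := ((hX _ j1).add (hX _ j2)).sub ((hX _ j3).const_mul 2)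
  have e : incr X N i = X (((i : ℝ) + 1) / N) + X (((i : ℝ) - 1) / N) -
    fun ω => 2 * X ((i : ℝ) / N) ω := rfl
  rw [e, covariance_sub_left ((hX _ i1).add (hX _ i2)) ((hX _ i3).const_mul 2) hY,
    covariance_add_left (hX _ i1) (hX _ i2) hY, covariance_const_mul_left, delta₁,
    right _ i1, right _ i2, right _ i3, ← add_div, ← sub_div]

/-- The factor relating the normalized increments of steps `1 / n` and `1 / (2n)`. -/
def scaleFactor (γ : ℝ) (L : ℝ → ℝ) (n : ℕ) : ℝ :=
  (√(varScale γ L (1 / (n : ℝ))))⁻¹ * √(varScale γ L (1 / ((2 * n : ℕ) : ℝ)))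

lemma isRefiningArray_normIncr [IsProbabilityMeasure P]
    (hX : IsGaussianProcess (fun t : Icc (0 : ℝ) 1 => X t) P)
    (hcent : ∀ t ∈ Icc (0 : ℝ) 1, ∫ ω, X t ω ∂P = 0)
    (hR : ∀ s ∈ Icc (0 : ℝ) 1, ∀ t ∈ Icc (0 : ℝ) 1, R s t = cov[X s, X t; P])
    (hL : IsSlowlyVarying L) :
    IsRefiningArray (normIncr X γ L) P (entries R γ L) (scaleFactor γ L) := by
  have hL2 : ∀ t ∈ Icc (0 : ℝ) 1, MemLp (X t) 2 P := fun t ht =>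
    (hX.hasGaussianLaw_eval ⟨t, ht⟩).memLp_two
  refine ⟨fun n => ?_, fun N k hk => ?_, fun N i hi j hj => ?_, fun n k hk => ?_⟩
  · have h1 := ((isGaussianProcess_normIncr hX γ L).comp_right
      (fun p : Finset.Ico 1 n ⊕ Finset.Ico 1 (2 * n) =>
        match p with
        | .inl k => (⟨(n, k), k.2⟩ : {p : ℕ × ℕ // p.2 ∈ Finset.Ico 1 p.1})
        | .inr i => ⟨(2 * n, i), i.2⟩)).hasGaussianLaw Finset.univ
    have h2 := h1.map (ContinuousLinearMap.pi fun p =>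
      ContinuousLinearMap.proj (⟨p, Finset.mem_univ p⟩ : (Finset.univ : Finset _)))
    refine h2.congr (Eventually.of_forall fun ω => ?_)
    funext p
    rcases p with p | p <;> rfl
  · obtain ⟨h1, h2, h3⟩ := grid_mem hk
    have i : ∀ t ∈ Icc (0 : ℝ) 1, Integrable (X t) P := fun t ht => (hL2 t ht).integrable (by norm_num)
    simp only [normIncr, incr]
    have i12 : Integrable (fun ω => X (((k : ℝ) + 1) / N) ω + X (((k : ℝ) - 1) / N) ω) P :=
      (i _ h1).add (i _ h2)
    rw [integral_const_mul, integral_sub i12 ((i _ h3).const_mul 2),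
      integral_add (i _ h1) (i _ h2), integral_const_mul, hcent _ h1, hcent _ h2, hcent _ h3]
    ring
  · have hpos := varScale_pos (γ := γ) hL (one_div_mem_Ioo hi)
    unfold normIncr
    rw [covariance_const_mul_left, covariance_const_mul_right, covariance_incr hL2 hR hi hj, entries,
      normDelta, ← varScale, ← mul_assoc, ← mul_inv, Real.mul_self_sqrt hpos.le]
    rw [inv_mul_eq_div]
  · have hk' := Finset.mem_Ico.1 hk
    have hk2 : 2 * k ∈ Finset.Ico 1 (2 * n) := by rw [Finset.mem_Ico]; omega
    have hpos := Real.sqrt_pos.2 (varScale_pos (γ := γ) hL (one_div_mem_Ioo hk2))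
    funext ω
    simp only [normIncr, scaleFactor]
    rw [incr_refine X hk'.1 (by omega)]
    field_simp

/-- The square is 2^(γ-2) L(h/2)/L(h) with h = 1/n, and slow variation removes the last ratio. -/
lemma tendsto_scaleFactor_sq (hL : IsSlowlyVarying L) :
    Tendsto (fun n => scaleFactor γ L n ^ 2) atTop (𝓝 ((2 : ℝ) ^ (γ - 2))) := by
  have h1 : Tendsto (fun n : ℕ => (2 : ℝ) ^ (γ - 2) * (L (1 / 2 * (1 / (n : ℝ))) / L (1 / (n : ℝ))))
      atTop (𝓝 ((2 : ℝ) ^ (γ - 2) * 1)) :=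
    ((hL.tendsto (1 / 2) (by norm_num)).comp (tendsto_one_div_nhdsGT_zero tendsto_id)).const_mul _
  rw [mul_one] at h1
  refine h1.congr' ?_
  filter_upwards [eventually_ge_atTop 2] with n hn
  have hm : 1 / (n : ℝ) ∈ Ioo (0 : ℝ) 1 := one_div_mem_Ioo (k := 1) (by rw [Finset.mem_Ico]; omega)
  have hm2 : 1 / ((2 * n : ℕ) : ℝ) ∈ Ioo (0 : ℝ) 1 :=
    one_div_mem_Ioo (k := 1) (by rw [Finset.mem_Ico]; omega)
  have e : 1 / ((2 * n : ℕ) : ℝ) = 1 / 2 * (1 / (n : ℝ)) := by push_cast; field_simp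
  rw [scaleFactor, mul_pow, inv_pow, Real.sq_sqrt (varScale_pos hL hm).le,
    Real.sq_sqrt (varScale_pos hL hm2).le, e, varScale, varScale,
    Real.mul_rpow (by norm_num) hm.1.le]
  have e2 : (1 / 2 : ℝ) ^ (2 - γ) = 2 ^ (γ - 2) := by
    rw [one_div, Real.inv_rpow (by norm_num), ← Real.rpow_neg (by norm_num)]; ring_nf
  rw [e2]
  have h3 := Real.rpow_pos_of_pos hm.1 (2 - γ)
  have h4 := hL.pos _ hm
  field_simp

end GaussianIncrements

/-! ### The limit theorem -/

section Limit

variable {R D C : ℝ → ℝ → ℝ} {γ : ℝ} {L : ℝ → ℝ} {q : ℕ} {g : Fin (q + 1) → ℝ → ℝ} {ν : Fin q → ℝ}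
  {φ gt : ℝ → ℝ}

lemma tendsto_sqSum_entries (H : IsSingularKernel R D C γ L)
    (E : HasDiagonalExpansion R γ L g ν φ gt) (hc : IsDecayingArray (entries R γ L)) :
    Tendsto (sqSum (entries R γ L)) atTop (𝓝 (sigmaSq γ C (g 0) gt / 2)) := by
  refine ((hasDiagonalLimit_entries H E).tendsto_sum_combArray_sq hc one_pos weightOne
    (hasSum_combLimit_weightOne H.mem) (lagRange 1)
    (eventually_Icc_subset_lagRange one_pos)).congr fun n => ?_
  rw [sum_combArray_weightOne, sqSum]

lemma tendsto_crossSqSum_entries (H : IsSingularKernel R D C γ L)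
    (E : HasDiagonalExpansion R γ L g ν φ gt) (hc : IsDecayingArray (entries R γ L)) :
    Tendsto (crossSqSum (entries R γ L)) atTop (𝓝 (sigmaStarSq γ C (g 0) gt)) := by
  refine ((hasDiagonalLimit_entries H E).tendsto_sum_combArray_sq hc two_pos weightTwo
    (hasSum_combLimit_weightTwo H.mem (intervalIntegrable_diagLimit_mul H E)) (lagRange 2)
    (eventually_Icc_subset_lagRange two_pos)).congr fun n => ?_
  rw [sum_combArray_weightTwo, crossSqSum]

/-- The bracket is the limiting exponent in `IsRefiningArray.tendsto_charFun`, so this identity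
gives both positivity of the matrix and the form of the limit law. -/
lemma dotProduct_SigmaMat_mulVec (γ : ℝ) (C : ℝ → ℝ → ℝ) (g₀ gt : ℝ → ℝ) (x : Fin 2 → ℝ) :
    x ⬝ᵥ (SigmaMat γ C g₀ gt).mulVec x = 2 * (x 0 ^ 2 * (sigmaSq γ C g₀ gt / 2) +
      x 0 * x 1 * 2 ^ (γ - 2) * sigmaStarSq γ C g₀ gt + x 1 ^ 2 / 2 * (sigmaSq γ C g₀ gt / 2)) := by
  simp [SigmaMat, dotProduct, Matrix.mulVec, Fin.sum_univ_two]
  ring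

variable {Ω : Type*}

/-- The deterministic part of `centeredV`. -/
def bias (R : ℝ → ℝ → ℝ) (γ : ℝ) (L φ : ℝ → ℝ) {q : ℕ} (g : Fin (q + 1) → ℝ → ℝ) (ν : Fin q → ℝ)
    (N : ℕ) : ℝ :=
  1 / (N : ℝ) * ∑ k ∈ Finset.Ico 1 N, entries R γ L N k k - (∫ x in (0 : ℝ)..1, g 0 x) -
    ∑ i : Fin q, (∫ x in (0 : ℝ)..1, g i.succ x) * φ (1 / (N : ℝ)) ^ ν i

lemma centeredV_eq (X : ℝ → Ω → ℝ) (R : ℝ → ℝ → ℝ) (hL : IsSlowlyVarying L) (N : ℕ) (ω : Ω) :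
    centeredV X γ L φ g ν N ω = 1 / (N : ℝ) *
      ∑ k ∈ Finset.Ico 1 N, (normIncr X γ L N k ω ^ 2 - entries R γ L N k k) +
        bias R γ L φ g ν N := by
  rw [centeredV, variation_eq_sum X hL, bias, Finset.sum_sub_distrib]
  ring

/-- Separates the centred quadratic form from the deterministic bias. The factor (√2)⁻¹ appears
because the bias at level 2n is naturally multiplied by √(2n). -/
lemma sqrt_mul_centeredV_eq (X : ℝ → Ω → ℝ) (R : ℝ → ℝ → ℝ) (hL : IsSlowlyVarying L) {n : ℕ}
    (hn : 0 < n) (a b : ℝ) (ω : Ω) :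
    a * (√(n : ℝ) * centeredV X γ L φ g ν n ω) + b * (√(n : ℝ) * centeredV X γ L φ g ν (2 * n) ω) =
      (a / √n * ∑ k ∈ Finset.Ico 1 n, (normIncr X γ L n k ω ^ 2 - entries R γ L n k k) +
        b / (2 * √n) * ∑ k ∈ Finset.Ico 1 (2 * n),
          (normIncr X γ L (2 * n) k ω ^ 2 - entries R γ L (2 * n) k k)) +
      (a * (√(n : ℝ) * bias R γ L φ g ν n) +
        b * (√2)⁻¹ * (√((2 * n : ℕ) : ℝ) * bias R γ L φ g ν (2 * n))) := by
  have hn' : (0 : ℝ) < n := by exact_mod_cast hn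
  have hs : 0 < √(n : ℝ) := Real.sqrt_pos.2 hn'
  have e1 : √(n : ℝ) * (1 / n) = 1 / √n := by
    rw [mul_one_div, Real.sqrt_div_self, one_div]
  have e2 : √(n : ℝ) * (1 / (2 * n : ℕ)) = 1 / (2 * √n) := by
    push_cast
    rw [← div_div, div_right_comm, mul_div_assoc', e1, div_div, mul_comm]
  have e3 : (√2)⁻¹ * √((2 * n : ℕ) : ℝ) = √n := by
    push_cast
    rw [Real.sqrt_mul (by norm_num), inv_mul_cancel_left₀ (by positivity)]
  rw [centeredV_eq X R hL, centeredV_eq X R hL]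
  linear_combination
    a * (∑ k ∈ Finset.Ico 1 n, (normIncr X γ L n k ω ^ 2 - entries R γ L n k k)) * e1 +
    b * (∑ k ∈ Finset.Ico 1 (2 * n),
      (normIncr X γ L (2 * n) k ω ^ 2 - entries R γ L (2 * n) k k)) * e2 -
    b * bias R γ L φ g ν (2 * n) * e3

variable [MeasurableSpace Ω] {P : Measure Ω} {X : ℝ → Ω → ℝ}

lemma aemeasurable_centeredV (hX : ∀ t ∈ Icc (0 : ℝ) 1, AEMeasurable (X t) P) (N : ℕ) :
    AEMeasurable (centeredV X γ L φ g ν N) P := by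
  have hV : AEMeasurable (V X N) P := by
    unfold V
    refine Finset.aemeasurable_fun_sum _ fun k hk => ?_
    obtain ⟨h1, h2, h3⟩ := grid_mem hk
    exact (((hX _ h1).add (hX _ h2)).sub ((hX _ h3).const_mul 2)).pow_const 2
  unfold centeredV
  exact ((hV.const_mul _).sub_const _).sub_const _

theorem posSemidef_and_tendstoInDistribution [IsProbabilityMeasure P]
    (hX : IsGaussianProcess (fun t : Icc (0 : ℝ) 1 => X t) P)
    (hcent : ∀ t ∈ Icc (0 : ℝ) 1, ∫ ω, X t ω ∂P = 0)
    (hR : ∀ s ∈ Icc (0 : ℝ) 1, ∀ t ∈ Icc (0 : ℝ) 1, R s t = cov[X s, X t; P])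
    (H : IsSingularKernel R D C γ L) (E : HasDiagonalExpansion R γ L g ν φ gt) :
    (SigmaMat γ C (g 0) gt).PosSemidef ∧
    TendstoInDistribution
      (fun (n : ℕ) (ω : Ω) =>
        (!₂[√(n : ℝ) * centeredV X γ L φ g ν n ω,
            √(n : ℝ) * centeredV X γ L φ g ν (2 * n) ω] : EuclideanSpace ℝ (Fin 2)))
      atTop (id : EuclideanSpace ℝ (Fin 2) → EuclideanSpace ℝ (Fin 2))
      (fun _ => P) (multivariateGaussian 0 (SigmaMat γ C (g 0) gt)) := by
  have A := isRefiningArray_normIncr (γ := γ) hX hcent hR H.slow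
  have hc := isDecayingArray_entries H E A.isPSDOn
  have lim := A.tendsto_charFun hc (tendsto_sqSum_entries H E hc) (tendsto_scaleFactor_sq H.slow)
    (tendsto_crossSqSum_entries H E hc)
  have hS : (SigmaMat γ C (g 0) gt).PosSemidef := by
    refine Matrix.PosSemidef.of_dotProduct_mulVec_nonneg ?_ fun x => ?_
    · ext i j
      fin_cases i <;> fin_cases j <;> simp [SigmaMat]
    · rw [star_trivial, dotProduct_SigmaMat_mulVec]
      exact mul_nonneg zero_le_two (lim (x 0) (x 1)).1
  have hm := fun N => aemeasurable_centeredV (γ := γ) (L := L) (φ := φ) (g := g) (ν := ν)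
    (fun t ht => hX.aemeasurable ⟨t, ht⟩) N
  have hmeas : ∀ n : ℕ, AEMeasurable (fun ω => (!₂[√(n : ℝ) * centeredV X γ L φ g ν n ω,
      √(n : ℝ) * centeredV X γ L φ g ν (2 * n) ω] : EuclideanSpace ℝ (Fin 2))) P := by
    intro n
    refine (WithLp.measurable_toLp 2 _).comp_aemeasurable (aemeasurable_pi_lambda _ fun i => ?_)
    fin_cases i
    · exact (hm n).const_mul _
    · exact (hm (2 * n)).const_mul _
  refine ⟨hS, hmeas, aemeasurable_id, ?_⟩
  -- Lévy's continuity theorem: the characteristic function at t is that of the combination with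
  -- coefficients a = t 0 and b = t 1.
  refine ProbabilityMeasure.tendsto_iff_tendsto_charFun.2 fun t => ?_
  simp only [ProbabilityMeasure.coe_mk, Measure.map_id]
  rw [charFun_multivariateGaussian hS]
  have hb1 : Tendsto (fun n : ℕ => √(n : ℝ) * bias R γ L φ g ν n) atTop (𝓝 0) := E.tendsto_bias
  have hb2 : Tendsto (fun n : ℕ => √((2 * n : ℕ) : ℝ) * bias R γ L φ g ν (2 * n)) atTop (𝓝 0) :=
    hb1.comp (tendsto_id.const_mul_atTop' two_pos)
  have hbias : Tendsto (fun n : ℕ => t 0 * (√(n : ℝ) * bias R γ L φ g ν n) +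
      t 1 * (√2)⁻¹ * (√((2 * n : ℕ) : ℝ) * bias R γ L φ g ν (2 * n))) atTop (𝓝 0) := by
    simpa only [mul_zero, add_zero] using
      (hb1.const_mul (t 0)).add (hb2.const_mul (t 1 * (√2)⁻¹))
  -- The bias enters only through a deterministic phase factor, which tends to 1.
  have hphase := (Complex.continuous_exp.tendsto _).comp
    (((Complex.continuous_ofReal.tendsto _).comp hbias).mul_const Complex.I)
  have main := (lim (t 0) (t 1)).2.mul hphase
  convert main.congr' ?_ using 2
  · rw [dotProduct_SigmaMat_mulVec]
    simp only [inner_zero_right, Complex.ofReal_zero, zero_mul, Complex.exp_zero, mul_one]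
    congr 1
    push_cast
    ring
  · filter_upwards [eventually_gt_atTop 0] with n hn
    rw [charFun_apply, integral_map (hmeas n) (by fun_prop), Function.comp, ← integral_mul_const]
    refine integral_congr_ae (Eventually.of_forall fun ω => ?_)
    have e : inner ℝ (!₂[√(n : ℝ) * centeredV X γ L φ g ν n ω,
        √(n : ℝ) * centeredV X γ L φ g ν (2 * n) ω] : EuclideanSpace ℝ (Fin 2)) t =
        t 0 * (√(n : ℝ) * centeredV X γ L φ g ν n ω) +
          t 1 * (√(n : ℝ) * centeredV X γ L φ g ν (2 * n) ω) := by
      simp [PiLp.inner_apply, Fin.sum_univ_two]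
    simp only
    rw [e, sqrt_mul_centeredV_eq X R H.slow hn, ← Complex.exp_add, ← add_mul]
    simp only [Function.comp, ← Complex.ofReal_add]

end Limit

end QuadVar

end

theorem theorem3 {Ω : Type*} [MeasurableSpace Ω] (P : Measure Ω) [IsProbabilityMeasure P]
    -- a centered Gaussian process on [0,1] (values of `X` off [0,1] play no role)
    (X : ℝ → Ω → ℝ)
    (hX : IsGaussianProcess (fun t : Icc (0 : ℝ) 1 => X t) P)
    (hcent : ∀ t ∈ Icc (0 : ℝ) 1, ∫ ω, X t ω ∂P = 0)
    -- its covariance function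
    (R : ℝ → ℝ → ℝ)
    (hR : ∀ s ∈ Icc (0 : ℝ) 1, ∀ t ∈ Icc (0 : ℝ) 1, R s t = covariance (X s) (X t) P)
    -- assumption 1
    (hRcont : ContinuousOn (fun p : ℝ × ℝ => R p.1 p.2) (Icc 0 1 ×ˢ Icc 0 1))
    -- assumption 2
    (D : ℝ → ℝ → ℝ) (hD : QuadVar.IsMixedDeriv R D)
    (C : ℝ → ℝ → ℝ)
    (hC : ContinuousOn (fun p : ℝ × ℝ => C p.1 p.2) {p | 0 ≤ p.2 ∧ p.2 ≤ p.1 ∧ p.1 ≤ 1})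
    (γ : ℝ) (hγ : γ ∈ Ioo (0 : ℝ) 2)
    (L : ℝ → ℝ) (hL : QuadVar.IsSlowlyVarying L)
    (hLbdd : ∀ a b : ℝ, 0 < a → b < 1 → BddAbove (L '' Icc a b))
    (hDC : ∀ s t : ℝ, 0 < t → t < s → s < 1 →
      (s - t) ^ (2 + γ) / L (s - t) * D s t = C s t)
    -- assumption 3
    (q : ℕ) (g : Fin (q + 1) → ℝ → ℝ) (ν : Fin q → ℝ) (φ : ℝ → ℝ)
    (hνpos : ∀ i, 0 < ν i) (hνmono : StrictMono ν)
    (hφpos : ∀ h ∈ Ioo (0 : ℝ) 1, 0 < φ h)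
    (hglip : ∀ i : Fin q, ∃ K : ℝ≥0, LipschitzOnWith K (g i.castSucc) (Ioo 0 1))
    (hgq : ∃ α K : ℝ≥0, 0 < α ∧ α ≤ 1 / 2 ∧
      HolderOnWith K (1 / 2 + α) (g (Fin.last q)) (Ioo 0 1))
    (hg0 : ∃ t ∈ Ioo (0 : ℝ) 1, g 0 t ≠ 0)
    (hexp : ∀ ε : ℝ, 0 < ε → ∀ᶠ h in 𝓝[>] (0 : ℝ), ∀ t ∈ Icc h (1 - h),
      1 / √h * |QuadVar.delta₁ h (QuadVar.delta₂ h R) t t / (h ^ (2 - γ) * L h) - g 0 t -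
        ∑ i : Fin q, g i.succ t * φ h ^ ν i| ≤ ε)
    (hφlim : q ≠ 0 → Tendsto φ (𝓝[>] 0) (𝓝 0))
    (gt : ℝ → ℝ) (hgtbdd : ∃ K : ℝ, ∀ t ∈ Ioo (0 : ℝ) 1, |gt t| ≤ K)
    (hgt : ∀ ε : ℝ, 0 < ε → ∀ᶠ h in 𝓝[>] (0 : ℝ), ∀ t ∈ Icc h (1 - 2 * h),
      |QuadVar.delta₁ h (QuadVar.delta₂ h R) (t + h) t / (h ^ (2 - γ) * L h) - gt t| ≤ ε) :
    -- Σ is a covariance matrix and the pair converges in law to N(0, Σ)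
    (QuadVar.SigmaMat γ C (g 0) gt).PosSemidef ∧
    TendstoInDistribution
      (fun (n : ℕ) (ω : Ω) =>
        (!₂[√(n : ℝ) * QuadVar.centeredV X γ L φ g ν n ω,
            √(n : ℝ) * QuadVar.centeredV X γ L φ g ν (2 * n) ω] : EuclideanSpace ℝ (Fin 2)))
      atTop (id : EuclideanSpace ℝ (Fin 2) → EuclideanSpace ℝ (Fin 2))
      (fun _ => P) (multivariateGaussian 0 (QuadVar.SigmaMat γ C (g 0) gt)) := by
  exact QuadVar.posSemidef_and_tendstoInDistribution hX hcent hR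
    ⟨hRcont, hD, hC, hγ, hL, hLbdd, hDC⟩
    ⟨hνpos, hglip, hgq, hexp, hφlim, hgtbdd, hgt⟩
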